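/- Let $\mathbb{K}$ be a field of characteristic zero, let $\mathcal{D},\mathcal{T}$ be nonempty sets, let $\lambda=(\lambda_t)_{t\in\mathcal{T}}\in\mathbb{K}^{\mathcal{T}}$ be any family of scalars and let $t_0\in\mathcal{T}$. A $\mathcal{D}$-decorated $\mathcal{T}$-typed forest is a finite rooted forest $F$ with maps $\mathrm{dec}:V(F)\to\mathcal{D}$ and $\mathrm{type}:E(F)\to\mathcal{T}$; it is a tree if it is connected. Let $\mathbb{T}_{\mathcal{D},\mathcal{T}}$ be the set of isomorphism classes of such trees, and $\mathcal{H}_{\mathcal{D},\mathcal{T}}$ the vector space generated by the isomorphism classes of such forests, which with the product given by disjoint union is the symmetric algebra generated by $\mathbb{T}_{\mathcal{D},\mathcal{T}}$. Let $\mathcal{H}^{CK_\lambda}_{\mathcal{D},\mathcal{T}}$ be this algebra with the multiplicative coproduct given on trees by $$\Delta^{CK_\lambda}(T)=T\otimes 1+1\otimes T+\sum_{c\in Adm(T)}\Bigl(\prod_{e\in c}\lambda_{\mathrm{type}(e)}\Bigr)R^c(T)\otimes P^c(T),$$ where $Adm(T)$ is the set of nonempty sets $c$ of edges of $T$ such that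 any path from the root to a leaf meets at most one edge in $c$, $R^c(T)$ is the connected component of $T\setminus c$ containing the root, and $P^c(T)$ is the product of the other components; the counit is the algebra morphism vanishing on all trees. For a set $\mathcal{D}'$, let $\mathcal{H}^{CK}_{\mathcal{D}'}$ be the (untyped) Connes–Kreimer algebra of $\mathcal{D}'$-decorated rooted forests, i.e. the case of a single type $t$ with $\lambda_t=1$. Let $\mathcal{D}'=\mathbb{T}^{(t_0)}_{\mathcal{D},\mathcal{T}}\subseteq\mathbb{T}_{\mathcal{D},\mathcal{T}}$ be the set of trees having no edge of type $t_0$ outgoing from the root. For a forest $F$, write $\{T_1,\ldots,T_k\}\triangleleft_{t_0}F$ if $\{T_1,\dots,T_k\}$ is a partition of $V(F)$ each block of which is, by restriction, a tree belonging to $\mathbb{T}^{(t_0)}_{\mathcal{D},\mathcal{T}}$; then $F/\{T_1,\ldots,T_k\}$ is the $\mathbb{T}^{(t_0)}_{\mathcal{D},\mathcal{T}}$-decorated forest obtained by contracting each $T_i$ to a single vertex decorated by $T_i$, and forgetting the types of the remaining edges. Then $\mathcal{H}^{CK_\lambda}_{\mathcal{D},\mathcal{T}}$ and $\mathcal{H}^{CK}_{\mathbb{T}^{(t_0)}_{\mathcal{D},\mathcal{T}}}$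 are Hopf algebras, and the linear map $\Psi^*_{t_0}:\mathcal{H}_{\mathcal{D},\mathcal{T}}\to\mathcal{H}_{\mathbb{T}^{(t_0)}_{\mathcal{D},\mathcal{T}}}$ given on every forest $F$ by $$\Psi^*_{t_0}(F)=\sum_{\{T_1,\ldots,T_k\}\triangleleft_{t_0}F}\Bigl(\prod_{e\in E(F)\setminus\sqcup_i E(T_i)}\lambda_{\mathrm{type}(e)}\Bigr)\,F/\{T_1,\ldots,T_k\}$$ is well defined and is a Hopf algebra morphism from $\mathcal{H}^{CK_\lambda}_{\mathcal{D},\mathcal{T}}$ to $\mathcal{H}^{CK}_{\mathbb{T}^{(t_0)}_{\mathcal{D},\mathcal{T}}}$. It is an isomorphism if, and only if, $\lambda_{t_0}\neq 0$. -/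

import Mathlib

open scoped TensorProduct

/-! ### Typed decorated rooted forests -/

/-- A `T`-typed `D`-decorated rooted forest with vertex set `V`. Each vertex `v` has a decoration
`dec v`, and is either a root (`up v = none`), or has a parent `w`, the edge between `w` and `v`
having type `t` (`up v = some (t, w)`). An edge is thus identified with its lower endpoint `v`.
There are no cycles: the relation "is the parent of" is well-founded. -/
structure TypedForest (D T V : Type*) where
  dec : V → D
  up : V → Option (T × V)
  wf : WellFounded fun u v => ∃ t, up v = some (t, u)

namespace TypedForest

variable {D T V W : Type*}

/-- `u` is the parent of `v`. -/
def Parent (F : TypedForest D T V) (u v : V) : Prop := ∃ t, F.up v = some (t, u)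

/-- `u` is an ancestor of `v`, or `u = v`. -/
def Anc (F : TypedForest D T V) : V → V → Prop := Relation.ReflTransGen F.Parent

/-- `v` is a root. -/
def IsRoot (F : TypedForest D T V) (v : V) : Prop := F.up v = none

/-- `v` is a leaf. -/
def IsLeaf (F : TypedForest D T V) (v : V) : Prop := ∀ w, ¬ F.Parent v w

/-- A tree is a forest with exactly one root (for finite forests this is connectedness). -/
def IsTree (F : TypedForest D T V) : Prop := ∃! r, F.IsRoot r

/-- The root of a tree. -/
noncomputable def root (F : TypedForest D T V) (h : F.IsTree) : V := h.exists.choose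

theorem isRoot_root (F : TypedForest D T V) (h : F.IsTree) : F.IsRoot (F.root h) :=
  h.exists.choose_spec

/-- No edge outgoing from a root has type `t₀`. -/
def RootAvoids (F : TypedForest D T V) (t₀ : T) : Prop :=
  ∀ r, F.IsRoot r → ∀ v, F.up v ≠ some (t₀, r)

/-- Renaming the vertices. -/
def transport (F : TypedForest D T V) (e : V ≃ W) : TypedForest D T W where
  dec w := F.dec (e.symm w)
  up w := (F.up (e.symm w)).map (Prod.map id e)
  wf := by
    refine Subrelation.wf ?_ (InvImage.wf e.symm F.wf)
    rintro u v ⟨t, h⟩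
    rw [Option.map_eq_some_iff] at h
    obtain ⟨⟨t', x⟩, hx, h⟩ := h
    simp only [Prod.map_apply, id_eq, Prod.mk.injEq] at h
    refine ⟨t', ?_⟩
    rw [hx, ← h.2, e.symm_apply_apply]

/-- The subforest induced on a set `S` of vertices: decorations and types are restricted, and an
edge is kept when both its endpoints belong to `S`. -/
noncomputable def restrict (F : TypedForest D T V) (S : Set V) : TypedForest D T S where
  dec v := F.dec v
  up v := (F.up v).bind fun p =>
    open Classical in if h : p.2 ∈ S then some (p.1, ⟨p.2, h⟩) else none
  wf := by
    refine Subrelation.wf ?_ (InvImage.wf Subtype.val F.wf)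
    rintro u v ⟨t, h⟩
    rw [Option.bind_eq_some_iff] at h
    obtain ⟨⟨t', x⟩, hx, h⟩ := h
    split_ifs at h with hS
    simp only [Option.some.injEq, Prod.mk.injEq] at h
    refine ⟨t', ?_⟩
    rw [hx, ← h.2]

/-- The forest obtained by deleting the edges in `c`. -/
noncomputable def cut (F : TypedForest D T V) (c : Finset V) : TypedForest D T V where
  dec := F.dec
  up v := open Classical in if v ∈ c then none else F.up v
  wf := by
    refine Subrelation.wf ?_ F.wf
    rintro u v ⟨t, h⟩
    split_ifs at h
    exact ⟨t, h⟩

/-- The value of `lam` at the type of the edge whose lower endpoint is `v`. -/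
def edgeWeight {K : Type*} [One K] (F : TypedForest D T V) (lam : T → K) (v : V) : K :=
  match F.up v with
  | none => 1
  | some p => lam p.1

/-- Admissible cuts: nonempty sets of edges such that any path from a root to a leaf meets at most
one of them. (The edges on the path from the root to `l` are those whose lower endpoint is an
ancestor of `l` or `l` itself.) -/
def IsAdmissibleCut (F : TypedForest D T V) (c : Finset V) : Prop :=
  c.Nonempty ∧ (∀ v ∈ c, ¬ F.IsRoot v) ∧
    ∀ l, F.IsLeaf l → ∀ u ∈ c, ∀ v ∈ c, F.Anc u l → F.Anc v l → u = v

/-! ### Isomorphisms -/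

/-- `e` is an isomorphism of typed decorated forests. -/
def IsIso (F : TypedForest D T V) (G : TypedForest D T W) (e : V ≃ W) : Prop :=
  (∀ v, G.dec (e v) = F.dec v) ∧ ∀ v, G.up (e v) = (F.up v).map (Prod.map id e)

theorem isIso_transport (F : TypedForest D T V) (e : V ≃ W) : F.IsIso (F.transport e) e := by
  constructor <;> intro v <;> simp [transport]

theorem IsIso.refl (F : TypedForest D T V) : F.IsIso F (Equiv.refl V) := by
  constructor <;> intro v <;> simp

theorem IsIso.trans {X : Type*} {F : TypedForest D T V} {G : TypedForest D T W}
    {H : TypedForest D T X} {e : V ≃ W} {f : W ≃ X} (h : F.IsIso G e) (k : G.IsIso H f) :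
    F.IsIso H (e.trans f) := by
  constructor <;> intro v
  · simp [h.1, k.1]
  · simp only [Equiv.trans_apply, k.2, h.2, Option.map_map]
    rfl

theorem IsIso.symm {F : TypedForest D T V} {G : TypedForest D T W}
    {e : V ≃ W} (h : F.IsIso G e) : G.IsIso F e.symm := by
  constructor <;> intro v
  · rw [← h.1, e.apply_symm_apply]
  · have := h.2 (e.symm v)
    rw [e.apply_symm_apply] at this
    rw [this, Option.map_map]
    have hid : (Prod.map id e.symm ∘ Prod.map id e : T × V → T × V) = id := by
      funext p; exact Prod.ext rfl (e.symm_apply_apply p.2)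
    rw [hid, Option.map_id_apply]

section iso

variable {F : TypedForest D T V} {G : TypedForest D T W} {e : V ≃ W}

theorem IsIso.up_eq_some (h : F.IsIso G e) {t : T} {u v : V} :
    G.up (e v) = some (t, e u) ↔ F.up v = some (t, u) := by
  rw [h.2]
  cases F.up v <;> simp [Prod.ext_iff]

theorem IsIso.parent (h : F.IsIso G e) {u v : V} : G.Parent (e u) (e v) ↔ F.Parent u v :=
  exists_congr fun _ => h.up_eq_some

theorem IsIso.isRoot (h : F.IsIso G e) {v : V} : G.IsRoot (e v) ↔ F.IsRoot v := by
  simp [IsRoot, h.2]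

theorem IsIso.isLeaf (h : F.IsIso G e) {v : V} : G.IsLeaf (e v) ↔ F.IsLeaf v := by
  refine ⟨fun k w hw => k (e w) (h.parent.2 hw), fun k w hw => ?_⟩
  obtain ⟨w, rfl⟩ := e.surjective w
  exact k w (h.parent.1 hw)

theorem IsIso.anc_of (h : F.IsIso G e) {u v : V} (k : F.Anc u v) : G.Anc (e u) (e v) :=
  Relation.ReflTransGen.lift (p := G.Parent) e (fun _ _ => h.parent.2) _ _ k

theorem IsIso.anc (h : F.IsIso G e) {u v : V} : G.Anc (e u) (e v) ↔ F.Anc u v := by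
  refine ⟨fun k => ?_, h.anc_of⟩
  simpa using h.symm.anc_of k

theorem IsIso.isTree (h : F.IsIso G e) (hF : F.IsTree) : G.IsTree := by
  obtain ⟨r, hr, hu⟩ := hF
  refine ⟨e r, h.isRoot.2 hr, fun s hs => ?_⟩
  rw [← hu (e.symm s) (h.symm.isRoot.2 hs), e.apply_symm_apply]

theorem IsIso.root (h : F.IsIso G e) (hF : F.IsTree) (hG : G.IsTree) :
    e (F.root hF) = G.root hG :=
  hG.unique (h.isRoot.2 (F.isRoot_root hF)) (G.isRoot_root hG)

theorem IsIso.rootAvoids (h : F.IsIso G e) {t₀ : T} (k : F.RootAvoids t₀) : G.RootAvoids t₀ := by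
  intro r hr v hv
  refine k (e.symm r) (h.symm.isRoot.2 hr) (e.symm v) (h.symm.up_eq_some.2 hv)

theorem IsIso.edgeWeight {K : Type*} [One K] (h : F.IsIso G e) (lam : T → K) (v : V) :
    G.edgeWeight lam (e v) = F.edgeWeight lam v := by
  unfold TypedForest.edgeWeight
  rw [h.2]
  cases F.up v <;> rfl

theorem IsIso.cut (h : F.IsIso G e) (c : Finset V) :
    (F.cut c).IsIso (G.cut (c.map e.toEmbedding)) e := by
  refine ⟨h.1, fun v => ?_⟩
  by_cases hv : v ∈ c <;> simp [TypedForest.cut, hv, h.2]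

theorem IsIso.restrict (h : F.IsIso G e) {S : Set V} {R : Set W} (hS : ∀ v, v ∈ S ↔ e v ∈ R) :
    (F.restrict S).IsIso (G.restrict R) (e.subtypeEquiv hS) := by
  refine ⟨fun v => h.1 v, fun v => ?_⟩
  simp only [TypedForest.restrict, Equiv.subtypeEquiv_apply, h.2]
  cases F.up v with
  | none => rfl
  | some p =>
    by_cases hp : p.2 ∈ S
    · have := (hS _).1 hp
      simp [hp, this]
    · have := (hS _).not.1 hp
      simp [hp, this]

theorem IsIso.isAdmissibleCut (h : F.IsIso G e) {c : Finset V} (k : F.IsAdmissibleCut c) :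
    G.IsAdmissibleCut (c.map e.toEmbedding) := by
  obtain ⟨h1, h2, h3⟩ := k
  refine ⟨h1.map, ?_, ?_⟩
  · intro w hw
    obtain ⟨v, hv, rfl⟩ := Finset.mem_map.1 hw
    exact fun hr => h2 v hv (h.isRoot.1 hr)
  · intro l hl u' hu' v' hv' hul hvl
    obtain ⟨u, hu, rfl⟩ := Finset.mem_map.1 hu'
    obtain ⟨v, hv, rfl⟩ := Finset.mem_map.1 hv'
    obtain ⟨l, rfl⟩ := e.surjective l
    exact congrArg e (h3 l (h.isLeaf.1 hl) u hu v hv (h.anc.1 hul) (h.anc.1 hvl))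

end iso

/-- The vertices below a vertex `v` (including `v`) form a tree with root `v`. -/
theorem isTree_restrict_anc (F : TypedForest D T V) (v : V) :
    (F.restrict {w | F.Anc v w}).IsTree := by
  have key : ∀ w, F.Anc v w → ¬ F.Parent w v := by
    intro w hw hp
    have h1 : Relation.TransGen F.Parent v v := Relation.TransGen.tail' hw hp
    have hwf : WellFounded (Relation.TransGen F.Parent) := WellFounded.transGen F.wf
    exact hwf.irrefl.irrefl v h1
  refine ⟨⟨v, Relation.ReflTransGen.refl⟩, ?_, ?_⟩
  · simp only [IsRoot, restrict, Option.bind_eq_none_iff]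
    rintro ⟨t, w⟩ hw
    rw [dif_neg]
    exact fun hS => key w hS ⟨t, hw⟩
  · rintro ⟨x, hx⟩ hr
    refine Subtype.ext ?_
    rcases Relation.ReflTransGen.cases_tail hx with h | ⟨y, hy, t, hyx⟩
    · exact h
    · have hy' : F.Anc v y := hy
      simp [IsRoot, restrict, hyx, hy'] at hr

end TypedForest

/-! ### Isomorphism classes of trees -/

/-- Finite typed decorated trees are isomorphic. -/
instance typedTreeSetoid (D T : Type*) :
    Setoid (Σ n : ℕ, {F : TypedForest D T (Fin n) // F.IsTree}) where
  r x y := ∃ e : Fin x.1 ≃ Fin y.1, x.2.1.IsIso y.2.1 e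
  iseqv :=
    { refl := fun x => ⟨_, TypedForest.IsIso.refl x.2.1⟩
      symm := fun ⟨_, h⟩ => ⟨_, h.symm⟩
      trans := fun ⟨_, h⟩ ⟨_, k⟩ => ⟨_, h.trans k⟩ }

/-- The set of isomorphism classes of finite `T`-typed `D`-decorated trees. -/
def TypedTree (D T : Type*) : Type _ := Quotient (typedTreeSetoid D T)

/-- The isomorphism class of a tree with an arbitrary finite vertex set. -/
noncomputable def TypedForest.cls {D T V : Type*} [Finite V] (F : TypedForest D T V)
    (h : F.IsTree) : TypedTree D T :=
  Quotient.mk (typedTreeSetoid D T)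
    ⟨Nat.card V, F.transport (Finite.equivFin V), (F.isIso_transport _).isTree h⟩

theorem TypedForest.IsIso.cls {D T V W : Type*} [Finite V] [Finite W] {F : TypedForest D T V}
    {G : TypedForest D T W} {e : V ≃ W} (h : F.IsIso G e) (hF : F.IsTree) (hG : G.IsTree) :
    F.cls hF = G.cls hG :=
  Quotient.sound ⟨_, ((F.isIso_transport _).symm.trans h).trans (G.isIso_transport _)⟩

/-- No edge outgoing from the root has type `t₀`. -/
def TypedTree.RootAvoids {D T : Type*} (τ : TypedTree D T) (t₀ : T) : Prop :=
  Quotient.liftOn (s := typedTreeSetoid D T) τ (fun x => x.2.1.RootAvoids t₀) fun _ _ he =>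
    he.elim fun _ h => propext ⟨h.rootAvoids, h.symm.rootAvoids⟩

theorem TypedForest.rootAvoids_cls {D T V : Type*} [Finite V] (F : TypedForest D T V)
    (h : F.IsTree) {t₀ : T} (k : F.RootAvoids t₀) : (F.cls h).RootAvoids t₀ :=
  (F.isIso_transport _).rootAvoids k

/-- The set of trees with no edge of type `t₀` outgoing from the root. -/
abbrev AvoidingTree (D T : Type*) (t₀ : T) : Type _ := {τ : TypedTree D T // τ.RootAvoids t₀}

/-- The class of the tree formed by `v` and all the vertices below it. When `v` is a root, this is
the connected component of `v`. -/
noncomputable def TypedForest.branch {D T V : Type*} [Finite V] (F : TypedForest D T V) (v : V) :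
    TypedTree D T :=
  (F.restrict {w | F.Anc v w}).cls (F.isTree_restrict_anc v)

theorem TypedForest.IsIso.branch {D T V W : Type*} [Finite V] [Finite W] {F : TypedForest D T V}
    {G : TypedForest D T W} {e : V ≃ W} (h : F.IsIso G e) (v : V) :
    G.branch (e v) = F.branch v :=
  ((h.restrict fun _ => h.anc.symm).cls _ _).symm

/-! ### The Hopf algebra -/

/-- The algebra of typed decorated forests: the symmetric algebra on the vector space with basis the
set of typed decorated trees. Its monomials are the forests and its product is disjoint union. -/
abbrev ForestAlg (K D T : Type*) [CommRing K] : Type _ := MvPolynomial (TypedTree D T) K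

/-- A forest, seen as the product of its connected components. -/
noncomputable def TypedForest.mono (K : Type*) [CommRing K] {D T V : Type*} [Fintype V]
    (F : TypedForest D T V) : ForestAlg K D T :=
  open Classical in ∏ r : V with F.IsRoot r, MvPolynomial.X (F.branch r)

section Coproduct

variable {K D T : Type*} [CommRing K]

/-- `R^c(F)`: the component of the root after deletion of the edges in `c`. -/
noncomputable def TypedForest.trunk (K : Type*) [CommRing K] {V : Type*} [Fintype V]
    (F : TypedForest D T V) (h : F.IsTree) (c : Finset V) : ForestAlg K D T :=
  MvPolynomial.X ((F.cut c).branch (F.root h))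

/-- `P^c(F)`: the product of the other components after deletion of the edges in `c`; their roots
are the lower endpoints of the edges in `c`. -/
noncomputable def TypedForest.pruned (K : Type*) [CommRing K] {V : Type*} [Fintype V]
    (F : TypedForest D T V) (c : Finset V) : ForestAlg K D T :=
  ∏ v ∈ c, MvPolynomial.X ((F.cut c).branch v)

/-- `T ⊗ 1 + 1 ⊗ T + ∑_c (∏_{e ∈ c} λ_{type(e)}) R^c(T) ⊗ P^c(T)`, the sum being over the
admissible cuts of the tree `T`. -/
noncomputable def TypedForest.treeCoproduct {V : Type*} [Fintype V] (lam : T → K)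
    (F : TypedForest D T V) (h : F.IsTree) : ForestAlg K D T ⊗[K] ForestAlg K D T :=
  MvPolynomial.X (F.cls h) ⊗ₜ[K] 1 + 1 ⊗ₜ[K] MvPolynomial.X (F.cls h) +
    open Classical in ∑ c : Finset V with F.IsAdmissibleCut c,
      (∏ v ∈ c, F.edgeWeight lam v) • (F.trunk K h c ⊗ₜ[K] F.pruned K c)

theorem TypedForest.IsIso.treeCoproduct {V W : Type*} [Fintype V] [Fintype W] (lam : T → K)
    {F : TypedForest D T V} {G : TypedForest D T W} {e : V ≃ W} (h : F.IsIso G e)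
    (hF : F.IsTree) (hG : G.IsTree) : F.treeCoproduct lam hF = G.treeCoproduct lam hG := by
  unfold TypedForest.treeCoproduct
  rw [h.cls hF hG]
  congr 1
  refine Finset.sum_equiv e.finsetCongr ?_ ?_
  · intro c
    simp only [Finset.mem_filter, Finset.mem_univ, true_and, Equiv.finsetCongr_apply]
    refine ⟨h.isAdmissibleCut, fun k => ?_⟩
    have := h.symm.isAdmissibleCut k
    rwa [Finset.map_map, ← Equiv.trans_toEmbedding, Equiv.self_trans_symm,
      Equiv.refl_toEmbedding, Finset.map_refl] at this
  · intro c _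
    simp only [Equiv.finsetCongr_apply, TypedForest.trunk, TypedForest.pruned, Finset.prod_map,
      Equiv.coe_toEmbedding, ← h.root hF hG, (h.cut c).branch, h.edgeWeight]

/-- The coproduct `Δ^{CK_λ}`: the algebra morphism given on trees by admissible cuts. -/
noncomputable def ckComul (lam : T → K) :
    ForestAlg K D T →ₐ[K] ForestAlg K D T ⊗[K] ForestAlg K D T :=
  MvPolynomial.aeval fun τ : TypedTree D T =>
    Quotient.liftOn (s := typedTreeSetoid D T) τ (fun x => x.2.1.treeCoproduct lam x.2.2)
      fun _ _ he => he.elim fun _ h => h.treeCoproduct lam _ _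

/-- The counit: it vanishes on every nonempty forest. -/
noncomputable def ckCounit (K D T : Type*) [CommRing K] : ForestAlg K D T →ₐ[K] K :=
  MvPolynomial.aeval fun _ => 0

end Coproduct

/-- The algebra `A`, with the multiplicative coproduct `Δ`, the multiplicative counit `ε` and the
antipode `S`, is a Hopf algebra. -/
structure IsHopfAlgebra {K A : Type*} [CommRing K] [CommRing A] [Algebra K A]
    (Δ : A →ₐ[K] A ⊗[K] A) (ε : A →ₐ[K] K) (S : A →ₗ[K] A) : Prop where
  coassoc : (TensorProduct.assoc K A A A).toLinearMap ∘ₗ Δ.toLinearMap.rTensor A ∘ₗ Δ.toLinearMap =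
    Δ.toLinearMap.lTensor A ∘ₗ Δ.toLinearMap
  counit_left : ε.toLinearMap.rTensor A ∘ₗ Δ.toLinearMap = TensorProduct.mk K K A 1
  counit_right : ε.toLinearMap.lTensor A ∘ₗ Δ.toLinearMap = (TensorProduct.mk K A K).flip 1
  antipode_left : LinearMap.mul' K A ∘ₗ S.rTensor A ∘ₗ Δ.toLinearMap =
    Algebra.linearMap K A ∘ₗ ε.toLinearMap
  antipode_right : LinearMap.mul' K A ∘ₗ S.lTensor A ∘ₗ Δ.toLinearMap =
    Algebra.linearMap K A ∘ₗ ε.toLinearMap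

/-- The linear map `Ψ` is a morphism of Hopf algebras from `(A, Δ, ε, S)` to `(A', Δ', ε', S')`. -/
structure IsHopfMorphism {K A A' : Type*} [CommRing K] [CommRing A] [Algebra K A]
    [CommRing A'] [Algebra K A']
    (Δ : A →ₐ[K] A ⊗[K] A) (ε : A →ₐ[K] K) (S : A →ₗ[K] A)
    (Δ' : A' →ₐ[K] A' ⊗[K] A') (ε' : A' →ₐ[K] K) (S' : A' →ₗ[K] A')
    (Ψ : A →ₗ[K] A') : Prop where
  map_one : Ψ 1 = 1
  map_mul : ∀ x y, Ψ (x * y) = Ψ x * Ψ y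
  map_comul : ∀ x, Δ' (Ψ x) = TensorProduct.map Ψ Ψ (Δ x)
  map_counit : ∀ x, ε' (Ψ x) = ε x
  map_antipode : ∀ x, S' (Ψ x) = Ψ (S x)

/-! ### Contraction -/

namespace TypedForest

variable {D T V : Type*}

/-- The block `q` of the partition of the vertex set `V` into the classes of `s`. -/
def block (s : Setoid V) (q : Quotient s) : Set V := {v | Quotient.mk s v = q}

/-- The partition of the vertices of `F` into the classes of `s` is such that each block is, by
restriction, a tree with no edge of type `t₀` outgoing from its root. -/
def IsTreePartition (F : TypedForest D T V) (t₀ : T) (s : Setoid V) : Prop :=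
  ∀ q : Quotient s, (F.restrict (block s q)).IsTree ∧ (F.restrict (block s q)).RootAvoids t₀

section contract

variable {F : TypedForest D T V} {t₀ : T} {s : Setoid V}

/-- The vertex of `F` that is the root of the block `q`. -/
noncomputable def blockRoot (h : F.IsTreePartition t₀ s) (q : Quotient s) : V :=
  (F.restrict (block s q)).root (h q).1

theorem mk_blockRoot (h : F.IsTreePartition t₀ s) (q : Quotient s) :
    Quotient.mk s (blockRoot h q) = q :=
  ((F.restrict (block s q)).root (h q).1).2

theorem anc_blockRoot (h : F.IsTreePartition t₀ s) (v : V) :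
    F.Anc (blockRoot h (Quotient.mk s v)) v := by
  induction v using F.wf.induction with
  | _ v ih =>
    by_cases hv : (F.restrict (block s (Quotient.mk s v))).IsRoot ⟨v, rfl⟩
    · have := (h (Quotient.mk s v)).1.unique hv (isRoot_root _ (h (Quotient.mk s v)).1)
      have h2 : v = blockRoot h (Quotient.mk s v) := congrArg Subtype.val this
      rw [← h2]
      exact Relation.ReflTransGen.refl
    · simp only [IsRoot, restrict, Option.bind_eq_none_iff, not_forall] at hv
      obtain ⟨⟨t, w⟩, hw, hS⟩ := hv
      by_cases hm : w ∈ block s (Quotient.mk s v)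
      · have h3 := ih w ⟨t, hw⟩
        have hm' : Quotient.mk s w = Quotient.mk s v := hm
        rw [hm'] at h3
        exact h3.tail ⟨t, hw⟩
      · exact absurd (dif_neg hm) hS

/-- The contracted forest: each block becomes a single vertex, decorated by the block; the edges
between different blocks remain, without their type. -/
noncomputable def contract [Finite V] (h : F.IsTreePartition t₀ s) :
    TypedForest (AvoidingTree D T t₀) Unit (Quotient s) where
  dec q := ⟨(F.restrict (block s q)).cls (h q).1, rootAvoids_cls _ _ (h q).2⟩
  up q := (F.up (blockRoot h q)).map fun p => ((), Quotient.mk s p.2)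
  wf := by
    refine Subrelation.wf ?_ (InvImage.wf (blockRoot h) (WellFounded.transGen F.wf))
    rintro q q' ⟨_, hq⟩
    rw [Option.map_eq_some_iff] at hq
    obtain ⟨⟨t, w⟩, hw, hq⟩ := hq
    simp only [Prod.mk.injEq, true_and] at hq
    subst hq
    exact Relation.TransGen.tail' (anc_blockRoot h w) ⟨t, hw⟩

end contract

/-- The product of the `λ_{type(e)}` over the edges `e` of `F` that are not inside a block. -/
noncomputable def outerWeight {K : Type*} [CommRing K] [Fintype V] (lam : T → K)
    (F : TypedForest D T V) (s : Setoid V) : K :=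
  open Classical in ∏ v : V with ∃ t w, F.up v = some (t, w) ∧ ¬ s v w, F.edgeWeight lam v

instance finite_setoid [Finite V] : Finite (Setoid V) :=
  Finite.of_injective (fun s : Setoid V => fun a b => s a b) fun _ _ h =>
    Setoid.ext fun a b => iff_of_eq (congrFun (congrFun h a) b)

/-- The sum, over the partitions of `F` into trees with no edge of type `t₀` outgoing from the root,
of the weighted contracted forests. -/
noncomputable def contractionSum {K : Type*} [CommRing K] [Fintype V] (lam : T → K) (t₀ : T)
    (F : TypedForest D T V) : ForestAlg K (AvoidingTree D T t₀) Unit :=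
  open Classical in
  letI := Fintype.ofFinite {s : Setoid V // F.IsTreePartition t₀ s}
  ∑ s : {s : Setoid V // F.IsTreePartition t₀ s}, F.outerWeight lam s.1 • (contract s.2).mono K

end TypedForest

/-- `Ψ` is the linear map sending each forest `F` to `contractionSum lam t₀ F`. -/
def IsContractionMap {K D T : Type*} [CommRing K] (lam : T → K) (t₀ : T)
    (Ψ : ForestAlg K D T →ₗ[K] ForestAlg K (AvoidingTree D T t₀) Unit) : Prop :=
  ∀ (V : Type) [Fintype V] (F : TypedForest D T V), Ψ (F.mono K) = F.contractionSum lam t₀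

/-!
A subforest is handled through its set of vertices. Call *trunk* of a forest a set of vertices that
contains the parent of each of its elements (a union of trunks of some of its trees). On a tree, an
admissible cut is the set of edges leaving a nonempty proper trunk, and the two primitive terms of
the coproduct correspond to the trunks `univ` and `∅`. As trunks of a disjoint union are unions of
trunks, the coproduct of *any* forest `F` is the sum over its trunks `U` of
`cutWeight U • F|_U ⊗ F|_{Uᶜ}` (`TypedForest.ckComul_mono`).

* *Hopf algebra.* Both sides of coassociativity are sums over the chains of two trunks
  (`TypedForest.ckComul_coassoc`). A left and a right antipode are defined on trees by recursion on
  the number of vertices, and they agree, being convolution inverses of the identity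
  (`TypedForest.exists_isHopfAlgebra`).

* *Hopf morphism.* The sum over the contractions of `F` is multiplicative, since no block meets two
  connected components (`TypedForest.contractionSum_eq_mul`). So `Ψ` exists, as the algebra morphism
  `TypedForest.contractionHom` prescribed on trees; it is unique because forests span. The trunks of
  a contracted forest are the trunks of `F` that are unions of blocks, and a partition saturating
  `U` amounts to a partition of `U` and one of `Uᶜ`; hence the compatibility with the coproducts
  (`TypedForest.ckComul_contractionSum`). A morphism of bialgebras preserves antipodes.

* *Bijectivity when `λ_{t₀} ≠ 0`.* The block of the root of a tree `τ` is a trunk `U` with no edge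
  of type `t₀` outgoing from the root, and the contracted tree is the contraction of `τ|_{Uᶜ}`
  grafted on a root decorated by `τ|_U`. Thus `Ψ` on trees is the composite of the map `rootExpansion`,
  sending `τ` to the sum over `U` of `cutWeight U • (τ|_U, τ|_{Uᶜ})`, and of the map
  `(α, s) ↦ B_α (Ψ s)`, where `B_α` grafts on a root decorated by `α`
  (`TypedForest.contractionHom_X`). Deleting all the `t₀`-edges at the root identifies trees with
  pairs (tree avoiding `t₀` at the root, forest) (`TypedTree.graftEquiv`), and for this
  identification `rootExpansion` is triangular with respect to the size of the first component,
  with powers of `λ_{t₀}` on the diagonal. It is therefore bijective, and the inverse of `Ψ` is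
  built by recursion on the number of vertices (`TypedForest.contractionHom_bijective`).

* *Failure when `λ_{t₀} = 0`.* The tree with two vertices joined by an edge of type `t₀` can only be
  contracted trivially, with weight `λ_{t₀}`, so that it is in the kernel.
-/

/-! ### Embeddings and induced subforests -/

namespace TypedForest

variable {D T V W X : Type*} {F : TypedForest D T V} {G : TypedForest D T W}
  {H : TypedForest D T X} {i : W → V} {j : X → V}

/-- `i` identifies `G` with the subforest of `F` induced on the range of `i`. Working with maps
rather than with `F.restrict (Set.range i)` makes it possible to compare restrictions of
restrictions, and the different models of a forest, without transporting vertices. -/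
structure IsEmb (G : TypedForest D T W) (F : TypedForest D T V) (i : W → V) : Prop where
  injective : Function.Injective i
  dec : ∀ w, F.dec (i w) = G.dec w
  up : ∀ t w w', G.up w = some (t, w') ↔ F.up (i w) = some (t, i w')

theorem isEmb_restrict (F : TypedForest D T V) (S : Set V) : (F.restrict S).IsEmb F (↑) := by
  refine ⟨Subtype.val_injective, fun _ => rfl, fun t w w' => ?_⟩
  simp only [restrict, Option.bind_eq_some_iff]
  constructor
  · rintro ⟨⟨t', x⟩, hx, h⟩
    split_ifs at h with hS
    simp only [Option.some.injEq, Prod.mk.injEq] at h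
    rw [hx, ← h.1, ← h.2]
  · intro h
    exact ⟨_, h, by simp⟩

theorem IsEmb.comp {k : X → W} (h : G.IsEmb F i) (h' : H.IsEmb G k) : H.IsEmb F (i ∘ k) :=
  ⟨h.injective.comp h'.injective, fun w => (h.dec _).trans (h'.dec w), fun t w w' =>
    (h'.up t w w').trans (h.up t _ _)⟩

/-- Embeddings factor through larger embeddings. -/
theorem IsEmb.factor (h : G.IsEmb F i) (h' : H.IsEmb F j) {f : W → X}
    (hf : ∀ w, j (f w) = i w) : G.IsEmb H f := by
  refine ⟨fun a b hab => h.injective ?_, fun w => ?_, fun t w w' => ?_⟩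
  · rw [← hf, ← hf, hab]
  · rw [← h.dec, ← h'.dec, hf]
  · rw [h.up, h'.up, hf, hf]

theorem IsIso.isEmb {e : V ≃ W} (h : F.IsIso G e) : F.IsEmb G e :=
  ⟨e.injective, h.1, fun _ _ _ => h.up_eq_some.symm⟩

theorem IsEmb.isIso {e : W ≃ V} (h : G.IsEmb F e) : G.IsIso F e := by
  refine ⟨h.dec, fun v => Option.ext ?_⟩
  rintro ⟨t, w⟩
  obtain ⟨w, rfl⟩ := e.surjective w
  rw [← h.up, Option.map_eq_some_iff]
  constructor
  · intro k
    exact ⟨_, k, rfl⟩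
  · rintro ⟨⟨t', x⟩, hx, h⟩
    simp only [Prod.map_apply, id_eq, Prod.mk.injEq, EmbeddingLike.apply_eq_iff_eq] at h
    rw [hx, h.1, h.2]

/-- An induced subforest depends only on its set of vertices, up to isomorphism. -/
theorem IsEmb.exists_isIso (h : G.IsEmb F i) (h' : H.IsEmb F j)
    (hr : Set.range i = Set.range j) : ∃ e : W ≃ X, G.IsIso H e ∧ ∀ w, j (e w) = i w := by
  let e : W ≃ X := (Equiv.ofInjective i h.injective).trans
    ((Equiv.setCongr hr).trans (Equiv.ofInjective j h'.injective).symm)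
  have he : ∀ w, j (e w) = i w := fun w => by
    simp only [e, Equiv.trans_apply]
    exact congrArg Subtype.val (Equiv.apply_symm_apply (Equiv.ofInjective j h'.injective) _)
  exact ⟨e, (h.factor h' he).isIso, he⟩

theorem IsEmb.parent (h : G.IsEmb F i) {u v : W} : F.Parent (i u) (i v) ↔ G.Parent u v :=
  exists_congr fun t => (h.up t v u).symm

theorem IsEmb.anc (h : G.IsEmb F i) {u v : W} (k : G.Anc u v) : F.Anc (i u) (i v) :=
  Relation.ReflTransGen.lift (p := F.Parent) i (fun _ _ => h.parent.2) _ _ k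

theorem Parent.unique {u u' v : V} (h : F.Parent u v) (h' : F.Parent u' v) : u = u' := by
  obtain ⟨t, h⟩ := h
  obtain ⟨t', h'⟩ := h'
  rw [h] at h'
  simp only [Option.some.injEq, Prod.mk.injEq] at h'
  exact h'.2

theorem Parent.not_isRoot {u v : V} (h : F.Parent u v) : ¬ F.IsRoot v := by
  obtain ⟨t, h⟩ := h
  simp [IsRoot, h]

theorem exists_parent {v : V} (h : ¬ F.IsRoot v) : ∃ u, F.Parent u v := by
  obtain ⟨⟨t, u⟩, h⟩ := Option.ne_none_iff_exists'.1 h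
  exact ⟨u, t, h⟩

theorem Anc.eq_of_isRoot {u v : V} (h : F.Anc u v) (hv : F.IsRoot v) : u = v := by
  rcases Relation.ReflTransGen.cases_tail h with h | ⟨y, -, hy⟩
  · exact h.symm
  · exact absurd hv hy.not_isRoot

theorem Anc.of_parent {u v w : V} (h : F.Anc u v) (hne : u ≠ v) (hw : F.Parent w v) :
    F.Anc u w := by
  rcases Relation.ReflTransGen.cases_tail h with h | ⟨y, hy, hyv⟩
  · exact absurd h.symm hne
  · rwa [hw.unique hyv]

theorem not_anc_of_parent {u v : V} (h : F.Parent u v) : ¬ F.Anc v u := fun k =>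
  (WellFounded.transGen F.wf).irrefl.irrefl v (Relation.TransGen.tail' k h)

theorem exists_isRoot_anc (F : TypedForest D T V) (v : V) : ∃ r, F.IsRoot r ∧ F.Anc r v := by
  induction v using F.wf.induction with
  | _ v ih =>
    by_cases hv : F.IsRoot v
    · exact ⟨v, hv, Relation.ReflTransGen.refl⟩
    · obtain ⟨u, hu⟩ := exists_parent hv
      obtain ⟨r, hr, h⟩ := ih u hu
      exact ⟨r, hr, h.tail hu⟩

theorem IsTree.anc (hF : F.IsTree) {r : V} (hr : F.IsRoot r) (v : V) : F.Anc r v := by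
  obtain ⟨r', hr', h⟩ := F.exists_isRoot_anc v
  rwa [hF.unique hr hr']

/-- The ancestors of a vertex form a chain. -/
theorem Anc.total {u v l : V} (h : F.Anc u l) (k : F.Anc v l) : F.Anc u v ∨ F.Anc v u := by
  induction l using F.wf.induction with
  | _ l ih =>
    by_cases hu : u = l
    · exact Or.inr (hu ▸ k)
    by_cases hv : v = l
    · exact Or.inl (hv ▸ h)
    rcases Relation.ReflTransGen.cases_tail h with h' | ⟨y, hy, hyl⟩
    · exact absurd h'.symm hu
    · exact ih y hyl hy (k.of_parent hv hyl)

/-- If the range of `i` contains the parents of its elements, roots of `G` are roots of `F`. -/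
theorem IsEmb.isRoot (h : G.IsEmb F i)
    (hi : ∀ u v, F.Parent u v → v ∈ Set.range i → u ∈ Set.range i) {w : W} :
    F.IsRoot (i w) ↔ G.IsRoot w := by
  refine ⟨fun hr => ?_, fun hr => ?_⟩
  · by_contra hn
    obtain ⟨u, hu⟩ := exists_parent hn
    exact (h.parent.2 hu).not_isRoot hr
  · by_contra hn
    obtain ⟨u, hu⟩ := exists_parent hn
    obtain ⟨u, rfl⟩ := hi _ _ hu ⟨w, rfl⟩
    exact (h.parent.1 hu).not_isRoot hr

theorem IsEmb.exists_of_anc (h : G.IsEmb F i)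
    (hi : ∀ u v, F.Parent u v → u ∈ Set.range i → v ∈ Set.range i) {w : W} {x : V}
    (hx : F.Anc (i w) x) : ∃ w', i w' = x ∧ G.Anc w w' := by
  induction hx with
  | refl => exact ⟨w, rfl, Relation.ReflTransGen.refl⟩
  | tail _ hp ih =>
    obtain ⟨w', rfl, hw'⟩ := ih
    obtain ⟨w'', rfl⟩ := hi _ _ hp ⟨w', rfl⟩
    exact ⟨w'', rfl, hw'.tail (h.parent.1 hp)⟩

/-- If the range of `i` contains the children of its elements, branches are the same in `G` and
in `F`. -/
theorem IsEmb.branch [Finite V] [Finite W] (h : G.IsEmb F i)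
    (hi : ∀ u v, F.Parent u v → u ∈ Set.range i → v ∈ Set.range i) (w : W) :
    F.branch (i w) = G.branch w := by
  obtain ⟨e, he, -⟩ := (F.isEmb_restrict {x | F.Anc (i w) x}).exists_isIso
    (h.comp (G.isEmb_restrict {x | G.Anc w x})) (by
      ext x
      rw [Subtype.range_coe]
      simp only [Set.mem_ofPred_eq, Set.mem_range, Function.comp_apply, Subtype.exists, exists_prop]
      constructor
      · intro hx
        obtain ⟨w', rfl, hw'⟩ := h.exists_of_anc hi hx
        exact ⟨w', hw', rfl⟩
      · rintro ⟨w', hw', rfl⟩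
        exact h.anc hw')
  exact he.cls _ _

theorem IsTree.branch [Finite V] (hF : F.IsTree) {r : V} (hr : F.IsRoot r) :
    F.branch r = F.cls hF := by
  obtain ⟨e, he, -⟩ := (F.isEmb_restrict {x | F.Anc r x}).exists_isIso
    (IsIso.refl F).isEmb (by
      ext x
      simp [hF.anc hr])
  exact he.cls _ _

/-! ### The monomial of an induced subforest -/

section mono

variable (K : Type*) [CommRing K]

theorem IsIso.mono [Fintype V] [Fintype W] {e : V ≃ W} (h : F.IsIso G e) :
    F.mono K = G.mono K := by
  classical
  unfold TypedForest.mono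
  refine Finset.prod_equiv e (fun v => ?_) fun v _ => ?_
  · simp [h.isRoot]
  · rw [h.branch]

theorem mono_eq_X [Fintype V] (hF : F.IsTree) : F.mono K = MvPolynomial.X (F.cls hF) := by
  classical
  unfold TypedForest.mono
  rw [Finset.prod_eq_single_of_mem (F.root hF) (by simpa using F.isRoot_root hF)]
  · rw [hF.branch (F.isRoot_root hF)]
  · intro b hb hne
    exact absurd (hF.unique (by simpa using hb) (F.isRoot_root hF)) hne

theorem mono_of_isEmpty [Fintype V] [IsEmpty V] (F : TypedForest D T V) : F.mono K = 1 := by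
  classical
  unfold TypedForest.mono
  rw [Finset.univ_eq_empty, Finset.filter_empty, Finset.prod_empty]

/-- The monomial of the subforest of `F` induced on `S`. -/
noncomputable def subMono [Finite V] (F : TypedForest D T V) (S : Set V) : ForestAlg K D T :=
  letI := Fintype.ofFinite S
  (F.restrict S).mono K

variable {K} in
theorem mono_restrict [Finite V] (F : TypedForest D T V) (S : Set V) [Fintype S] :
    (F.restrict S).mono K = F.subMono K S := by
  rw [subMono]
  congr!

variable {K} in
theorem IsEmb.mono [Finite V] [Fintype W] (h : G.IsEmb F i) :
    G.mono K = F.subMono K (Set.range i) := by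
  obtain ⟨e, he, -⟩ := h.exists_isIso (F.isEmb_restrict (Set.range i)) Subtype.range_coe.symm
  let _ := Fintype.ofFinite (Set.range i)
  exact he.mono K

variable {K} in
theorem IsEmb.subMono [Finite V] [Finite W] (h : G.IsEmb F i) (R : Set W) :
    G.subMono K R = F.subMono K (i '' R) := by
  let _ := Fintype.ofFinite R
  rw [← mono_restrict, (h.comp (G.isEmb_restrict R)).mono]
  congr 1
  ext x
  simp

theorem subMono_univ [Fintype V] (F : TypedForest D T V) :
    F.subMono K Set.univ = F.mono K := by
  rw [(IsIso.refl F).isEmb.mono]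
  congr 1
  ext x
  simp

theorem subMono_empty [Finite V] (F : TypedForest D T V) : F.subMono K ∅ = 1 := by
  let _ := Fintype.ofFinite (∅ : Set V)
  rw [← mono_restrict, mono_of_isEmpty]

theorem IsEmb.mono_eq_prod [Fintype V] [Fintype W] (h : G.IsEmb F i)
    (hi : ∀ u v, F.Parent u v → (u ∈ Set.range i ↔ v ∈ Set.range i)) :
    G.mono K = open Classical in
      ∏ v : V with F.IsRoot v ∧ v ∈ Set.range i, MvPolynomial.X (F.branch v) := by
  classical
  unfold TypedForest.mono
  refine Finset.prod_bij (fun w _ => i w) ?_ (fun _ _ _ _ e => h.injective e) ?_ ?_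
  · intro w hw
    simp only [Finset.mem_filter, Finset.mem_univ, true_and] at hw ⊢
    exact ⟨(h.isRoot fun u v p => (hi u v p).2).2 hw, w, rfl⟩
  · intro v hv
    simp only [Finset.mem_filter, Finset.mem_univ, true_and] at hv
    obtain ⟨hv, w, rfl⟩ := hv
    exact ⟨w, by simpa using (h.isRoot fun u v p => (hi u v p).2).1 hv, rfl⟩
  · intro w _
    rw [h.branch fun u v p => (hi u v p).1]

/-- If no edge joins `U` to its complement, `F` is the disjoint union of its restrictions. -/
theorem mono_eq_mul [Fintype V] (F : TypedForest D T V) {U : Set V}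
    (hU : ∀ u v, F.Parent u v → (u ∈ U ↔ v ∈ U)) :
    F.mono K = F.subMono K U * F.subMono K Uᶜ := by
  classical
  let _ := Fintype.ofFinite U
  let _ := Fintype.ofFinite (Uᶜ : Set V)
  rw [← mono_restrict, ← mono_restrict, (F.isEmb_restrict U).mono_eq_prod K,
    (F.isEmb_restrict Uᶜ).mono_eq_prod K]
  · unfold TypedForest.mono
    rw [← Finset.prod_filter_mul_prod_filter_not _ (· ∈ U), Finset.filter_filter,
      Finset.filter_filter]
    simp
  · simpa [not_iff_not] using hU
  · simpa using hU

theorem subMono_eq_mul [Finite V] (F : TypedForest D T V) {S U : Set V} (hS : U ⊆ S)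
    (hU : ∀ u ∈ S, ∀ v ∈ S, F.Parent u v → (u ∈ U ↔ v ∈ U)) :
    F.subMono K S = F.subMono K U * F.subMono K (S \ U) := by
  let _ := Fintype.ofFinite S
  have h := F.isEmb_restrict S
  rw [← mono_restrict, mono_eq_mul K (F.restrict S) (U := (↑) ⁻¹' U), h.subMono, h.subMono]
  · congr 2
    · simpa using hS
    · ext x
      simp
  · intro u v hp
    exact hU u u.2 v v.2 (h.parent.2 hp)

end mono

/-- Induction on the subsets of the vertex set of a forest: it is enough to deal with the empty set,
with the sets that induce a tree, and with disjoint unions. -/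
theorem set_induction [Finite V] (F : TypedForest D T V) {P : Set V → Prop} (empty : P ∅)
    (tree : ∀ S, (F.restrict S).IsTree → P S)
    (union : ∀ S U, U ⊆ S → (∀ u ∈ S, ∀ v ∈ S, F.Parent u v → (u ∈ U ↔ v ∈ U)) →
      P U → P (S \ U) → P S) (S : Set V) : P S := by
  induction h : S.ncard using Nat.strong_induction_on generalizing S with
  | _ n ih =>
    subst h
    rcases S.eq_empty_or_nonempty with rfl | ⟨v, hv⟩
    · exact empty
    by_cases hT : (F.restrict S).IsTree
    · exact tree S hT
    obtain ⟨r, hr, -⟩ := (F.restrict S).exists_isRoot_anc ⟨v, hv⟩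
    have hE := F.isEmb_restrict S
    obtain ⟨r', hr', hne⟩ : ∃ r', (F.restrict S).IsRoot r' ∧ r' ≠ r := by
      by_contra hc
      push Not at hc
      exact hT ⟨r, hr, hc⟩
    -- With at least two roots, the component of one of them can be split off.
    set U : Set V := (↑) '' {w | (F.restrict S).Anc r w} with hUdef
    have hUS : U ⊆ S := by
      rintro _ ⟨x, -, rfl⟩
      exact x.2
    have hrU : (r : V) ∈ U := ⟨r, Relation.ReflTransGen.refl, rfl⟩
    have hr'U : (r' : V) ∉ U := by
      rintro ⟨x, hx, hxr⟩
      rw [Subtype.ext hxr] at hx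
      exact hne (Anc.eq_of_isRoot hx hr').symm
    refine union S U hUS ?_ (ih _ (Set.ncard_lt_ncard ⟨hUS, fun h => hr'U (h r'.2)⟩) U rfl)
      (ih _ (Set.ncard_lt_ncard ⟨Set.sdiff_subset, fun h => (h r.2).2 hrU⟩) _ rfl)
    intro u hu w hw hp
    have hp' : (F.restrict S).Parent ⟨u, hu⟩ ⟨w, hw⟩ := hE.parent.1 hp
    constructor
    · rintro ⟨x, hx, rfl⟩
      exact ⟨⟨w, hw⟩, Relation.ReflTransGen.tail hx hp', rfl⟩
    · rintro ⟨x, hx, rfl⟩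
      refine ⟨⟨u, hu⟩, Anc.of_parent hx ?_ hp', rfl⟩
      rintro rfl
      exact hp'.not_isRoot hr

end TypedForest

/-! ### Trunks and the coproduct of a forest -/

namespace TypedForest

variable {D T V W X : Type*} {F : TypedForest D T V} {G : TypedForest D T W} {i : W → V}

/-- `U` is a subset of `S` that contains the parents of its elements, as soon as they belong to
`S`: a union of trunks of the subforest induced on `S`. -/
def IsTrunk (F : TypedForest D T V) (S U : Set V) : Prop :=
  U ⊆ S ∧ ∀ u ∈ S, ∀ v ∈ U, F.Parent u v → u ∈ U

theorem isTrunk_self (F : TypedForest D T V) (S : Set V) : F.IsTrunk S S :=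
  ⟨subset_rfl, fun _ h _ _ _ => h⟩

theorem isTrunk_empty (F : TypedForest D T V) (S : Set V) : F.IsTrunk S ∅ :=
  ⟨Set.empty_subset _, fun _ _ _ h _ => h.elim⟩

theorem IsTrunk.mem_of_anc {U : Set V} (h : F.IsTrunk Set.univ U) {u v : V} (k : F.Anc u v)
    (hv : v ∈ U) : u ∈ U := by
  induction k with
  | refl => exact hv
  | tail _ hp ih => exact ih (h.2 _ trivial _ hv hp)

theorem IsEmb.isTrunk_image (h : G.IsEmb F i) {R U : Set W} :
    F.IsTrunk (i '' R) (i '' U) ↔ G.IsTrunk R U := by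
  unfold IsTrunk
  rw [Set.image_subset_image_iff h.injective]
  refine and_congr_right fun _ => ?_
  simp only [Set.forall_mem_image, h.parent, h.injective.mem_set_image]

section weight

variable {K : Type*} [CommRing K] (lam : T → K)

open Classical in
/-- The contribution to `cutWeight` of the edge whose lower endpoint is `v`. -/
noncomputable def cutFactor (F : TypedForest D T V) (S U : Set V) (v : V) : K :=
  match F.up v with
  | none => 1
  | some p => if v ∈ S ∧ v ∉ U ∧ p.2 ∈ U then lam p.1 else 1

/-- The product of the `λ_{type(e)}` over the edges `e` from a vertex of `U` to a vertex of
`S \ U`. -/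
noncomputable def cutWeight [Fintype V] (F : TypedForest D T V) (S U : Set V) : K :=
  ∏ v, F.cutFactor lam S U v

theorem IsEmb.cutFactor (h : G.IsEmb F i) (R U : Set W) (w : W) :
    F.cutFactor lam (i '' R) (i '' U) (i w) = G.cutFactor lam R U w := by
  classical
  unfold TypedForest.cutFactor
  cases hG : G.up w with
  | some p =>
    rw [(h.up p.1 w p.2).1 hG]
    exact if_congr (by simp only [h.injective.mem_set_image]) rfl rfl
  | none =>
    cases hF : F.up (i w) with
    | none => rfl
    | some p =>
      refine if_neg ?_
      rintro ⟨-, -, x, -, hx⟩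
      have := (h.up p.1 w x).2 (by rw [hF, hx])
      simp [hG] at this

theorem IsEmb.cutWeight [Fintype V] [Fintype W] (h : G.IsEmb F i) (R U : Set W) :
    G.cutWeight lam R U = F.cutWeight lam (i '' R) (i '' U) := by
  unfold TypedForest.cutWeight
  refine Finset.prod_of_injOn i h.injective.injOn (fun _ _ => Finset.mem_coe.2 (Finset.mem_univ _))
    ?_ fun w _ => (h.cutFactor lam R U w).symm
  intro v _ hv
  unfold TypedForest.cutFactor
  split
  · rfl
  · refine if_neg ?_
    rintro ⟨⟨w, -, rfl⟩, -⟩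
    exact hv ⟨w, by simp, rfl⟩

theorem cutWeight_self [Fintype V] (F : TypedForest D T V) (S : Set V) :
    F.cutWeight lam S S = 1 := by
  refine Finset.prod_eq_one fun v _ => ?_
  unfold cutFactor
  split
  · rfl
  · exact if_neg fun h => h.2.1 h.1

theorem cutWeight_empty [Fintype V] (F : TypedForest D T V) (S : Set V) :
    F.cutWeight lam S ∅ = 1 := by
  refine Finset.prod_eq_one fun v _ => ?_
  unfold cutFactor
  split
  · rfl
  · exact if_neg fun h => h.2.2

end weight

section coproductSum

variable {K : Type*} [CommRing K] (lam : T → K)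

open Classical in
/-- The coproduct of the subforest induced on `S`, as a sum over its unions of trunks. Contrary to
the sum over admissible cuts, it makes sense for all forests, and contains the two primitive
terms. -/
noncomputable def coproductSum [Fintype V] (F : TypedForest D T V) (S : Set V) :
    ForestAlg K D T ⊗[K] ForestAlg K D T :=
  ∑ U : Set V with F.IsTrunk S U,
    F.cutWeight lam S U • (F.subMono K U ⊗ₜ[K] F.subMono K (S \ U))

theorem IsEmb.coproductSum [Fintype V] [Fintype W] (h : G.IsEmb F i) (R : Set W) :
    G.coproductSum lam R = F.coproductSum lam (i '' R) := by
  classical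
  unfold TypedForest.coproductSum
  refine Finset.sum_bij (fun U _ => i '' U) ?_ (fun _ _ _ _ e => h.injective.image_injective e)
    ?_ ?_
  · intro U hU
    simpa [h.isTrunk_image] using hU
  · intro U hU
    simp only [Finset.mem_filter, Finset.mem_univ, true_and] at hU
    obtain ⟨U, -, rfl⟩ := Set.subset_image_iff.1 hU.1
    exact ⟨U, by simpa [h.isTrunk_image] using hU, rfl⟩
  · intro U _
    rw [h.cutWeight, h.subMono, h.subMono, Set.image_sdiff h.injective]

theorem coproductSum_empty [Fintype V] (F : TypedForest D T V) :
    F.coproductSum lam ∅ = 1 := by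
  classical
  have : ∀ U : Set V, F.IsTrunk ∅ U ↔ U = ∅ := fun U =>
    ⟨fun h => Set.subset_empty_iff.1 h.1, by rintro rfl; exact F.isTrunk_empty _⟩
  unfold coproductSum
  rw [Finset.sum_eq_single_of_mem ∅ (by simp [this])
      (fun U hU hne => absurd (by simpa [this] using hU) hne),
    cutWeight_empty, Set.sdiff_self, subMono_empty, one_smul, Algebra.TensorProduct.one_def]

/-- The trunks of a disjoint union are the unions of trunks of the two parts. -/
theorem coproductSum_eq_mul [Fintype V] (F : TypedForest D T V) {S U : Set V} (hS : U ⊆ S)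
    (hU : ∀ u ∈ S, ∀ v ∈ S, F.Parent u v → (u ∈ U ↔ v ∈ U)) :
    F.coproductSum lam S = F.coproductSum lam U * F.coproductSum lam (S \ U) := by
  classical
  unfold coproductSum
  rw [Finset.sum_mul_sum, ← Finset.sum_product']
  refine Finset.sum_bij' (fun A _ => (A ∩ U, A \ U)) (fun p _ => p.1 ∪ p.2) ?_ ?_ ?_ ?_ ?_
  · intro A hA
    simp only [Finset.mem_filter, Finset.mem_univ, true_and, Finset.mem_product] at hA ⊢
    refine ⟨⟨Set.inter_subset_right, fun u hu v hv hp => ⟨hA.2 u (hS hu) v hv.1 hp, hu⟩⟩,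
      Set.sdiff_subset_sdiff_left hA.1, fun u hu v hv hp => ⟨hA.2 u hu.1 v hv.1 hp, hu.2⟩⟩
  · rintro ⟨A, B⟩ hAB
    simp only [Finset.mem_filter, Finset.mem_univ, true_and, Finset.mem_product] at hAB ⊢
    obtain ⟨hA, hB⟩ := hAB
    refine ⟨Set.union_subset (hA.1.trans hS) (hB.1.trans Set.sdiff_subset), ?_⟩
    rintro u hu v (hv | hv) hp
    · exact Or.inl (hA.2 u ((hU u hu v (hS (hA.1 hv)) hp).2 (hA.1 hv)) v hv hp)
    · have := hB.1 hv
      exact Or.inr (hB.2 u ⟨hu, fun h => this.2 ((hU u hu v this.1 hp).1 h)⟩ v hv hp)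
  · intro A _
    exact Set.inter_union_sdiff A U
  · rintro ⟨A, B⟩ hAB
    simp only [Finset.mem_filter, Finset.mem_univ, true_and, Finset.mem_product] at hAB
    obtain ⟨⟨hA, -⟩, hB, -⟩ := hAB
    refine Prod.ext ?_ ?_ <;> ext x <;> simp only [Set.mem_inter_iff, Set.mem_sdiff, Set.mem_union]
    · exact ⟨fun h => h.1.resolve_right fun hb => (hB hb).2 h.2, fun h => ⟨Or.inl h, hA h⟩⟩
    · exact ⟨fun h => h.1.resolve_left fun ha => h.2 (hA ha), fun h => ⟨Or.inr h, (hB h).2⟩⟩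
  · intro A hA
    simp only [Finset.mem_filter, Finset.mem_univ, true_and] at hA
    have hw : F.cutWeight lam S A
        = F.cutWeight lam U (A ∩ U) * F.cutWeight lam (S \ U) (A \ U) := by
      unfold cutWeight
      rw [← Finset.prod_mul_distrib]
      refine Finset.prod_congr rfl fun v _ => ?_
      unfold cutFactor
      cases hv : F.up v with
      | none => simp
      | some p =>
        by_cases hpS : p.2 ∈ S
        · by_cases hvS : v ∈ S
          · have := hU p.2 hpS v hvS ⟨p.1, hv⟩
            by_cases hvU : v ∈ U <;> simp [hvU, this, hvS]
          · have : v ∉ U := fun h => hvS (hS h)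
            simp [hvS, this]
        · have : p.2 ∉ A := fun h => hpS (hA.1 h)
          simp [this]
    have h1 : F.subMono K A = F.subMono K (A ∩ U) * F.subMono K (A \ U) := by
      rw [F.subMono_eq_mul K (Set.inter_subset_left (s := A) (t := U)), Set.sdiff_self_inter]
      intro u hu v hv hp
      simp [hu, hv, hU u (hA.1 hu) v (hA.1 hv) hp]
    have h2 : F.subMono K (S \ A)
        = F.subMono K (U \ (A ∩ U)) * F.subMono K ((S \ U) \ (A \ U)) := by
      rw [F.subMono_eq_mul K (Set.sdiff_subset_sdiff_left hS : U \ A ⊆ S \ A)]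
      · congr 2 <;> ext x <;> simp only [Set.mem_inter_iff, Set.mem_sdiff] <;> tauto
      · intro u hu v hv hp
        simp [hu.2, hv.2, hU u hu.1 v hv.1 hp]
    rw [hw, h1, h2, smul_mul_smul_comm, Algebra.TensorProduct.tmul_mul_tmul]

end coproductSum

/-! ### Admissible cuts and trunks of a tree -/

section tree

variable {K : Type*} [CommRing K] (lam : T → K)

/-- Admissibility of a cut is tested on leaves, so that every vertex needs a leaf below it; this is
where the finiteness of the forest matters. -/
theorem exists_isLeaf_anc [Finite V] (F : TypedForest D T V) (v : V) :
    ∃ l, F.IsLeaf l ∧ F.Anc v l := by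
  have hwf : WellFounded (Function.swap (Relation.TransGen F.Parent)) := by
    have : IsTrans V (Function.swap (Relation.TransGen F.Parent)) :=
      ⟨fun _ _ _ h k => Relation.TransGen.trans k h⟩
    have : Std.Irrefl (Function.swap (Relation.TransGen F.Parent)) :=
      ⟨(WellFounded.transGen F.wf).irrefl.irrefl⟩
    exact Finite.wellFounded_of_trans_of_irrefl _
  induction v using hwf.induction with
  | _ v ih =>
    by_cases hv : F.IsLeaf v
    · exact ⟨v, hv, Relation.ReflTransGen.refl⟩
    · simp only [IsLeaf, not_forall, not_not] at hv
      obtain ⟨w, hw⟩ := hv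
      obtain ⟨l, hl, h⟩ := ih w (Relation.TransGen.single hw)
      exact ⟨l, hl, Relation.ReflTransGen.head hw h⟩

/-- The trunk left by an admissible cut: the vertices that are below no edge of the cut. -/
def above (F : TypedForest D T V) (c : Finset V) : Set V := {v | ∀ u ∈ c, ¬ F.Anc u v}

theorem isTrunk_above (F : TypedForest D T V) (c : Finset V) :
    F.IsTrunk Set.univ (F.above c) :=
  ⟨Set.subset_univ _, fun _ _ _ hv hp w hw hwu => hv w hw (hwu.tail hp)⟩

open Classical in
/-- The edges leaving a trunk, represented by their lower endpoints. -/
noncomputable def boundary [Fintype V] (F : TypedForest D T V) (U : Set V) : Finset V :=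
  {v | v ∉ U ∧ ∃ p ∈ U, F.Parent p v}

theorem mem_boundary [Fintype V] {U : Set V} {v : V} :
    v ∈ F.boundary U ↔ v ∉ U ∧ ∃ p ∈ U, F.Parent p v := by
  simp [boundary]

theorem boundary_above [Fintype V] {c : Finset V} (hc : F.IsAdmissibleCut c) :
    F.boundary (F.above c) = c := by
  ext v
  rw [mem_boundary]
  constructor
  · rintro ⟨hv, p, hp, hpv⟩
    simp only [above, Set.mem_ofPred_eq, not_forall, not_not] at hv hp
    obtain ⟨u, hu, huv⟩ := hv
    by_cases h : u = v
    · exact h ▸ hu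
    · exact absurd (huv.of_parent h hpv) (hp u hu)
  · intro hv
    refine ⟨fun h => h v hv Relation.ReflTransGen.refl, ?_⟩
    obtain ⟨p, hp⟩ := exists_parent (hc.2.1 v hv)
    refine ⟨p, fun u hu hup => ?_, hp⟩
    obtain ⟨l, hl, hvl⟩ := F.exists_isLeaf_anc v
    have := hc.2.2 l hl u hu v hv ((Relation.ReflTransGen.tail hup hp).trans hvl) hvl
    exact not_anc_of_parent hp (this ▸ hup)

theorem exists_anc_boundary [Fintype V] (hF : F.IsTree) {U : Set V} (hne : U.Nonempty)
    (hU : F.IsTrunk Set.univ U) {v : V} (hv : v ∉ U) : ∃ u ∈ F.boundary U, F.Anc u v := by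
  induction v using F.wf.induction with
  | _ v ih =>
    have hr : ¬ F.IsRoot v := by
      intro hr
      obtain ⟨x, hx⟩ := hne
      exact hv (hU.mem_of_anc (hF.anc hr x) hx)
    obtain ⟨p, hp⟩ := exists_parent hr
    by_cases hpU : p ∈ U
    · exact ⟨v, mem_boundary.2 ⟨hv, p, hpU, hp⟩, Relation.ReflTransGen.refl⟩
    · obtain ⟨u, hu, hup⟩ := ih p hp hpU
      exact ⟨u, hu, hup.tail hp⟩

theorem above_boundary [Fintype V] (hF : F.IsTree) {U : Set V} (hne : U.Nonempty)
    (hU : F.IsTrunk Set.univ U) : F.above (F.boundary U) = U := by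
  ext v
  constructor
  · intro h
    by_contra hv
    obtain ⟨u, hu, huv⟩ := exists_anc_boundary hF hne hU hv
    exact h u hu huv
  · intro hv u hu huv
    exact (mem_boundary.1 hu).1 (hU.mem_of_anc huv hv)

theorem isAdmissibleCut_boundary [Fintype V] (hF : F.IsTree) {U : Set V} (hne : U.Nonempty)
    (hU : F.IsTrunk Set.univ U) (huniv : U ≠ Set.univ) : F.IsAdmissibleCut (F.boundary U) := by
  refine ⟨?_, fun v hv hr => ?_, fun l _ u hu v hv hul hvl => ?_⟩
  · obtain ⟨v, hv⟩ := (Set.ne_univ_iff_exists_notMem U).1 huniv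
    obtain ⟨u, hu, -⟩ := exists_anc_boundary hF hne hU hv
    exact ⟨u, hu⟩
  · obtain ⟨-, p, -, hp⟩ := mem_boundary.1 hv
    exact hp.not_isRoot hr
  · have key : ∀ u v, u ∈ F.boundary U → v ∈ F.boundary U → F.Anc u v → u = v := by
      intro u v hu hv h
      by_contra hne
      obtain ⟨-, p, hp, hpv⟩ := mem_boundary.1 hv
      exact (mem_boundary.1 hu).1 (hU.mem_of_anc (h.of_parent hne hpv) hp)
    rcases hul.total hvl with h | h
    · exact key u v hu hv h
    · exact (key v u hv hu h).symm

theorem above_nonempty {c : Finset V} (hF : F.IsTree) (hc : F.IsAdmissibleCut c) :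
    F.root hF ∈ F.above c := by
  intro u hu h
  have := h.eq_of_isRoot (F.isRoot_root hF)
  exact hc.2.1 u hu (this ▸ F.isRoot_root hF)

theorem cut_up {c : Finset V} {v : V} (hv : v ∉ c) : (F.cut c).up v = F.up v := by
  simp [cut, hv]

theorem cut_parent {c : Finset V} {u v : V} : (F.cut c).Parent u v ↔ v ∉ c ∧ F.Parent u v := by
  by_cases hv : v ∈ c <;> simp [cut, hv, Parent]

/-- A set of vertices none of which is the lower endpoint of a cut edge, except those whose parent
does not belong to the set, induces the same subforest before and after the cut. -/
theorem isEmb_cut {c : Finset V} {S : Set V} (hS : ∀ v ∈ S, v ∈ c → ∀ p ∈ S, ¬ F.Parent p v) :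
    ((F.cut c).restrict S).IsEmb F (↑) := by
  have h := (F.cut c).isEmb_restrict S
  refine ⟨h.injective, h.dec, fun t w w' => (h.up t w w').trans ?_⟩
  by_cases hw : (w : V) ∈ c
  · have h1 := hS w w.2 hw w' w'.2
    have h2 : ¬ (F.cut c).Parent w' w := fun h => (cut_parent.1 h).1 hw
    exact ⟨fun h => absurd ⟨t, h⟩ h2, fun h => absurd ⟨t, h⟩ h1⟩
  · rw [cut_up hw]

theorem anc_cut {c : Finset V} {u v : V} (h : (F.cut c).Anc u v) : F.Anc u v :=
  Relation.ReflTransGen.lift (p := F.Parent) id (fun _ _ k => (cut_parent.1 k).2) _ _ h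

theorem trunk_eq [Fintype V] (hF : F.IsTree) {c : Finset V} (hc : F.IsAdmissibleCut c) :
    F.trunk K hF c = F.subMono K (F.above c) := by
  have hset : {w | (F.cut c).Anc (F.root hF) w} = F.above c := by
    ext w
    constructor
    · intro h
      rw [Set.mem_ofPred_eq] at h
      induction h with
      | refl => exact above_nonempty hF hc
      | tail _ hp ih =>
        intro u hu hub
        obtain ⟨hb, hp⟩ := cut_parent.1 hp
        exact ih u hu (hub.of_parent (fun e => hb (e ▸ hu)) hp)
    · intro hw
      have := hF.anc (F.isRoot_root hF) w
      rw [Set.mem_ofPred_eq]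
      induction this with
      | refl => exact Relation.ReflTransGen.refl
      | @tail b d _ hp ih =>
        refine (ih fun u hu hub => hw u hu (hub.tail hp)).tail (cut_parent.2 ⟨fun hd => ?_, hp⟩)
        exact hw d hd Relation.ReflTransGen.refl
  have hemb := isEmb_cut (F := F) (c := c) (S := {w | (F.cut c).Anc (F.root hF) w}) (by
    rw [hset]
    exact fun v hv hvc => absurd Relation.ReflTransGen.refl (hv v hvc))
  let _ := Fintype.ofFinite {w | (F.cut c).Anc (F.root hF) w}
  rw [trunk, branch, ← mono_eq_X, hemb.mono, Subtype.range_coe, hset]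

theorem pruned_eq [Fintype V] {c : Finset V} (hc : F.IsAdmissibleCut c) :
    F.pruned K c = F.subMono K (F.above c)ᶜ := by
  classical
  let _ := Fintype.ofFinite ((F.above c)ᶜ : Set V)
  have hE := F.isEmb_restrict (F.above c)ᶜ
  have hT := F.isTrunk_above c
  rw [← mono_restrict]
  unfold pruned TypedForest.mono
  symm
  -- The roots of the part below the cut are the lower endpoints of the edges in the cut.
  have hroot : ∀ x : ((F.above c)ᶜ : Set V),
      (F.restrict (F.above c)ᶜ).IsRoot x ↔ (x : V) ∈ c := by
    intro x
    constructor
    · intro hx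
      have hxn : ∃ u ∈ c, F.Anc u x := by
        have := x.2
        simp only [above, Set.mem_compl_iff, Set.mem_ofPred_eq, not_forall, not_not] at this
        obtain ⟨u, hu, h⟩ := this
        exact ⟨u, hu, h⟩
      obtain ⟨u, hu, hux⟩ := hxn
      by_contra hxc
      have hne : u ≠ x := fun h => hxc (h ▸ hu)
      obtain ⟨y, hy, hyx⟩ := (Relation.ReflTransGen.cases_tail hux).resolve_left
        fun h => hne h.symm
      have hyc : y ∈ (F.above c)ᶜ := fun h => h u hu hy
      exact ((hE.parent (u := ⟨y, hyc⟩)).1 hyx).not_isRoot hx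
    · intro hx
      by_contra hr
      obtain ⟨p, hp⟩ := exists_parent hr
      obtain ⟨-, q, hq, hqx⟩ := mem_boundary.1 ((boundary_above hc).symm ▸ hx :
        (x : V) ∈ F.boundary (F.above c))
      exact p.2 (hqx.unique (hE.parent.2 hp) ▸ hq)
  refine Finset.prod_bij (fun x _ => (x : V)) ?_ (fun _ _ _ _ => Subtype.ext) ?_ ?_
  · intro x hx
    exact (hroot x).1 (by simpa using hx)
  · intro v hv
    have : v ∈ (F.above c)ᶜ := fun h => h v hv Relation.ReflTransGen.refl
    exact ⟨⟨v, this⟩, by simpa [hroot] using hv, rfl⟩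
  · intro x hx
    have hxc := (hroot x).1 (by simpa using hx)
    congr 1
    rw [← hE.branch (by
      simp only [Subtype.range_coe]
      exact fun u v hp hu hv => hu (hT.2 _ trivial _ hv hp))]
    -- Below an edge of the cut, no other edge is cut.
    have hS : {w | (F.cut c).Anc x w} = {w | F.Anc x w} := by
      ext w
      refine ⟨anc_cut, fun h => ?_⟩
      rw [Set.mem_ofPred_eq] at h ⊢
      induction h with
      | refl => exact Relation.ReflTransGen.refl
      | @tail b d hxb hp ih =>
        refine ih.tail (cut_parent.2 ⟨fun hd => ?_, hp⟩)
        rw [← boundary_above hc, mem_boundary] at hd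
        obtain ⟨-, q, hq, hqd⟩ := hd
        exact hq x hxc (hqd.unique hp ▸ hxb)
    have hemb := isEmb_cut (F := F) (c := c) (S := {w | (F.cut c).Anc x w}) (by
      intro v hv hvc p hpS hp
      rw [hS] at hpS
      rw [← boundary_above hc, mem_boundary] at hvc
      obtain ⟨-, q, hq, hqd⟩ := hvc
      exact hq x hxc (hqd.unique hp ▸ hpS))
    obtain ⟨e, he, -⟩ := (F.isEmb_restrict {w | F.Anc x w}).exists_isIso hemb (by
      rw [Subtype.range_coe, Subtype.range_coe, hS])
    exact he.cls _ _

/-- The edges of an admissible cut are the edges leaving its trunk. -/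
theorem prod_edgeWeight_eq [Fintype V] {c : Finset V} (hc : F.IsAdmissibleCut c) :
    ∏ v ∈ c, F.edgeWeight lam v = F.cutWeight lam Set.univ (F.above c) := by
  classical
  unfold cutWeight
  rw [← Finset.prod_subset (Finset.subset_univ c)]
  · refine Finset.prod_congr rfl fun v hv => ?_
    rw [← boundary_above hc, mem_boundary] at hv
    obtain ⟨hv, q, hq, t, hqv⟩ := hv
    simp [edgeWeight, cutFactor, hqv, hv, hq]
  · intro v _ hv
    unfold cutFactor
    split
    · rfl
    · rename_i p hp
      refine if_neg fun h => hv ?_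
      rw [← boundary_above hc, mem_boundary]
      exact ⟨h.2.1, p.2, h.2.2, p.1, hp⟩

/-- An admissible cut of a tree amounts to a nonempty proper trunk; the trunks `univ` and `∅` give
the two primitive terms. -/
theorem treeCoproduct_eq [Fintype V] (hF : F.IsTree) :
    F.treeCoproduct lam hF = F.coproductSum lam Set.univ := by
  classical
  have hne : (∅ : Set V) ≠ Set.univ := fun h => Set.notMem_empty (F.root hF) (h ▸ Set.mem_univ _)
  unfold treeCoproduct coproductSum
  rw [← Finset.add_sum_erase _ _ (a := Set.univ) (by simpa using F.isTrunk_self _),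
    ← Finset.add_sum_erase _ _ (a := (∅ : Set V)) (by simpa [hne] using F.isTrunk_empty _),
    ← add_assoc, cutWeight_self, cutWeight_empty, subMono_univ, subMono_empty, Set.sdiff_self,
    Set.sdiff_empty, subMono_univ, subMono_empty, mono_eq_X K hF, one_smul, one_smul]
  congr 1
  refine Finset.sum_bij' (fun c _ => F.above c) (fun U _ => F.boundary U) ?_ ?_ ?_ ?_ ?_
  · intro c hc
    simp only [Finset.mem_filter, Finset.mem_univ, true_and, Finset.mem_erase] at hc ⊢
    refine ⟨fun h => ?_, fun h => ?_, F.isTrunk_above c⟩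
    · exact Set.notMem_empty _ (h ▸ above_nonempty hF hc)
    · obtain ⟨v, hv⟩ := hc.1
      have : v ∈ F.above c := h ▸ Set.mem_univ v
      exact this v hv Relation.ReflTransGen.refl
  · intro U hU
    simp only [Finset.mem_filter, Finset.mem_univ, true_and, Finset.mem_erase] at hU ⊢
    exact isAdmissibleCut_boundary hF (Set.nonempty_iff_ne_empty.2 hU.1) hU.2.2 hU.2.1
  · intro c hc
    exact boundary_above (by simpa using hc)
  · intro U hU
    simp only [Finset.mem_filter, Finset.mem_univ, true_and, Finset.mem_erase] at hU
    exact above_boundary hF (Set.nonempty_iff_ne_empty.2 hU.1) hU.2.2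
  · intro c hc
    replace hc : F.IsAdmissibleCut c := by simpa using hc
    rw [prod_edgeWeight_eq lam hc, trunk_eq hF hc, pruned_eq hc, Set.compl_eq_univ_sdiff]

theorem ckComul_X_cls [Fintype V] (hF : F.IsTree) :
    ckComul lam (MvPolynomial.X (F.cls hF)) = F.treeCoproduct lam hF := by
  rw [ckComul, MvPolynomial.aeval_X]
  exact ((F.isIso_transport _).treeCoproduct lam _ _).symm

/-- By multiplicativity, the formula for trees extends to all induced subforests. -/
theorem ckComul_subMono [Fintype V] (F : TypedForest D T V) (S : Set V) :
    ckComul lam (F.subMono K S) = F.coproductSum lam S := by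
  induction S using F.set_induction with
  | empty => rw [subMono_empty, map_one, coproductSum_empty]
  | tree S hS =>
    let _ := Fintype.ofFinite S
    rw [← mono_restrict, mono_eq_X K hS, ckComul_X_cls, treeCoproduct_eq,
      (F.isEmb_restrict S).coproductSum, Subtype.coe_image_univ]
  | union S U h1 h2 h3 h4 =>
    rw [F.subMono_eq_mul K h1 h2, map_mul, h3, h4, ← F.coproductSum_eq_mul lam h1 h2]

end tree

end TypedForest

/-! ### Hopf algebras and convolution -/

section convolution

variable {K A A' : Type*} [CommRing K] [CommRing A] [Algebra K A] [CommRing A'] [Algebra K A']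
  {Δ : A →ₐ[K] A ⊗[K] A} {ε : A →ₐ[K] K} {Δ' : A' →ₐ[K] A' ⊗[K] A'} {ε' : A' →ₐ[K] K}

open WithConv in
/-- In a coalgebra, a left convolution inverse and a right convolution inverse of a linear map are
equal. -/
theorem eq_of_convolution_inverses
    (coassoc : (TensorProduct.assoc K A A A).toLinearMap ∘ₗ Δ.toLinearMap.rTensor A ∘ₗ
      Δ.toLinearMap = Δ.toLinearMap.lTensor A ∘ₗ Δ.toLinearMap)
    (counit_left : ε.toLinearMap.rTensor A ∘ₗ Δ.toLinearMap = TensorProduct.mk K K A 1)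
    (counit_right : ε.toLinearMap.lTensor A ∘ₗ Δ.toLinearMap = (TensorProduct.mk K A K).flip 1)
    {f g h : A →ₗ[K] A'}
    (hl : LinearMap.mul' K A' ∘ₗ TensorProduct.map g f ∘ₗ Δ.toLinearMap =
      Algebra.linearMap K A' ∘ₗ ε.toLinearMap)
    (hr : LinearMap.mul' K A' ∘ₗ TensorProduct.map f h ∘ₗ Δ.toLinearMap =
      Algebra.linearMap K A' ∘ₗ ε.toLinearMap) : g = h := by
  let _ : Coalgebra K A :=
    { comul := Δ.toLinearMap
      counit := ε.toLinearMap
      coassoc := coassoc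
      rTensor_counit_comp_comul := counit_left
      lTensor_counit_comp_comul := counit_right }
  have h1 : toConv g * toConv f = 1 := congrArg toConv hl
  have h2 : toConv f * toConv h = 1 := congrArg toConv hr
  exact congrArg WithConv.ofConv (left_inv_eq_right_inv h1 h2)

/-- It is enough to have a left antipode and a right antipode: they are equal. -/
theorem isHopfAlgebra_of_inverses
    (coassoc : (TensorProduct.assoc K A A A).toLinearMap ∘ₗ Δ.toLinearMap.rTensor A ∘ₗ
      Δ.toLinearMap = Δ.toLinearMap.lTensor A ∘ₗ Δ.toLinearMap)
    (counit_left : ε.toLinearMap.rTensor A ∘ₗ Δ.toLinearMap = TensorProduct.mk K K A 1)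
    (counit_right : ε.toLinearMap.lTensor A ∘ₗ Δ.toLinearMap = (TensorProduct.mk K A K).flip 1)
    {S S' : A →ₗ[K] A}
    (hl : LinearMap.mul' K A ∘ₗ S.rTensor A ∘ₗ Δ.toLinearMap =
      Algebra.linearMap K A ∘ₗ ε.toLinearMap)
    (hr : LinearMap.mul' K A ∘ₗ S'.lTensor A ∘ₗ Δ.toLinearMap =
      Algebra.linearMap K A ∘ₗ ε.toLinearMap) : IsHopfAlgebra Δ ε S := by
  have := eq_of_convolution_inverses coassoc counit_left counit_right hl hr
  subst this
  exact ⟨coassoc, counit_left, counit_right, hl, hr⟩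

/-- A morphism of bialgebras between Hopf algebras commutes with the antipodes. -/
theorem isHopfMorphism_of_bialgebra {S : A →ₗ[K] A} {S' : A' →ₗ[K] A'}
    (h : IsHopfAlgebra Δ ε S) (h' : IsHopfAlgebra Δ' ε' S') {Ψ : A →ₐ[K] A'}
    (map_comul : ∀ x, Δ' (Ψ x) = TensorProduct.map Ψ.toLinearMap Ψ.toLinearMap (Δ x))
    (map_counit : ∀ x, ε' (Ψ x) = ε x) :
    IsHopfMorphism Δ ε S Δ' ε' S' Ψ.toLinearMap := by
  refine ⟨map_one Ψ, map_mul Ψ, map_comul, map_counit, fun x => ?_⟩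
  refine LinearMap.congr_fun (f := S' ∘ₗ Ψ.toLinearMap) (g := Ψ.toLinearMap ∘ₗ S) ?_ x
  refine eq_of_convolution_inverses (f := Ψ.toLinearMap) h.coassoc h.counit_left h.counit_right
    ?_ ?_
  · ext x
    have := LinearMap.congr_fun h'.antipode_left (Ψ x)
    simp only [LinearMap.comp_apply, AlgHom.toLinearMap_apply, map_comul, map_counit,
      ← LinearMap.rTensor_comp_map] at this ⊢
    rw [← this]
  · ext x
    have := congrArg Ψ (LinearMap.congr_fun h.antipode_right x)
    have hmul : ∀ z : A ⊗[K] A, Ψ (LinearMap.mul' K A z) =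
        LinearMap.mul' K A' (TensorProduct.map Ψ.toLinearMap Ψ.toLinearMap z) := by
      intro z
      induction z with
      | zero => simp
      | tmul a b => simp
      | add a b ha hb => simp only [map_add, ha, hb]
    simp only [LinearMap.comp_apply, AlgHom.toLinearMap_apply, hmul, Algebra.linearMap_apply,
      AlgHom.commutes] at this ⊢
    rw [← this, ← LinearMap.comp_apply, ← LinearMap.map_comp_lTensor]
    rfl

end convolution

/-- Algebra morphisms out of a polynomial algebra can be defined by recursion on the size of the
variables: the value `R f s` prescribed on the variable `s` may involve the values of `f` on the
variables of smaller size. -/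
theorem MvPolynomial.exists_algHom_rec {K σ A : Type*} [CommRing K] [CommRing A] [Algebra K A]
    (size : σ → ℕ) (R : (MvPolynomial σ K →ₐ[K] A) → σ → A)
    (hR : ∀ f g s, (∀ t, size t < size s → f (X t) = g (X t)) → R f s = R g s) :
    ∃ f : MvPolynomial σ K →ₐ[K] A, ∀ s, f (X s) = R f s := by
  -- The morphism `a n` has the right values on the variables of size less than `n`.
  let a : ℕ → MvPolynomial σ K →ₐ[K] A := fun n => Nat.rec (aeval 0) (fun _ f => aeval (R f)) n
  have ha : ∀ n s, a (n + 1) (X s) = R (a n) s := fun n s => aeval_X _ s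
  have key : ∀ N s, size s < N → ∀ n m, size s < n → size s < m → a n (X s) = a m (X s) := by
    intro N
    induction N with
    | zero => exact fun _ h => absurd h (Nat.not_lt_zero _)
    | succ N ih =>
      intro s hs n m hn hm
      obtain ⟨n, rfl⟩ := Nat.exists_eq_add_one_of_ne_zero (Nat.ne_zero_of_lt hn)
      obtain ⟨m, rfl⟩ := Nat.exists_eq_add_one_of_ne_zero (Nat.ne_zero_of_lt hm)
      rw [ha, ha]
      exact hR _ _ _ fun t ht => ih t (by omega) n m (by omega) (by omega)
  refine ⟨aeval fun s => a (size s + 1) (X s), fun s => ?_⟩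
  rw [aeval_X, ha]
  refine hR _ _ _ fun t ht => ?_
  rw [aeval_X]
  exact key _ t (Nat.lt_succ_self _) _ _ ht (Nat.lt_succ_self _)

namespace TypedForest

variable {D T V W X : Type*} {F : TypedForest D T V} {G : TypedForest D T W} {i : W → V}

/-! ### Gluing forests and representing monomials -/

/-- The forest obtained from `F` and `G` by attaching the roots of `G` to a vertex of `F` with
edges of a given type (`a = some (t, v)`), or their disjoint union (`a = none`). -/
def glue (F : TypedForest D T V) (G : TypedForest D T W) (a : Option (T × V)) :
    TypedForest D T (V ⊕ W) where
  dec := Sum.elim F.dec G.dec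
  up
    | .inl v => (F.up v).map (Prod.map id .inl)
    | .inr w => ((G.up w).map (Prod.map id .inr)).or (a.map (Prod.map id .inl))
  wf := by
    have hl : ∀ v, Acc (fun x y : V ⊕ W => ∃ t, Sum.elim (fun v => (F.up v).map (Prod.map id .inl))
        (fun w => ((G.up w).map (Prod.map id .inr)).or (a.map (Prod.map id .inl))) y
          = some (t, x)) (.inl v) := by
      intro v
      induction v using F.wf.induction with
      | _ v ih =>
        refine ⟨_, ?_⟩
        rintro x ⟨t, hx⟩
        simp only [Sum.elim_inl, Option.map_eq_some_iff] at hx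
        obtain ⟨⟨t', u⟩, hu, hx⟩ := hx
        simp only [Prod.map_apply, id_eq, Prod.mk.injEq] at hx
        rw [← hx.2]
        exact ih u ⟨t', hu⟩
    have hr : ∀ w, Acc (fun x y : V ⊕ W => ∃ t, Sum.elim (fun v => (F.up v).map (Prod.map id .inl))
        (fun w => ((G.up w).map (Prod.map id .inr)).or (a.map (Prod.map id .inl))) y
          = some (t, x)) (.inr w) := by
      intro w
      induction w using G.wf.induction with
      | _ w ih =>
        refine ⟨_, ?_⟩
        rintro x ⟨t, hx⟩
        simp only [Sum.elim_inr, Option.or_eq_some_iff, Option.map_eq_some_iff] at hx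
        obtain ⟨⟨t', u⟩, hu, hx⟩ | ⟨-, ⟨t', u⟩, hu, hx⟩ := hx
        · simp only [Prod.map_apply, id_eq, Prod.mk.injEq] at hx
          rw [← hx.2]
          exact ih u ⟨t', hu⟩
        · simp only [Prod.map_apply, id_eq, Prod.mk.injEq] at hx
          rw [← hx.2]
          exact hl u
    refine ⟨fun x => ?_⟩
    rcases x with v | w
    · convert hl v using 3 with x y
      cases y <;> rfl
    · convert hr w using 3 with x y
      cases y <;> rfl

theorem isEmb_glue_inl (F : TypedForest D T V) (G : TypedForest D T W) (a : Option (T × V)) :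
    F.IsEmb (F.glue G a) .inl := by
  refine ⟨Sum.inl_injective, fun _ => rfl, fun t w w' => ?_⟩
  simp [glue, Option.map_eq_some_iff, Prod.ext_iff]

theorem isEmb_glue_inr (F : TypedForest D T V) (G : TypedForest D T W) (a : Option (T × V)) :
    G.IsEmb (F.glue G a) .inr := by
  refine ⟨Sum.inr_injective, fun _ => rfl, fun t w w' => ?_⟩
  simp [glue, Option.map_eq_some_iff, Prod.ext_iff]

theorem mono_glue_none (K : Type*) [CommRing K] [Fintype V] [Fintype W] (F : TypedForest D T V)
    (G : TypedForest D T W) : (F.glue G none).mono K = F.mono K * G.mono K := by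
  rw [mono_eq_mul K (F.glue G none) (U := Set.range .inl), (F.isEmb_glue_inl G none).mono,
    (F.isEmb_glue_inr G none).mono, Set.compl_range_inl]
  rintro (u | u) (v | v) ⟨t, h⟩ <;> simp [glue] at h ⊢

end TypedForest

namespace TypedTree

variable {D T : Type*}

/-- The number of vertices of a tree. -/
def size (τ : TypedTree D T) : ℕ :=
  Quotient.liftOn (s := typedTreeSetoid D T) τ (fun x => x.1) fun _ _ he =>
    he.elim fun e _ => by simpa using Fintype.card_congr e

theorem _root_.TypedForest.size_cls {V : Type*} [Finite V] (F : TypedForest D T V)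
    (h : F.IsTree) : (F.cls h).size = Nat.card V := rfl

theorem exists_cls (τ : TypedTree D T) :
    ∃ (n : ℕ) (F : TypedForest D T (Fin n)) (h : F.IsTree), F.cls h = τ := by
  induction τ using Quotient.inductionOn with
  | h x => exact ⟨x.1, x.2.1, x.2.2, Quotient.sound ⟨_, (x.2.1.isIso_transport _).symm⟩⟩

/-- A forest representing a tree. -/
noncomputable def rep (τ : TypedTree D T) : TypedForest D T (Fin τ.exists_cls.choose) :=
  τ.exists_cls.choose_spec.choose

theorem isTree_rep (τ : TypedTree D T) : τ.rep.IsTree :=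
  τ.exists_cls.choose_spec.choose_spec.choose

theorem cls_rep (τ : TypedTree D T) : τ.rep.cls τ.isTree_rep = τ :=
  τ.exists_cls.choose_spec.choose_spec.choose_spec

theorem mono_rep (K : Type*) [CommRing K] (τ : TypedTree D T) :
    τ.rep.mono K = MvPolynomial.X τ := by
  rw [TypedForest.mono_eq_X K τ.isTree_rep, cls_rep]

theorem size_eq (τ : TypedTree D T) : τ.size = Nat.card (Fin τ.exists_cls.choose) := by
  conv_lhs => rw [← τ.cls_rep, TypedForest.size_cls]

end TypedTree

namespace TypedForest

variable {D T V W X : Type*} {F : TypedForest D T V}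

theorem exists_mono_eq_monomial (K : Type*) [CommRing K] (s : TypedTree D T →₀ ℕ) :
    ∃ (V : Type) (_ : Fintype V) (F : TypedForest D T V),
      F.mono K = MvPolynomial.monomial s 1 := by
  have hz : ∃ (V : Type) (_ : Fintype V) (F : TypedForest D T V), F.mono K = 1 :=
    ⟨Empty, inferInstance, ⟨Empty.elim, Empty.elim, ⟨fun v => v.elim⟩⟩, mono_of_isEmpty K _⟩
  have hadd : ∀ s s' : TypedTree D T →₀ ℕ,
      (∃ (V : Type) (_ : Fintype V) (F : TypedForest D T V),
        F.mono K = MvPolynomial.monomial s 1) →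
      (∃ (V : Type) (_ : Fintype V) (F : TypedForest D T V),
        F.mono K = MvPolynomial.monomial s' 1) →
      ∃ (V : Type) (_ : Fintype V) (F : TypedForest D T V),
        F.mono K = MvPolynomial.monomial (s + s') 1 := by
    rintro s s' ⟨V, _, F, hF⟩ ⟨W, _, G, hG⟩
    refine ⟨V ⊕ W, inferInstance, F.glue G none, ?_⟩
    rw [mono_glue_none, hF, hG, MvPolynomial.monomial_mul, mul_one]
  induction s using Finsupp.induction_linear with
  | zero => exact hz
  | add s s' h h' => exact hadd s s' h h'
  | single τ n =>
    induction n with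
    | zero => simpa using hz
    | succ n ih =>
      rw [Finsupp.single_add]
      exact hadd _ _ ih ⟨_, inferInstance, τ.rep, τ.mono_rep K⟩

/-- The forests span `ForestAlg K D T`. -/
theorem linearMap_ext_mono {K M : Type*} [CommRing K] [AddCommGroup M] [Module K M]
    {f g : ForestAlg K D T →ₗ[K] M}
    (h : ∀ (V : Type) [Fintype V] (F : TypedForest D T V), f (F.mono K) = g (F.mono K)) :
    f = g := by
  refine MvPolynomial.linearMap_ext fun s => LinearMap.ext_ring ?_
  obtain ⟨V, _, F, hF⟩ := exists_mono_eq_monomial K s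
  simpa [hF] using h V F

theorem size_branch_le [Finite V] (F : TypedForest D T V) (v : V) :
    (F.branch v).size ≤ Nat.card V :=
  Finite.card_subtype_le _

/-- Two algebra morphisms that agree on the trees with at most `n` vertices agree on the forests
with at most `n` vertices. -/
theorem algHom_subMono_congr {K A : Type*} [CommRing K] [CommRing A] [Algebra K A] [Finite V]
    {f g : ForestAlg K D T →ₐ[K] A} {S : Set V} (F : TypedForest D T V)
    (h : ∀ τ : TypedTree D T, τ.size ≤ S.ncard → f (MvPolynomial.X τ) = g (MvPolynomial.X τ)) :
    f (F.subMono K S) = g (F.subMono K S) := by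
  let _ := Fintype.ofFinite S
  rw [← mono_restrict]
  unfold TypedForest.mono
  rw [map_prod, map_prod]
  exact Finset.prod_congr rfl fun v _ => h _ (size_branch_le _ _)

/-! ### The Hopf algebra of typed forests -/

section hopf

variable {K : Type*} [CommRing K] (lam : T → K)

open Classical in
/-- The coproduct of a forest is the sum over its unions of trunks. -/
theorem ckComul_mono [Fintype V] (F : TypedForest D T V) :
    ckComul lam (F.mono K) = ∑ U : Set V with F.IsTrunk Set.univ U,
      F.cutWeight lam Set.univ U • (F.subMono K U ⊗ₜ[K] F.subMono K Uᶜ) := by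
  simp only [Set.compl_eq_univ_sdiff]
  rw [← subMono_univ, ckComul_subMono]
  rfl

theorem ckCounit_subMono [Finite V] (F : TypedForest D T V) {S : Set V} (hS : S.Nonempty) :
    ckCounit K D T (F.subMono K S) = 0 := by
  classical
  let _ := Fintype.ofFinite S
  obtain ⟨v, hv⟩ := hS
  obtain ⟨r, hr, -⟩ := (F.restrict S).exists_isRoot_anc ⟨v, hv⟩
  rw [← mono_restrict]
  unfold TypedForest.mono
  rw [map_prod]
  exact Finset.prod_eq_zero (i := r) (by simpa using hr) (by simp [ckCounit])

/-- Both sides are sums over the chains of trunks `A ⊆ U`: choosing `U` and then a trunk `A` of `U`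
is the same as choosing `A` and then the trunk `U \ A` of the complement of `A`. -/
theorem ckComul_coassoc :
    (TensorProduct.assoc K (ForestAlg K D T) (ForestAlg K D T) (ForestAlg K D T)).toLinearMap ∘ₗ
      (ckComul lam).toLinearMap.rTensor (ForestAlg K D T) ∘ₗ (ckComul lam).toLinearMap =
    (ckComul lam).toLinearMap.lTensor (ForestAlg K D T) ∘ₗ (ckComul lam).toLinearMap := by
  classical
  refine linearMap_ext_mono fun V _ F => ?_
  simp only [LinearMap.comp_apply, AlgHom.toLinearMap_apply, ckComul_mono, map_sum, map_smul,
    LinearMap.rTensor_tmul, LinearMap.lTensor_tmul, ckComul_subMono, coproductSum,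
    TensorProduct.sum_tmul, TensorProduct.tmul_sum, ← TensorProduct.smul_tmul',
    TensorProduct.tmul_smul, Finset.smul_sum, smul_smul, LinearEquiv.coe_coe,
    TensorProduct.assoc_tmul]
  rw [Finset.sum_sigma', Finset.sum_sigma']
  refine Finset.sum_bij' (fun p _ => ⟨p.2, p.1 \ p.2⟩) (fun p _ => ⟨p.1 ∪ p.2, p.1⟩) ?_ ?_ ?_ ?_ ?_
  · rintro ⟨U, A⟩ h
    simp only [Finset.mem_sigma, Finset.mem_filter, Finset.mem_univ, true_and] at h ⊢
    obtain ⟨⟨-, hU⟩, hAU, hA⟩ := h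
    refine ⟨⟨Set.subset_univ _, fun u _ v hv hp => hA u (hU u trivial v (hAU hv) hp) v hv hp⟩,
      fun x hx => hx.2, fun u hu v hv hp => ⟨hU u trivial v hv.1 hp, hu⟩⟩
  · rintro ⟨A, B⟩ h
    simp only [Finset.mem_sigma, Finset.mem_filter, Finset.mem_univ, true_and] at h ⊢
    obtain ⟨⟨-, hA⟩, hBA, hB⟩ := h
    refine ⟨⟨Set.subset_univ _, ?_⟩, Set.subset_union_left, fun u _ v hv hp => hA u trivial v hv hp⟩
    rintro u - v (hv | hv) hp
    · exact Or.inl (hA u trivial v hv hp)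
    · by_cases hu : u ∈ A
      · exact Or.inl hu
      · exact Or.inr (hB u hu v hv hp)
  · rintro ⟨U, A⟩ h
    simp only [Finset.mem_sigma, Finset.mem_filter, Finset.mem_univ, true_and] at h
    simp only [Set.union_sdiff_cancel h.2.1]
  · rintro ⟨A, B⟩ h
    simp only [Finset.mem_sigma, Finset.mem_filter, Finset.mem_univ, true_and] at h
    have : (A ∪ B) \ A = B := by
      ext x
      have := @h.2.1 x
      simp only [Set.mem_sdiff, Set.mem_union, Set.mem_compl_iff] at this ⊢
      tauto
    simp only [this]
  · rintro ⟨U, A⟩ h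
    simp only [Finset.mem_sigma, Finset.mem_filter, Finset.mem_univ, true_and] at h ⊢
    obtain ⟨-, hAU, -⟩ := h
    have h1 : Aᶜ \ (U \ A) = Uᶜ := by
      ext x
      have := @hAU x
      simp only [Set.mem_sdiff, Set.mem_compl_iff] at this ⊢
      tauto
    rw [h1]
    congr 1
    unfold cutWeight
    rw [← Finset.prod_mul_distrib, ← Finset.prod_mul_distrib]
    refine Finset.prod_congr rfl fun v _ => ?_
    unfold cutFactor
    cases F.up v with
    | none => simp
    | some p =>
      have h1 := @hAU v
      have h2 := @hAU p.2
      by_cases hv : v ∈ U <;> by_cases hvA : v ∈ A <;> by_cases hp : p.2 ∈ U <;>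
        by_cases hpA : p.2 ∈ A <;> simp_all

theorem ckComul_counit_left :
    (ckCounit K D T).toLinearMap.rTensor (ForestAlg K D T) ∘ₗ (ckComul lam).toLinearMap =
      TensorProduct.mk K K (ForestAlg K D T) 1 := by
  classical
  refine linearMap_ext_mono fun V _ F => ?_
  simp only [LinearMap.comp_apply, AlgHom.toLinearMap_apply, ckComul_mono, map_sum, map_smul,
    LinearMap.rTensor_tmul]
  rw [Finset.sum_eq_single_of_mem ∅ (by simpa using F.isTrunk_empty _)]
  · simp [cutWeight_empty, subMono_empty, subMono_univ]
  · intro U _ hU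
    rw [ckCounit_subMono F (Set.nonempty_iff_ne_empty.2 hU), TensorProduct.zero_tmul, smul_zero]

theorem ckComul_counit_right :
    (ckCounit K D T).toLinearMap.lTensor (ForestAlg K D T) ∘ₗ (ckComul lam).toLinearMap =
      (TensorProduct.mk K (ForestAlg K D T) K).flip 1 := by
  classical
  refine linearMap_ext_mono fun V _ F => ?_
  simp only [LinearMap.comp_apply, AlgHom.toLinearMap_apply, ckComul_mono, map_sum, map_smul,
    LinearMap.lTensor_tmul]
  rw [Finset.sum_eq_single_of_mem Set.univ (by simpa using F.isTrunk_self _)]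
  · simp [cutWeight_self, subMono_empty, subMono_univ]
  · intro U _ hU
    rw [ckCounit_subMono F (Set.nonempty_compl.2 hU), TensorProduct.tmul_zero, smul_zero]

/-- The antipode `S` is defined on a tree, recursively on its size, by isolating the term `S(T)` of
`(S ⋆ id)(T) = 0`. -/
theorem exists_antipode_left :
    ∃ S : ForestAlg K D T →ₐ[K] ForestAlg K D T,
      LinearMap.mul' K (ForestAlg K D T) ∘ₗ S.toLinearMap.rTensor (ForestAlg K D T) ∘ₗ
        (ckComul lam).toLinearMap = Algebra.linearMap K _ ∘ₗ (ckCounit K D T).toLinearMap := by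
  classical
  obtain ⟨S, hS⟩ := MvPolynomial.exists_algHom_rec (K := K) (A := ForestAlg K D T)
    (TypedTree.size (D := D) (T := T)) (fun S τ =>
      -∑ U ∈ ({U : Set _ | τ.rep.IsTrunk Set.univ U} : Finset _).erase Set.univ,
        τ.rep.cutWeight lam Set.univ U • (S (τ.rep.subMono K U) * τ.rep.subMono K Uᶜ)) (by
      intro f g τ h
      refine congrArg _ (Finset.sum_congr rfl fun U hU => ?_)
      rw [algHom_subMono_congr τ.rep fun σ hσ => h σ (hσ.trans_lt ?_)]
      rw [τ.size_eq]
      exact Set.ncard_lt_card (Finset.ne_of_mem_erase hU))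
  refine ⟨S, ?_⟩
  have : (Algebra.TensorProduct.lift S (AlgHom.id K _) fun _ _ => Commute.all _ _).comp
      (ckComul lam) = (Algebra.ofId K _).comp (ckCounit K D T) := by
    refine MvPolynomial.algHom_ext fun τ => ?_
    rw [AlgHom.comp_apply, AlgHom.comp_apply, ← τ.mono_rep K, ckComul_mono, map_sum,
      ← Finset.add_sum_erase _ _ (a := Set.univ) (by simpa using τ.rep.isTrunk_self _)]
    simp only [map_smul, Algebra.TensorProduct.lift_tmul, AlgHom.id_apply]
    rw [subMono_univ, cutWeight_self, Set.compl_univ, subMono_empty, mul_one, one_smul,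
      τ.mono_rep K, hS]
    simp [ckCounit]
  refine LinearMap.ext fun x => ?_
  refine Eq.trans ?_ (AlgHom.congr_fun this x)
  simp only [LinearMap.comp_apply, AlgHom.toLinearMap_apply, AlgHom.comp_apply]
  generalize ckComul lam x = z
  induction z with
  | zero => simp
  | tmul a b => simp
  | add a b ha hb => simp only [map_add, ha, hb]

/-- The right antipode is obtained by isolating the term `S(T)` of `(id ⋆ S)(T) = 0`. -/
theorem exists_antipode_right :
    ∃ S : ForestAlg K D T →ₐ[K] ForestAlg K D T,
      LinearMap.mul' K (ForestAlg K D T) ∘ₗ S.toLinearMap.lTensor (ForestAlg K D T) ∘ₗ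
        (ckComul lam).toLinearMap = Algebra.linearMap K _ ∘ₗ (ckCounit K D T).toLinearMap := by
  classical
  obtain ⟨S, hS⟩ := MvPolynomial.exists_algHom_rec (K := K) (A := ForestAlg K D T)
    (TypedTree.size (D := D) (T := T)) (fun S τ =>
      -∑ U ∈ ({U : Set _ | τ.rep.IsTrunk Set.univ U} : Finset _).erase ∅,
        τ.rep.cutWeight lam Set.univ U • (τ.rep.subMono K U * S (τ.rep.subMono K Uᶜ))) (by
      intro f g τ h
      refine congrArg _ (Finset.sum_congr rfl fun U hU => ?_)
      rw [algHom_subMono_congr τ.rep fun σ hσ => h σ (hσ.trans_lt ?_)]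
      rw [τ.size_eq]
      refine Set.ncard_lt_card fun h => Finset.ne_of_mem_erase hU ?_
      rwa [Set.compl_univ_iff] at h)
  refine ⟨S, ?_⟩
  have : (Algebra.TensorProduct.lift (AlgHom.id K _) S fun _ _ => Commute.all _ _).comp
      (ckComul lam) = (Algebra.ofId K _).comp (ckCounit K D T) := by
    refine MvPolynomial.algHom_ext fun τ => ?_
    rw [AlgHom.comp_apply, AlgHom.comp_apply, ← τ.mono_rep K, ckComul_mono, map_sum,
      ← Finset.add_sum_erase _ _ (a := (∅ : Set _)) (by simpa using τ.rep.isTrunk_empty _)]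
    simp only [map_smul, Algebra.TensorProduct.lift_tmul, AlgHom.id_apply]
    rw [Set.compl_empty, subMono_univ, cutWeight_empty, subMono_empty, one_mul, one_smul,
      τ.mono_rep K, hS]
    simp [ckCounit]
  refine LinearMap.ext fun x => ?_
  refine Eq.trans ?_ (AlgHom.congr_fun this x)
  simp only [LinearMap.comp_apply, AlgHom.toLinearMap_apply, AlgHom.comp_apply]
  generalize ckComul lam x = z
  induction z with
  | zero => simp
  | tmul a b => simp
  | add a b ha hb => simp only [map_add, ha, hb]

theorem exists_isHopfAlgebra :
    ∃ S : ForestAlg K D T →ₗ[K] ForestAlg K D T,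
      IsHopfAlgebra (ckComul lam) (ckCounit K D T) S := by
  obtain ⟨S, hS⟩ := exists_antipode_left (D := D) lam
  obtain ⟨S', hS'⟩ := exists_antipode_right (D := D) lam
  exact ⟨S.toLinearMap, isHopfAlgebra_of_inverses (ckComul_coassoc lam) (ckComul_counit_left lam)
    (ckComul_counit_right lam) hS hS'⟩

end hopf

end TypedForest

namespace TypedForest

variable {D T V W X : Type*} {F : TypedForest D T V} {G : TypedForest D T W} {i : W → V} {t₀ : T}

/-! ### Partitions and induced subforests -/

/-- `U` is a union of classes of `s`. -/
def _root_.Setoid.Saturates (s : Setoid V) (U : Set V) : Prop := ∀ x y, s x y → (x ∈ U ↔ y ∈ U)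

theorem mem_block {s : Setoid V} {x y : V} : x ∈ block s (Quotient.mk s y) ↔ s x y :=
  Quotient.eq (r := s)

theorem _root_.Setoid.saturates_block (s : Setoid V) (v : V) :
    s.Saturates (block s (Quotient.mk s v)) := fun x y hxy => by
  rw [mem_block, mem_block]
  exact ⟨s.trans (s.symm hxy), s.trans hxy⟩

theorem _root_.Setoid.Saturates.mk_mem {s : Setoid V} {U : Set V} (hU : s.Saturates U) {v : V} :
    Quotient.mk s v ∈ Quotient.mk s '' U ↔ v ∈ U := by
  refine ⟨?_, fun h => ⟨v, h, rfl⟩⟩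
  rintro ⟨u, hu, huv⟩
  exact (hU u v (Quotient.eq.1 huv)).1 hu

theorem _root_.Setoid.Saturates.compl {s : Setoid V} {U : Set V} (hU : s.Saturates U) :
    s.Saturates Uᶜ := fun x y h => not_congr (hU x y h)

theorem IsEmb.exists_isIso_block (h : G.IsEmb F i) {s : Setoid V}
    (hs : s.Saturates (Set.range i)) (w : W) :
    ∃ e : block (s.comap i) (Quotient.mk _ w) ≃ block s (Quotient.mk s (i w)),
      (G.restrict (block (s.comap i) (Quotient.mk _ w))).IsIso
        (F.restrict (block s (Quotient.mk s (i w)))) e ∧ ∀ x, (e x : V) = i x := by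
  refine (h.comp (G.isEmb_restrict _)).exists_isIso (F.isEmb_restrict _) ?_
  rw [Subtype.range_coe]
  ext x
  simp only [Set.mem_range, Function.comp_apply, Subtype.exists, mem_block, Setoid.comap_rel,
    exists_prop]
  constructor
  · rintro ⟨y, hy, rfl⟩
    exact hy
  · intro hx
    obtain ⟨y, rfl⟩ := (hs x _ hx).2 ⟨w, rfl⟩
    exact ⟨y, hx, rfl⟩

theorem IsEmb.isTreePartition_comap (h : G.IsEmb F i) {s : Setoid V}
    (hs : s.Saturates (Set.range i)) :
    G.IsTreePartition t₀ (s.comap i) ↔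
      ∀ w, (F.restrict (block s (Quotient.mk s (i w)))).IsTree ∧
        (F.restrict (block s (Quotient.mk s (i w)))).RootAvoids t₀ := by
  refine Quotient.forall.trans (forall_congr' fun w => ?_)
  obtain ⟨e, he, -⟩ := h.exists_isIso_block hs w
  exact and_congr ⟨he.isTree, he.symm.isTree⟩ ⟨he.rootAvoids, he.symm.rootAvoids⟩

theorem isTreePartition_iff {s : Setoid V} : F.IsTreePartition t₀ s ↔
    ∀ v, (F.restrict (block s (Quotient.mk s v))).IsTree ∧
      (F.restrict (block s (Quotient.mk s v))).RootAvoids t₀ :=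
  Quotient.forall

/-- A union of blocks cuts a partition into trees into two such partitions. -/
theorem isTreePartition_iff_restrict {s : Setoid V} {U : Set V} (hs : s.Saturates U) :
    F.IsTreePartition t₀ s ↔
      (F.restrict U).IsTreePartition t₀ (s.comap (↑)) ∧
        (F.restrict Uᶜ).IsTreePartition t₀ (s.comap (↑)) := by
  rw [(F.isEmb_restrict U).isTreePartition_comap (by rwa [Subtype.range_coe]),
    (F.isEmb_restrict Uᶜ).isTreePartition_comap (by rw [Subtype.range_coe]; exact hs.compl),
    isTreePartition_iff]
  refine ⟨fun h => ⟨fun w => h w, fun w => h w⟩, fun h v => ?_⟩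
  by_cases hv : v ∈ U
  · exact h.1 ⟨v, hv⟩
  · exact h.2 ⟨v, hv⟩

section contract

variable {s : Setoid V}

/-- A vertex whose parent is in another block is the root of its block. -/
theorem eq_blockRoot (h : F.IsTreePartition t₀ s) {p v : V} (hp : F.Parent p v) (hs : ¬ s v p) :
    v = blockRoot h (Quotient.mk s v) := by
  have hE := F.isEmb_restrict (block s (Quotient.mk s v))
  have hr : (F.restrict (block s (Quotient.mk s v))).IsRoot ⟨v, rfl⟩ := by
    by_contra hr
    obtain ⟨q, hq⟩ := exists_parent hr
    have := (hE.parent.2 hq).unique hp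
    have hqs := mem_block.1 q.2
    rw [this] at hqs
    exact hs (s.symm hqs)
  exact congrArg Subtype.val ((h (Quotient.mk s v)).1.unique hr (isRoot_root _ _))

/-- If no edge joins `U` to its complement, a partition into trees does not mix them. -/
theorem IsTreePartition.saturates (h : F.IsTreePartition t₀ s) {U : Set V}
    (hU : ∀ u v, F.Parent u v → (u ∈ U ↔ v ∈ U)) : s.Saturates U := by
  have key : ∀ u v, F.Anc u v → (u ∈ U ↔ v ∈ U) := by
    intro u v k
    induction k with
    | refl => rfl
    | tail _ hp ih => exact ih.trans (hU _ _ hp)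
  intro x y hxy
  rw [← key _ _ (anc_blockRoot h x), ← key _ _ (anc_blockRoot h y), Quotient.sound hxy]

variable [Finite V]

theorem contract_up (h : F.IsTreePartition t₀ s) {q q' : Quotient s} {u : Unit} :
    (contract h).up q = some (u, q') ↔ ∃ p, F.Parent p (blockRoot h q) ∧ Quotient.mk s p = q' := by
  simp only [contract, Option.map_eq_some_iff, Parent, Prod.mk.injEq]
  constructor
  · rintro ⟨⟨t, w⟩, hw, -, rfl⟩
    exact ⟨w, ⟨t, hw⟩, rfl⟩
  · rintro ⟨w, ⟨t, hw⟩, rfl⟩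
    exact ⟨⟨t, w⟩, hw, trivial, rfl⟩

theorem contract_parent (h : F.IsTreePartition t₀ s) {q q' : Quotient s} :
    (contract h).Parent q' q ↔ ∃ p, F.Parent p (blockRoot h q) ∧ Quotient.mk s p = q' :=
  ⟨fun ⟨_, k⟩ => (contract_up h).1 k, fun k => ⟨(), (contract_up h).2 k⟩⟩

theorem contract_parent_mk (h : F.IsTreePartition t₀ s) {p v : V} (hp : F.Parent p v)
    (hs : ¬ s v p) : (contract h).Parent (Quotient.mk s p) (Quotient.mk s v) :=
  (contract_parent h).2 ⟨p, eq_blockRoot h hp hs ▸ hp, rfl⟩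

/-- Contraction commutes with the restriction to a union of blocks. -/
theorem IsEmb.contract [Finite W] (h : G.IsEmb F i) (hs : s.Saturates (Set.range i))
    (hF : F.IsTreePartition t₀ s) (hG : G.IsTreePartition t₀ (s.comap i)) :
    (contract hG).IsEmb (contract hF) (Quotient.map i fun _ _ k => k) := by
  have hroot : ∀ q, i (blockRoot hG q) = blockRoot hF (Quotient.map i (fun _ _ k => k) q) := by
    refine Quotient.ind fun w => ?_
    obtain ⟨e, he, hei⟩ := h.exists_isIso_block hs w
    have := he.root (hG (Quotient.mk _ w)).1 (hF (Quotient.mk s (i w))).1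
    exact (hei _).symm.trans (congrArg Subtype.val this)
  refine ⟨?_, ?_, ?_⟩
  · intro q q'
    induction q, q' using Quotient.inductionOn₂ with
    | h w w' =>
      intro k
      have k' : s (i w) (i w') := Quotient.exact k
      exact Quotient.sound (s := s.comap i) k'
  · refine Quotient.ind fun w => Subtype.ext ?_
    obtain ⟨e, he, -⟩ := h.exists_isIso_block hs w
    exact (he.cls (hG (Quotient.mk _ w)).1 (hF (Quotient.mk s (i w))).1).symm
  · intro t q q'
    rw [contract_up, contract_up, ← hroot]
    induction q' using Quotient.inductionOn with
    | h w =>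
      constructor
      · rintro ⟨p, hp, hpw⟩
        exact ⟨i p, h.parent.2 hp, Quotient.sound (Quotient.exact (s := s.comap i) hpw)⟩
      · rintro ⟨p, hp, hpw⟩
        have hpw' : s p (i w) := Quotient.exact hpw
        obtain ⟨p, rfl⟩ := (hs _ _ hpw').2 ⟨w, rfl⟩
        exact ⟨p, h.parent.1 hp, Quotient.sound (s := s.comap i) hpw'⟩

/-- Unions of trunks of the contracted forest are the unions of trunks of `F` that are unions of
blocks. -/
theorem isTrunk_contract (h : F.IsTreePartition t₀ s) {U : Set V} (hs : s.Saturates U) :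
    (contract h).IsTrunk Set.univ (Quotient.mk s '' U) ↔ F.IsTrunk Set.univ U := by
  constructor
  · rintro ⟨-, hU⟩
    refine ⟨Set.subset_univ _, fun p _ v hv hp => ?_⟩
    by_cases hpv : s v p
    · exact (hs _ _ hpv).1 hv
    · exact hs.mk_mem.1 (hU _ trivial _ ⟨v, hv, rfl⟩ (contract_parent_mk h hp hpv))
  · rintro ⟨-, hU⟩
    refine ⟨Set.subset_univ _, ?_⟩
    rintro q - _ ⟨v, hv, rfl⟩ hq
    obtain ⟨p, hp, rfl⟩ := (contract_parent h).1 hq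
    have hr : s (blockRoot h (Quotient.mk s v)) v := Quotient.exact (mk_blockRoot h _)
    exact ⟨p, hU p trivial _ ((hs _ _ hr).2 hv) hp, rfl⟩

end contract

/-! ### The sum over all contractions -/

/-- Sums over all the partitions of a finite set of vertices are sums over this type. -/
noncomputable instance fintypeSetoid [Finite V] : Fintype (Setoid V) := Fintype.ofFinite _

section sum

variable {K : Type*} [CommRing K] (lam : T → K) {s : Setoid V}

open Classical in
/-- The monomial of the contracted forest, extended by zero to all partitions. -/
noncomputable def contractMono (K : Type*) [CommRing K] [Finite V] (t₀ : T)
    (F : TypedForest D T V) (s : Setoid V) : ForestAlg K (AvoidingTree D T t₀) Unit :=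
  if h : F.IsTreePartition t₀ s then (contract h).subMono K Set.univ else 0

theorem contractMono_of [Finite V] (h : F.IsTreePartition t₀ s) :
    F.contractMono K t₀ s = (contract h).subMono K Set.univ := dif_pos h

theorem contractMono_of_not [Finite V] (h : ¬ F.IsTreePartition t₀ s) :
    F.contractMono K t₀ s = 0 := dif_neg h

/-- The sum over the tree partitions is a sum over all partitions. -/
theorem contractionSum_eq [Fintype V] (F : TypedForest D T V) :
    F.contractionSum lam t₀ = ∑ s, F.outerWeight lam s • F.contractMono K t₀ s := by
  classical
  have h : ∀ s ∈ Finset.univ, F.outerWeight lam s • F.contractMono K t₀ s ≠ 0 →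
      F.IsTreePartition t₀ s := by
    intro s _ hs
    by_contra hn
    exact hs (by rw [contractMono_of_not hn, smul_zero])
  unfold contractionSum
  rw [← Finset.sum_filter_of_ne h]
  symm
  refine Finset.sum_bij (fun s hs => ⟨s, (Finset.mem_filter.1 hs).2⟩)
    (fun _ _ => @Finset.mem_univ _ (_) _)
    (fun _ _ _ _ h => congrArg Subtype.val h)
    (fun s _ => ⟨s.1, Finset.mem_filter.2 ⟨Finset.mem_univ _, s.2⟩, rfl⟩) fun s hs => ?_
  rw [contractMono_of (Finset.mem_filter.1 hs).2, subMono_univ]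

open Classical in
/-- The contribution to `outerWeight` of the edge whose lower endpoint is `v`, restricted to the
subforest induced on `S`. -/
noncomputable def outerFactor (F : TypedForest D T V) (S : Set V) (s : Setoid V) (v : V) : K :=
  match F.up v with
  | none => 1
  | some p => if v ∈ S ∧ p.2 ∈ S ∧ ¬ s v p.2 then lam p.1 else 1

theorem IsEmb.outerWeight [Fintype V] [Fintype W] (h : G.IsEmb F i) (s : Setoid V) :
    G.outerWeight lam (s.comap i) = ∏ v, F.outerFactor lam (Set.range i) s v := by
  classical
  unfold TypedForest.outerWeight
  rw [Finset.prod_filter]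
  refine Finset.prod_of_injOn i h.injective.injOn (fun _ _ => Finset.mem_coe.2 (Finset.mem_univ _))
    ?_ fun w _ => ?_
  · intro v _ hv
    unfold outerFactor
    split
    · rfl
    · refine if_neg ?_
      rintro ⟨⟨w, rfl⟩, -⟩
      exact hv ⟨w, by simp, rfl⟩
  · unfold outerFactor edgeWeight
    cases hG : G.up w with
    | some p =>
      rw [(h.up p.1 w p.2).1 hG]
      have hiff : (∃ t w', some p = some (t, w') ∧ ¬ s.comap i w w') ↔ ¬ s (i w) (i p.2) := by
        constructor
        · rintro ⟨t, w', h, hs⟩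
          cases h
          exact hs
        · exact fun hs => ⟨p.1, p.2, rfl, hs⟩
      by_cases hs : s (i w) (i p.2) <;> simp only [hiff] <;> simp [hs]
    | none =>
      rw [ite_self]
      cases hF : F.up (i w) with
      | none => rfl
      | some p =>
        refine (if_neg ?_).symm
        rintro ⟨-, ⟨x, hx⟩, -⟩
        have := (h.up p.1 w x).2 (by rw [hF, hx])
        simp [hG] at this

theorem outerWeight_eq [Fintype V] (F : TypedForest D T V) (s : Setoid V) :
    F.outerWeight lam s = ∏ v, F.outerFactor lam Set.univ s v := by
  have := (IsIso.refl F).isEmb.outerWeight lam s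
  rwa [(Equiv.refl V).range_eq_univ] at this

/-- If the trunk `U` is a union of blocks, the edges between blocks are those that leave `U` and
those inside `U` or inside its complement. -/
theorem outerWeight_eq_mul [Fintype V] (F : TypedForest D T V) {U : Set V} [Fintype U]
    [Fintype (Uᶜ : Set V)] (hU : F.IsTrunk Set.univ U) (hs : s.Saturates U) :
    F.outerWeight lam s = F.cutWeight lam Set.univ U *
      ((F.restrict U).outerWeight lam (s.comap (↑)) *
        (F.restrict Uᶜ).outerWeight lam (s.comap (↑))) := by
  rw [outerWeight_eq, (F.isEmb_restrict U).outerWeight, (F.isEmb_restrict Uᶜ).outerWeight,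
    cutWeight, ← Finset.prod_mul_distrib, ← Finset.prod_mul_distrib]
  refine Finset.prod_congr rfl fun v _ => ?_
  rw [Subtype.range_coe, Subtype.range_coe]
  unfold outerFactor cutFactor
  cases hv : F.up v with
  | none => simp
  | some p =>
    by_cases h1 : v ∈ U
    · have := hU.2 p.2 trivial v h1 ⟨p.1, hv⟩
      by_cases h3 : s v p.2 <;> simp [h1, this, h3]
    · by_cases h2 : p.2 ∈ U
      · have : ¬ s v p.2 := fun h => h1 ((hs _ _ h).2 h2)
        simp [h1, h2, this]
      · by_cases h3 : s v p.2 <;> simp [h1, h2, h3]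

theorem IsEmb.contractMono [Finite V] [Finite W] (h : G.IsEmb F i)
    (hs : s.Saturates (Set.range i)) (hF : F.IsTreePartition t₀ s)
    (hG : G.IsTreePartition t₀ (s.comap i)) :
    G.contractMono K t₀ (s.comap i) =
      (TypedForest.contract hF).subMono K (Quotient.mk s '' Set.range i) := by
  rw [contractMono_of hG, (h.contract hs hF hG).subMono, Set.image_univ]
  congr 1
  ext q
  constructor
  · rintro ⟨q, rfl⟩
    induction q using Quotient.inductionOn with
    | h w => exact ⟨i w, ⟨w, rfl⟩, rfl⟩
  · rintro ⟨_, ⟨w, rfl⟩, rfl⟩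
    exact ⟨Quotient.mk _ w, rfl⟩

theorem contractMono_restrict [Finite V] {U : Set V} (hs : s.Saturates U)
    (hF : F.IsTreePartition t₀ s) :
    (F.restrict U).contractMono K t₀ (s.comap (↑)) =
      (contract hF).subMono K (Quotient.mk s '' U) := by
  have h := (F.isEmb_restrict U).contractMono (K := K) (by rwa [Subtype.range_coe]) hF
    ((isTreePartition_iff_restrict hs).1 hF).1
  rwa [Subtype.range_coe] at h

theorem _root_.Setoid.Saturates.image_compl {U : Set V} (hs : s.Saturates U) :
    Quotient.mk s '' Uᶜ = (Quotient.mk s '' U)ᶜ := by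
  ext q
  induction q using Quotient.inductionOn with
  | h v => rw [Set.mem_compl_iff, hs.mk_mem, hs.compl.mk_mem, Set.mem_compl_iff]

theorem contractMono_restrict_compl [Finite V] {U : Set V} (hs : s.Saturates U)
    (hF : F.IsTreePartition t₀ s) :
    (F.restrict Uᶜ).contractMono K t₀ (s.comap (↑)) =
      (contract hF).subMono K (Quotient.mk s '' U)ᶜ := by
  rw [contractMono_restrict hs.compl hF, hs.image_compl]

theorem IsIso.contractionSum [Fintype V] [Fintype W] {e : V ≃ W} (h : F.IsIso G e) :
    F.contractionSum lam t₀ = G.contractionSum lam t₀ := by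
  classical
  rw [contractionSum_eq, contractionSum_eq]
  symm
  refine Fintype.sum_bijective (Setoid.comap e)
    ⟨Setoid.comap_injective e e.surjective, Setoid.comap_surjective e e.injective⟩ _ _ fun s => ?_
  have hE := h.isEmb
  have hr : Set.range e = Set.univ := e.range_eq_univ
  have hs : s.Saturates (Set.range e) := fun x y _ => by simp
  have hiff : F.IsTreePartition t₀ (s.comap e) ↔ G.IsTreePartition t₀ s := by
    rw [hE.isTreePartition_comap hs, isTreePartition_iff]
    exact e.forall_congr_right (q := fun w => (G.restrict (block s (Quotient.mk s w))).IsTree ∧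
        (G.restrict (block s (Quotient.mk s w))).RootAvoids t₀)
  rw [hE.outerWeight, hr, ← outerWeight_eq]
  congr 1
  by_cases hG : G.IsTreePartition t₀ s
  · rw [hE.contractMono hs hG (hiff.2 hG), contractMono_of hG, hr, Set.image_univ,
      Set.range_eq_univ.2 Quotient.mk_surjective]
  · rw [contractMono_of_not hG, contractMono_of_not (mt hiff.1 hG)]

end sum

/-! ### Partitions of a set and of its complement -/

/-- The partition made of a partition of `U` and a partition of its complement. -/
def _root_.Setoid.join (U : Set V) (s₁ : Setoid U) (s₂ : Setoid (Uᶜ : Set V)) : Setoid V where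
  r x y := (∃ (hx : x ∈ U) (hy : y ∈ U), s₁ ⟨x, hx⟩ ⟨y, hy⟩) ∨
    ∃ (hx : x ∈ Uᶜ) (hy : y ∈ Uᶜ), s₂ ⟨x, hx⟩ ⟨y, hy⟩
  iseqv := by
    refine ⟨fun x => ?_, ?_, ?_⟩
    · by_cases hx : x ∈ U
      · exact Or.inl ⟨hx, hx, s₁.refl _⟩
      · exact Or.inr ⟨hx, hx, s₂.refl _⟩
    · rintro x y (⟨hx, hy, h⟩ | ⟨hx, hy, h⟩)
      · exact Or.inl ⟨hy, hx, s₁.symm h⟩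
      · exact Or.inr ⟨hy, hx, s₂.symm h⟩
    · rintro x y z (⟨hx, hy, h⟩ | ⟨hx, hy, h⟩) (⟨hy', hz, k⟩ | ⟨hy', hz, k⟩)
      · exact Or.inl ⟨hx, hz, s₁.trans h k⟩
      · exact absurd hy hy'
      · exact absurd hy' hy
      · exact Or.inr ⟨hx, hz, s₂.trans h k⟩

theorem _root_.Setoid.saturates_join (U : Set V) (s₁ : Setoid U) (s₂ : Setoid (Uᶜ : Set V)) :
    (Setoid.join U s₁ s₂).Saturates U := by
  rintro x y (⟨hx, hy, -⟩ | ⟨hx, hy, -⟩)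
  · exact iff_of_true hx hy
  · exact iff_of_false hx hy

theorem _root_.Setoid.comap_join_left (U : Set V) (s₁ : Setoid U) (s₂ : Setoid (Uᶜ : Set V)) :
    (Setoid.join U s₁ s₂).comap (↑) = s₁ := by
  ext x y
  constructor
  · rintro (⟨hx, hy, h⟩ | ⟨hx, -⟩)
    · exact h
    · exact absurd x.2 hx
  · exact fun h => Or.inl ⟨x.2, y.2, h⟩

theorem _root_.Setoid.comap_join_right (U : Set V) (s₁ : Setoid U) (s₂ : Setoid (Uᶜ : Set V)) :
    (Setoid.join U s₁ s₂).comap (↑) = s₂ := by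
  ext x y
  constructor
  · rintro (⟨hx, -⟩ | ⟨hx, hy, h⟩)
    · exact absurd hx x.2
    · exact h
  · exact fun h => Or.inr ⟨x.2, y.2, h⟩

theorem _root_.Setoid.Saturates.join_comap {s : Setoid V} {U : Set V} (hs : s.Saturates U) :
    Setoid.join U (s.comap (↑)) (s.comap (↑)) = s := by
  ext x y
  constructor
  · rintro (⟨hx, hy, h⟩ | ⟨hx, hy, h⟩) <;> exact h
  · intro h
    by_cases hx : x ∈ U
    · exact Or.inl ⟨hx, (hs x y h).1 hx, h⟩
    · exact Or.inr ⟨hx, fun hy => hx ((hs x y h).2 hy), h⟩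

open Classical in
/-- A partition saturating `U` amounts to a partition of `U` and a partition of its complement. -/
theorem _root_.Setoid.sum_saturates {M : Type*} [AddCommMonoid M] [Finite V] (U : Set V)
    (f : Setoid U → Setoid (Uᶜ : Set V) → M) :
    ∑ s : Setoid V with s.Saturates U, f (s.comap (↑)) (s.comap (↑)) = ∑ s₁, ∑ s₂, f s₁ s₂ := by
  rw [← Finset.sum_product']
  refine Finset.sum_bij' (fun s _ => (s.comap (↑), s.comap (↑)))
    (fun p _ => Setoid.join U p.1 p.2) (fun _ _ => by simp) ?_ ?_ ?_ fun _ _ => rfl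
  · intro p _
    simpa using Setoid.saturates_join U p.1 p.2
  · intro s hs
    exact Setoid.Saturates.join_comap (by simpa using hs)
  · intro p _
    exact Prod.ext (Setoid.comap_join_left ..) (Setoid.comap_join_right ..)

section morphism

variable {K : Type*} [CommRing K] (lam : T → K)

theorem cutWeight_eq_one [Fintype V] {U : Set V} (hU : ∀ u v, F.Parent u v → (u ∈ U ↔ v ∈ U)) :
    F.cutWeight lam Set.univ U = 1 := by
  refine Finset.prod_eq_one fun v _ => ?_
  unfold cutFactor
  split
  · rfl
  · rename_i p hp
    exact if_neg fun h => h.2.1 ((hU p.2 v ⟨p.1, hp⟩).1 h.2.2)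

/-- Contractions of a disjoint union. -/
theorem contractionSum_eq_mul [Fintype V] (F : TypedForest D T V) {U : Set V} [Fintype U]
    [Fintype (Uᶜ : Set V)] (hU : ∀ u v, F.Parent u v → (u ∈ U ↔ v ∈ U)) :
    F.contractionSum lam t₀ =
      (F.restrict U).contractionSum lam t₀ * (F.restrict Uᶜ).contractionSum lam t₀ := by
  classical
  have h : ∀ s ∈ Finset.univ, F.outerWeight lam s • F.contractMono K t₀ s ≠ 0 →
      s.Saturates U := by
    intro s _ hs
    by_contra hn
    refine hs ?_
    rw [contractMono_of_not fun h => hn (h.saturates hU), smul_zero]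
  simp only [contractionSum_eq]
  rw [← Finset.sum_filter_of_ne h, Finset.sum_mul_sum, ← Setoid.sum_saturates U]
  refine Finset.sum_congr rfl fun s hs => ?_
  replace hs : s.Saturates U := by simpa using hs
  rw [smul_mul_smul_comm, outerWeight_eq_mul lam F
    ⟨Set.subset_univ _, fun u _ v hv hp => (hU u v hp).2 hv⟩ hs, cutWeight_eq_one lam hU, one_mul]
  congr 1
  by_cases hF : F.IsTreePartition t₀ s
  · rw [contractMono_restrict hs hF, contractMono_restrict_compl hs hF, contractMono_of hF]
    have := (contract hF).subMono_eq_mul K (Set.subset_univ (Quotient.mk s '' U)) (by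
      rintro q - q' - hq
      obtain ⟨p, hp, rfl⟩ := (contract_parent hF).1 hq
      rw [hs.mk_mem, hU p _ hp, ← hs.mk_mem, mk_blockRoot])
    rwa [← Set.compl_eq_univ_sdiff] at this
  · rw [contractMono_of_not hF]
    rw [isTreePartition_iff_restrict hs, not_and_or] at hF
    rcases hF with hF | hF
    · rw [contractMono_of_not hF, zero_mul]
    · rw [contractMono_of_not hF, mul_zero]

theorem contractionSum_of_isEmpty [Fintype V] [IsEmpty V] (F : TypedForest D T V) :
    F.contractionSum lam t₀ = 1 := by
  have : Subsingleton (Setoid V) := ⟨fun a b => Setoid.ext fun x => isEmptyElim x⟩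
  have h : F.IsTreePartition t₀ ⊥ := Quotient.ind fun x => isEmptyElim x
  rw [contractionSum_eq, Fintype.sum_subsingleton _ ⊥, contractMono_of h, outerWeight_eq,
    Finset.univ_eq_empty, Finset.prod_empty, one_smul]
  have : (Set.univ : Set (Quotient (⊥ : Setoid V))) = ∅ :=
    Set.eq_empty_of_forall_notMem fun q => Quotient.inductionOn q fun x => isEmptyElim x
  rw [this, subMono_empty]

open Classical in
/-- The coproduct of the sum over all contractions: trunks of contracted forests are contracted
trunks. -/
theorem ckComul_contractionSum [Fintype V] (F : TypedForest D T V) :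
    ckComul (fun _ : Unit => (1 : K)) (F.contractionSum lam t₀) =
      ∑ U : Set V with F.IsTrunk Set.univ U, F.cutWeight lam Set.univ U •
        ((F.restrict U).contractionSum lam t₀ ⊗ₜ[K] (F.restrict Uᶜ).contractionSum lam t₀) := by
  -- For each partition, trunks of the contracted forest are the saturated trunks of `F`.
  have h1 : ∀ s : Setoid V, ckComul (fun _ : Unit => (1 : K)) (F.contractMono K t₀ s) =
      ∑ U : Set V with F.IsTrunk Set.univ U ∧ s.Saturates U,
        (F.restrict U).contractMono K t₀ (s.comap (↑)) ⊗ₜ[K]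
          (F.restrict Uᶜ).contractMono K t₀ (s.comap (↑)) := by
    intro s
    by_cases hF : F.IsTreePartition t₀ s
    · rw [contractMono_of hF, subMono_univ, ckComul_mono]
      symm
      refine Finset.sum_bij' (fun U _ => Quotient.mk s '' U) (fun Q _ => Quotient.mk s ⁻¹' Q)
        ?_ ?_ ?_ ?_ ?_
      · intro U hU
        simp only [Finset.mem_filter, Finset.mem_univ, true_and] at hU ⊢
        exact (isTrunk_contract hF hU.2).2 hU.1
      · intro Q hQ
        simp only [Finset.mem_filter, Finset.mem_univ, true_and] at hQ ⊢
        have hs : s.Saturates (Quotient.mk s ⁻¹' Q) := fun x y h => by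
          simp only [Set.mem_preimage, Quotient.sound h]
        refine ⟨(isTrunk_contract hF hs).1 ?_, hs⟩
        rwa [Set.image_preimage_eq _ Quotient.mk_surjective]
      · intro U hU
        simp only [Finset.mem_filter, Finset.mem_univ, true_and] at hU
        ext v
        exact hU.2.mk_mem
      · intro Q _
        exact Set.image_preimage_eq _ Quotient.mk_surjective
      · intro U hU
        simp only [Finset.mem_filter, Finset.mem_univ, true_and] at hU
        rw [contractMono_restrict hU.2 hF, contractMono_restrict_compl hU.2 hF]
        have : (contract hF).cutWeight (fun _ : Unit => (1 : K)) Set.univ (Quotient.mk s '' U)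
            = 1 := by
          refine Finset.prod_eq_one fun v _ => ?_
          unfold cutFactor
          split
          · rfl
          · exact ite_self _
        rw [this, one_smul]
    · rw [contractMono_of_not hF, map_zero]
      refine (Finset.sum_eq_zero fun U hU => ?_).symm
      simp only [Finset.mem_filter, Finset.mem_univ, true_and] at hU
      rw [isTreePartition_iff_restrict hU.2, not_and_or] at hF
      rcases hF with hF | hF
      · rw [contractMono_of_not hF, TensorProduct.zero_tmul]
      · rw [contractMono_of_not hF, TensorProduct.tmul_zero]
  simp only [contractionSum_eq, map_sum, map_smul, h1, Finset.smul_sum, TensorProduct.sum_tmul,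
    TensorProduct.tmul_sum]
  rw [Finset.sum_comm' (t' := {U : Set V | F.IsTrunk Set.univ U})
    (s' := fun U => {s : Setoid V | s.Saturates U})
      (by simp [and_comm])]
  refine Finset.sum_congr rfl fun U hU => ?_
  replace hU : F.IsTrunk Set.univ U := by simpa using hU
  rw [Finset.sum_comm, ← Setoid.sum_saturates U]
  refine Finset.sum_congr rfl fun s hs => ?_
  replace hs : s.Saturates U := by simpa using hs
  rw [outerWeight_eq_mul lam F hU hs, TensorProduct.smul_tmul_smul, smul_smul]

end morphism

end TypedForest

namespace TypedForest

variable {D T V W X : Type*} {F : TypedForest D T V} {G : TypedForest D T W} {i : W → V} {t₀ : T}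

/-! ### The contraction morphism -/

theorem exists_isIso_of_cls_eq [Finite V] [Finite W] {hF : F.IsTree} {hG : G.IsTree}
    (h : F.cls hF = G.cls hG) : ∃ e, F.IsIso G e := by
  obtain ⟨e, he⟩ := Quotient.exact h
  exact ⟨_, ((F.isIso_transport _).trans he).trans (G.isIso_transport _).symm⟩

section

variable {K : Type*} [CommRing K] (lam : T → K)

/-- The algebra morphism that sends a forest to the weighted sum of its contractions. -/
noncomputable def contractionHom (lam : T → K) (t₀ : T) :
    ForestAlg K D T →ₐ[K] ForestAlg K (AvoidingTree D T t₀) Unit :=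
  MvPolynomial.aeval fun τ => τ.rep.contractionSum lam t₀

/-- `contractionHom` is defined on trees only; its value on a forest is the sum over contractions
because this sum is multiplicative. -/
theorem contractionHom_subMono [Finite V] (F : TypedForest D T V) (S : Set V) :
    ∀ [Fintype S], contractionHom lam t₀ (F.subMono K S) =
      (F.restrict S).contractionSum lam t₀ := by
  induction S using F.set_induction with
  | empty =>
    intro _
    rw [subMono_empty, map_one, contractionSum_of_isEmpty]
  | tree S hS =>
    intro _
    rw [← mono_restrict, mono_eq_X K hS, contractionHom, MvPolynomial.aeval_X]
    obtain ⟨e, he⟩ := exists_isIso_of_cls_eq (TypedTree.cls_rep ((F.restrict S).cls hS))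
    exact he.contractionSum lam
  | union S U h1 h2 h3 h4 =>
    intro _
    let _ := Fintype.ofFinite U
    let _ := Fintype.ofFinite (S \ U : Set V)
    let _ := Fintype.ofFinite ((↑) ⁻¹' U : Set S)
    let _ := Fintype.ofFinite (((↑) ⁻¹' U)ᶜ : Set S)
    have hE := F.isEmb_restrict S
    rw [F.subMono_eq_mul K h1 h2, map_mul, h3, h4,
      contractionSum_eq_mul lam (F.restrict S) (U := Subtype.val ⁻¹' U) fun u v hp =>
        h2 u u.2 v v.2 (hE.parent.2 hp)]
    congr 1
    · obtain ⟨e, he, -⟩ := (F.isEmb_restrict U).exists_isIso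
        (hE.comp ((F.restrict S).isEmb_restrict ((↑) ⁻¹' U))) (by
          rw [Set.range_comp, Subtype.range_coe, Subtype.range_coe, Subtype.image_preimage_coe,
            Set.inter_eq_right.2 h1])
      exact he.contractionSum lam
    · obtain ⟨e, he, -⟩ := (F.isEmb_restrict (S \ U)).exists_isIso
        (hE.comp ((F.restrict S).isEmb_restrict ((↑) ⁻¹' U)ᶜ)) (by
          rw [Set.range_comp, Subtype.range_coe, Subtype.range_coe, ← Set.preimage_compl,
            Subtype.image_preimage_coe, Set.sdiff_eq])
      exact he.contractionSum lam

theorem contractionHom_mono [Fintype V] (F : TypedForest D T V) :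
    contractionHom lam t₀ (F.mono K) = F.contractionSum lam t₀ := by
  let _ := Fintype.ofFinite (Set.univ : Set V)
  rw [← subMono_univ, contractionHom_subMono]
  exact ((F.isEmb_restrict Set.univ).isIso (e := Equiv.Set.univ V)).contractionSum lam

theorem isContractionMap_contractionHom :
    IsContractionMap lam t₀ (contractionHom (D := D) lam t₀).toLinearMap :=
  fun _ _ F => contractionHom_mono lam F

theorem _root_.IsContractionMap.eq_contractionHom
    {Ψ : ForestAlg K D T →ₗ[K] ForestAlg K (AvoidingTree D T t₀) Unit}
    (h : IsContractionMap lam t₀ Ψ) : Ψ = (contractionHom lam t₀).toLinearMap :=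
  linearMap_ext_mono fun V _ F => (h V F).trans (contractionHom_mono lam F).symm

theorem ckComul_contractionHom (x : ForestAlg K D T) :
    ckComul (fun _ : Unit => (1 : K)) (contractionHom lam t₀ x) =
      TensorProduct.map (contractionHom lam t₀).toLinearMap (contractionHom lam t₀).toLinearMap
        (ckComul lam x) := by
  classical
  refine LinearMap.congr_fun (f := (ckComul fun _ : Unit => (1 : K)).toLinearMap ∘ₗ
    (contractionHom lam t₀).toLinearMap) (g := TensorProduct.map
      (contractionHom lam t₀).toLinearMap (contractionHom lam t₀).toLinearMap ∘ₗ
        (ckComul lam).toLinearMap) ?_ x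
  refine linearMap_ext_mono fun V _ F => ?_
  simp only [LinearMap.comp_apply, AlgHom.toLinearMap_apply, contractionHom_mono,
    ckComul_contractionSum, ckComul_mono, map_sum, map_smul, TensorProduct.map_tmul,
    contractionHom_subMono]

theorem ckCounit_contractionHom (x : ForestAlg K D T) :
    ckCounit K (AvoidingTree D T t₀) Unit (contractionHom lam t₀ x) = ckCounit K D T x := by
  refine AlgHom.congr_fun (φ₁ := (ckCounit K (AvoidingTree D T t₀) Unit).comp
    (contractionHom lam t₀)) (φ₂ := ckCounit K D T) ?_ x
  refine MvPolynomial.algHom_ext fun τ => ?_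
  have hne : Nonempty (Fin τ.exists_cls.choose) := ⟨τ.rep.root τ.isTree_rep⟩
  rw [AlgHom.comp_apply, ← τ.mono_rep K, contractionHom_mono, ← subMono_univ,
    ckCounit_subMono _ Set.univ_nonempty, contractionSum_eq, map_sum]
  refine Finset.sum_eq_zero fun s _ => ?_
  rw [map_smul]
  by_cases h : τ.rep.IsTreePartition t₀ s
  · have : Nonempty (Quotient s) := hne.map (Quotient.mk s)
    rw [contractMono_of h, ckCounit_subMono _ Set.univ_nonempty, smul_zero]
  · rw [contractMono_of_not h, map_zero, smul_zero]

end

/-! ### A forest is determined by its monomial -/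

/-- The multiset of the connected components of a forest. -/
noncomputable def shape [Finite V] (F : TypedForest D T V) : TypedTree D T →₀ ℕ :=
  open Classical in
  letI := Fintype.ofFinite V
  ∑ r : V with F.IsRoot r, Finsupp.single (F.branch r) 1

theorem mono_eq_monomial (K : Type*) [CommRing K] [Fintype V] (F : TypedForest D T V) :
    F.mono K = MvPolynomial.monomial F.shape 1 := by
  classical
  rw [shape, MvPolynomial.monomial_sum_one]
  unfold TypedForest.mono
  refine Finset.prod_congr ?_ fun _ _ => rfl
  ext v
  simp

theorem subMono_eq_monomial (K : Type*) [CommRing K] [Finite V] (F : TypedForest D T V)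
    (S : Set V) : F.subMono K S = MvPolynomial.monomial (F.restrict S).shape 1 := by
  let _ := Fintype.ofFinite S
  rw [← mono_restrict, mono_eq_monomial]

theorem shape_eq_of_mono_eq [Fintype V] [Fintype W] (h : F.mono ℤ = G.mono ℤ) :
    F.shape = G.shape := by
  rw [mono_eq_monomial, mono_eq_monomial] at h
  exact MvPolynomial.monomial_left_injective one_ne_zero h

theorem IsIso.shape [Finite V] [Finite W] {e : V ≃ W} (h : F.IsIso G e) : F.shape = G.shape := by
  let _ := Fintype.ofFinite V
  let _ := Fintype.ofFinite W
  exact shape_eq_of_mono_eq (h.mono ℤ)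

theorem exists_shape_eq (s : TypedTree D T →₀ ℕ) :
    ∃ (V : Type) (_ : Fintype V) (F : TypedForest D T V), F.shape = s := by
  obtain ⟨V, _, F, hF⟩ := exists_mono_eq_monomial ℤ s
  rw [mono_eq_monomial] at hF
  exact ⟨V, inferInstance, F, MvPolynomial.monomial_left_injective one_ne_zero hF⟩

theorem shape_apply [Finite V] (F : TypedForest D T V) (τ : TypedTree D T) :
    F.shape τ = Nat.card {r : {v // F.IsRoot v} // F.branch r = τ} := by
  classical
  let _ := Fintype.ofFinite V
  rw [shape, Finsupp.finsetSum_apply]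
  simp only [Finsupp.single_apply]
  rw [← Finset.card_filter, Finset.filter_filter, Nat.card_eq_fintype_card,
    Fintype.card_congr (Equiv.subtypeSubtypeEquivSubtypeInter (fun v => F.IsRoot v)
      (fun v => F.branch v = τ)), Fintype.card_subtype]

/-- Two forests with the same components have matching roots. -/
theorem exists_equiv_roots [Finite V] [Finite W] (h : F.shape = G.shape) :
    ∃ e : {v // F.IsRoot v} ≃ {w // G.IsRoot w}, ∀ r, G.branch (e r) = F.branch r := by
  have hτ : ∀ τ, Nonempty ({r : {v // F.IsRoot v} // F.branch r = τ} ≃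
      {r : {w // G.IsRoot w} // G.branch r = τ}) := fun τ =>
    Finite.card_eq.1 (by rw [← shape_apply, ← shape_apply, h])
  let f := fun τ => (hτ τ).some
  refine ⟨(Equiv.sigmaFiberEquiv fun r : {v // F.IsRoot v} => F.branch r).symm.trans
    ((Equiv.sigmaCongrRight f).trans (Equiv.sigmaFiberEquiv _)), fun r => ?_⟩
  exact (f (F.branch r) ⟨r, rfl⟩).2

theorem Anc.root_unique {r r' : {v // F.IsRoot v}} {v : V} (h : F.Anc r v) (h' : F.Anc r' v) :
    r = r' := by
  refine Subtype.ext ?_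
  rcases h.total h' with k | k
  · exact k.eq_of_isRoot r'.2
  · exact (k.eq_of_isRoot r.2).symm

/-- Forests with the same components are isomorphic. -/
theorem exists_isIso_of_shape_eq [Finite V] [Finite W] (h : F.shape = G.shape) :
    ∃ e, F.IsIso G e := by
  obtain ⟨e, he⟩ := exists_equiv_roots h
  have hj : ∀ r : {v // F.IsRoot v}, ∃ j : {v | F.Anc r v} → W,
      (F.restrict {v | F.Anc r v}).IsEmb G j ∧ Set.range j = {w | G.Anc (e r) w} := by
    intro r
    obtain ⟨f, hf⟩ := exists_isIso_of_cls_eq (he r).symm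
    refine ⟨_, (G.isEmb_restrict _).comp hf.isEmb, ?_⟩
    rw [Set.range_comp, f.range_eq_univ, Set.image_univ, Subtype.range_coe]
  -- The isomorphism `φ` is made of the embeddings `j r` of the components, `ρ v` being the root
  -- of the component of `v`.
  choose j hj hrange using hj
  have hroot : ∀ v, ∃ r : {v // F.IsRoot v}, F.Anc r v := fun v => by
    obtain ⟨r, hr, h⟩ := F.exists_isRoot_anc v
    exact ⟨⟨r, hr⟩, h⟩
  choose ρ hρ using hroot
  let φ : V → W := fun v => j (ρ v) ⟨v, hρ v⟩
  have hφ : ∀ r v (hv : F.Anc (r : {v // F.IsRoot v}) v), φ v = j r ⟨v, hv⟩ := by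
    intro r v hv
    obtain rfl := Anc.root_unique (hρ v) hv
    rfl
  have hanc : ∀ r v, F.Anc (r : {v // F.IsRoot v}) v → G.Anc (e r) (φ v) := by
    intro r v hv
    rw [hφ r v hv]
    exact (hrange r).subset ⟨_, rfl⟩
  have hinj : Function.Injective φ := by
    intro v v' hvv
    have h1 := hanc _ _ (hρ v)
    have h2 := hanc _ _ (hρ v')
    rw [hvv] at h1
    have h3 := e.injective (Anc.root_unique h1 h2)
    have h4 : F.Anc (ρ v) v' := h3 ▸ hρ v'
    rw [hφ _ _ (hρ v), hφ _ _ h4] at hvv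
    exact congrArg Subtype.val ((hj _).injective hvv)
  have hsurj : ∀ r w, G.Anc (e r) w → ∃ v, F.Anc (r : {v // F.IsRoot v}) v ∧ φ v = w := by
    intro r w hw
    obtain ⟨⟨v, hv⟩, rfl⟩ := (hrange r).symm.subset hw
    exact ⟨v, hv, hφ r v hv⟩
  have hsurj' : Function.Surjective φ := by
    intro w
    obtain ⟨r, hr, h⟩ := G.exists_isRoot_anc w
    obtain ⟨v, -, hv⟩ := hsurj (e.symm ⟨r, hr⟩) w (by rwa [e.apply_symm_apply])
    exact ⟨v, hv⟩
  refine ⟨Equiv.ofBijective φ ⟨hinj, hsurj'⟩, IsEmb.isIso (G := F) ⟨hinj, fun v => ?_, ?_⟩⟩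
  · exact (hj (ρ v)).dec ⟨v, hρ v⟩
  · intro t v v'
    change F.up v = some (t, v') ↔ G.up (φ v) = some (t, φ v')
    have key : ∀ hv' : F.Anc (ρ v) v',
        F.up v = some (t, v') ↔ G.up (φ v) = some (t, φ v') := by
      intro hv'
      rw [hφ _ _ hv', ← (hj (ρ v)).up t ⟨v, hρ v⟩ ⟨v', hv'⟩,
        (F.isEmb_restrict {x | F.Anc (ρ v) x}).up]
    constructor
    · intro hup
      refine (key ((hρ v).of_parent ?_ ⟨t, hup⟩)).1 hup
      intro hr
      have := (ρ v).2
      rw [hr, IsRoot, hup] at this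
      cases this
    · intro hup
      have h1 : G.Anc (e (ρ v)) (φ v') := by
        refine (hanc _ _ (hρ v)).of_parent ?_ ⟨t, hup⟩
        intro hr
        have := (e (ρ v)).2
        rw [hr, IsRoot, hup] at this
        cases this
      obtain ⟨x, hx, hxv⟩ := hsurj _ _ h1
      exact (key (hinj hxv ▸ hx)).2 hup

end TypedForest

namespace TypedForest

variable {D T V W X : Type*} {F : TypedForest D T V} {G : TypedForest D T W} {i : W → V} {t₀ : T}

/-! ### Grafting on the root by edges of a given type -/

/-- `F` is obtained by grafting the forest induced on the complement of `U` on the root `r` of the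
tree induced on `U`, with edges of type `t₀`. -/
structure IsGraft (F : TypedForest D T V) (t₀ : T) (r : V) (U : Set V) : Prop where
  isRoot : F.IsRoot r
  mem : r ∈ U
  trunk : F.IsTrunk Set.univ U
  attach : ∀ v ∉ U, ∀ p ∈ U, ∀ t, F.up v = some (t, p) → t = t₀ ∧ p = r

theorem isTree_restrict_of_trunk (hF : F.IsTree) {r : V} (hr : F.IsRoot r) {U : Set V}
    (hrU : r ∈ U) (hU : F.IsTrunk Set.univ U) :
    (F.restrict U).IsTree ∧ ∀ x, (F.restrict U).IsRoot x ↔ (x : V) = r := by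
  have hE := F.isEmb_restrict U
  have key : ∀ x, (F.restrict U).IsRoot x ↔ (x : V) = r := fun x => by
    rw [← hE.isRoot fun u v hp hv => by
      rw [Subtype.range_coe] at hv ⊢
      exact hU.2 u trivial v hv hp]
    exact ⟨fun h => hF.unique h hr, fun h => h ▸ hr⟩
  exact ⟨⟨⟨r, hrU⟩, (key _).2 rfl, fun y hy => Subtype.ext ((key y).1 hy)⟩, key⟩

theorem IsTrunk.root_mem (hF : F.IsTree) {r : V} (hr : F.IsRoot r) {U : Set V}
    (hU : F.IsTrunk Set.univ U) (hne : U.Nonempty) : r ∈ U := by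
  obtain ⟨x, hx⟩ := hne
  exact hU.mem_of_anc (hF.anc hr x) hx

/-- The two parts of a grafting determine it. -/
theorem IsGraft.exists_isIso (hF : F.IsTree) (hG : G.IsTree) {r : V} {r' : W} {U : Set V}
    {U' : Set W} (h : F.IsGraft t₀ r U) (h' : G.IsGraft t₀ r' U') {e₁ : U ≃ U'}
    (he₁ : (F.restrict U).IsIso (G.restrict U') e₁) {e₂ : (Uᶜ : Set V) ≃ (U'ᶜ : Set W)}
    (he₂ : (F.restrict Uᶜ).IsIso (G.restrict U'ᶜ) e₂) : ∃ e, F.IsIso G e := by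
  classical
  let E : V ≃ W := (Equiv.Set.sumCompl U).symm.trans
    ((Equiv.sumCongr e₁ e₂).trans (Equiv.Set.sumCompl U'))
  have hE₁ : ∀ v (hv : v ∈ U), E v = e₁ ⟨v, hv⟩ := fun v hv => by
    simp [E, Equiv.Set.sumCompl_symm_apply_of_mem hv]
  have hE₂ : ∀ v (hv : v ∈ Uᶜ), E v = e₂ ⟨v, hv⟩ := fun v hv => by
    simp [E, Equiv.Set.sumCompl_symm_apply_of_notMem hv]
  have hFU := isTree_restrict_of_trunk hF h.isRoot h.mem h.trunk
  have hGU := isTree_restrict_of_trunk hG h'.isRoot h'.mem h'.trunk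
  have hEr : E r = r' := by
    rw [hE₁ r h.mem]
    exact (hGU.2 _).1 (he₁.isRoot.2 ((hFU.2 _).2 rfl))
  have hF₁ := F.isEmb_restrict U
  have hG₁ := G.isEmb_restrict U'
  have hF₂ := F.isEmb_restrict Uᶜ
  have hG₂ := G.isEmb_restrict U'ᶜ
  refine ⟨E, fun v => ?_, fun v => ?_⟩
  · by_cases hv : v ∈ U
    · rw [hE₁ v hv]
      exact he₁.1 ⟨v, hv⟩
    · rw [hE₂ v hv]
      exact he₂.1 ⟨v, hv⟩
  · cases hup : F.up v with
    | none =>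
      rw [hF.unique hup h.isRoot, hEr]
      exact h'.isRoot
    | some p =>
      obtain ⟨t, p⟩ := p
      change G.up (E v) = some (t, E p)
      by_cases hv : v ∈ U
      · have hp := h.trunk.2 p trivial v hv ⟨t, hup⟩
        rw [hE₁ v hv, hE₁ p hp, ← hG₁.up, he₁.up_eq_some, hF₁.up]
        exact hup
      · by_cases hp : p ∈ U
        · obtain ⟨rfl, rfl⟩ := h.attach v hv p hp t hup
          rw [hEr, hE₂ v hv]
          have hroot : (F.restrict Uᶜ).IsRoot ⟨v, hv⟩ := by
            by_contra hn
            obtain ⟨q, hq⟩ := exists_parent hn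
            exact q.2 ((hF₂.parent.2 hq).unique ⟨t, hup⟩ ▸ hp)
          have hroot' := he₂.isRoot.2 hroot
          have hnr : ¬ G.IsRoot (e₂ ⟨v, hv⟩ : W) := fun hr =>
            (e₂ ⟨v, hv⟩).2 (hG.unique hr h'.isRoot ▸ h'.mem)
          obtain ⟨⟨t', q⟩, hq⟩ := Option.ne_none_iff_exists'.1 hnr
          have hqU : q ∈ U' := by
            by_contra hqU
            exact ((hG₂.parent (u := ⟨q, hqU⟩)).1 ⟨t', hq⟩).not_isRoot hroot'
          obtain ⟨rfl, rfl⟩ := h'.attach _ (e₂ ⟨v, hv⟩).2 q hqU t' hq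
          exact hq
        · rw [hE₂ v hv, hE₂ p hp, ← hG₂.up, he₂.up_eq_some, hF₂.up]
          exact hup

/-- The part of a tree that remains when all the edges of type `t₀` outgoing from the root are
deleted, together with everything below them. -/
def rootPart (F : TypedForest D T V) (t₀ : T) : Set V :=
  {v | ∀ r w, F.IsRoot r → F.up w = some (t₀, r) → ¬ F.Anc w v}

theorem IsIso.mem_rootPart {e : V ≃ W} (h : F.IsIso G e) (v : V) :
    v ∈ F.rootPart t₀ ↔ e v ∈ G.rootPart t₀ := by
  simp only [rootPart, Set.mem_ofPred_eq]
  refine e.forall_congr fun r => e.forall_congr fun w => ?_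
  rw [h.isRoot, h.up_eq_some, h.anc]

theorem isGraft_rootPart (F : TypedForest D T V) {r : V} (hr : F.IsRoot r)
    (hF : F.IsTree) : F.IsGraft t₀ r (F.rootPart t₀) := by
  refine ⟨hr, fun r' w _ hw h => ?_, ⟨Set.subset_univ _, fun u _ v hv hp r' w hr' hw h =>
    hv r' w hr' hw (h.tail hp)⟩, fun v hv p hp t hup => ?_⟩
  · have := h.eq_of_isRoot hr
    rw [this, hr] at hw
    cases hw
  · simp only [rootPart, Set.mem_ofPred_eq, not_forall, not_not] at hv
    obtain ⟨r', w, hr', hw, h⟩ := hv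
    obtain rfl := hF.unique hr hr'
    by_cases hwv : w = v
    · subst hwv
      rw [hup] at hw
      simpa using hw
    · exact absurd (h.of_parent hwv ⟨t, hup⟩) (hp r w hr' hw)

theorem rootAvoids_rootPart (F : TypedForest D T V) (hF : F.IsTree) :
    (F.restrict (F.rootPart t₀)).RootAvoids t₀ := by
  have hg := F.isGraft_rootPart (t₀ := t₀) (F.isRoot_root hF) hF
  have hU := isTree_restrict_of_trunk hF hg.isRoot hg.mem hg.trunk
  intro x hx v hv
  rw [hU.2] at hx
  rw [(F.isEmb_restrict _).up, hx] at hv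
  exact v.2 _ _ (F.isRoot_root hF) hv Relation.ReflTransGen.refl

/-- `rootPart` is the greatest trunk with no edge of type `t₀` outgoing from the root. -/
theorem subset_rootPart (hF : F.IsTree) {U : Set V} (hU : F.IsTrunk Set.univ U)
    (ha : (F.restrict U).RootAvoids t₀) : U ⊆ F.rootPart t₀ := by
  intro v hv r w hr hw h
  have hwU := hU.mem_of_anc h hv
  have hrU := hU.root_mem hF hr ⟨v, hv⟩
  exact ha ⟨r, hrU⟩ (((isTree_restrict_of_trunk hF hr hrU hU).2 _).2 rfl) ⟨w, hwU⟩
    (((F.isEmb_restrict U).up t₀ _ _).2 hw)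

/-- In a grafting on a tree with no edge of type `t₀` outgoing from the root, that tree is the root
part. -/
theorem IsGraft.eq_rootPart [Finite V] (hF : F.IsTree) {r : V} {U : Set V}
    (h : F.IsGraft t₀ r U) (ha : (F.restrict U).RootAvoids t₀) : U = F.rootPart t₀ := by
  let _ := Fintype.ofFinite V
  refine (subset_rootPart hF h.trunk ha).antisymm fun v hv => ?_
  by_contra hvU
  obtain ⟨u, hu, huv⟩ := exists_anc_boundary hF ⟨r, h.mem⟩ h.trunk hvU
  obtain ⟨huU, p, hp, t, hup⟩ := mem_boundary.1 hu
  obtain ⟨rfl, rfl⟩ := h.attach u huU p hp t hup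
  exact hv p u h.isRoot hup huv

theorem isTree_rootPart (F : TypedForest D T V) (t₀ : T) (hF : F.IsTree) :
    (F.restrict (F.rootPart t₀)).IsTree := by
  have hg := F.isGraft_rootPart (t₀ := t₀) (F.isRoot_root hF) hF
  exact (isTree_restrict_of_trunk hF hg.isRoot hg.mem hg.trunk).1

/-- The class of the subforest induced on `U`, when it is a tree with no edge of type `t₀` outgoing
from the root. -/
noncomputable def avoidingCls [Finite V] (F : TypedForest D T V) {t₀ : T} {U : Set V}
    (h : (F.restrict U).IsTree ∧ (F.restrict U).RootAvoids t₀) : AvoidingTree D T t₀ :=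
  ⟨(F.restrict U).cls h.1, rootAvoids_cls _ _ h.2⟩

/-- A tree is encoded by its root part and the forest grafted on the root. -/
noncomputable def graftCode [Finite V] (F : TypedForest D T V) (t₀ : T) (hF : F.IsTree) :
    AvoidingTree D T t₀ × (TypedTree D T →₀ ℕ) :=
  (F.avoidingCls ⟨F.isTree_rootPart t₀ hF, F.rootAvoids_rootPart hF⟩,
    (F.restrict (F.rootPart t₀)ᶜ).shape)

theorem IsIso.graftCode [Finite V] [Finite W] {e : V ≃ W} (h : F.IsIso G e) (hF : F.IsTree)
    (hG : G.IsTree) : F.graftCode t₀ hF = G.graftCode t₀ hG := by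
  refine Prod.ext (Subtype.ext ?_) ?_
  · exact (h.restrict fun v => h.mem_rootPart v).cls (F.isTree_rootPart t₀ hF)
      (G.isTree_rootPart t₀ hG)
  · exact (h.restrict (S := (F.rootPart t₀)ᶜ) (R := (G.rootPart t₀)ᶜ)
      fun v => not_congr (h.mem_rootPart v)).shape

theorem isTree_glue [Nonempty V] (hF : F.IsTree) {r : V} :
    (F.glue G (some (t₀, r))).IsTree := by
  refine ⟨.inl (F.root hF), ?_, ?_⟩
  · have := F.isRoot_root hF
    simp only [IsRoot] at this
    simp [IsRoot, glue, this]
  · rintro (v | w) h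
    · have : F.IsRoot v := by simpa [IsRoot, glue] using h
      rw [hF.unique this (F.isRoot_root hF)]
    · simp [IsRoot, glue] at h

theorem isGraft_glue {r : V} (hr : F.IsRoot r) :
    (F.glue G (some (t₀, r))).IsGraft t₀ (.inl r) (Set.range .inl) := by
  refine ⟨?_, ⟨r, rfl⟩, ⟨Set.subset_univ _, ?_⟩, ?_⟩
  · simp only [IsRoot] at hr
    simp [IsRoot, glue, hr]
  · rintro (u | u) - _ ⟨v, rfl⟩ ⟨t, h⟩
    · exact ⟨u, rfl⟩
    · simp [glue] at h
  · rintro (v | v) hv _ ⟨p, rfl⟩ t h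
    · exact absurd ⟨v, rfl⟩ hv
    · cases hG : G.up v with
      | none => simpa [glue, hG, eq_comm] using h
      | some q => simp [glue, hG, Prod.ext_iff] at h

end TypedForest

namespace TypedTree

variable {D T : Type*}

open TypedForest

theorem graftCode_bijective (t₀ : T) :
    Function.Bijective fun τ : TypedTree D T => τ.rep.graftCode t₀ τ.isTree_rep := by
  constructor
  · intro τ σ h
    have h₁ := congrArg Subtype.val (congrArg Prod.fst h)
    obtain ⟨e₁, he₁⟩ := exists_isIso_of_cls_eq (hF := τ.rep.isTree_rootPart t₀ τ.isTree_rep)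
      (hG := σ.rep.isTree_rootPart t₀ σ.isTree_rep) h₁
    obtain ⟨e₂, he₂⟩ := exists_isIso_of_shape_eq (congrArg Prod.snd h)
    obtain ⟨e, he⟩ := IsGraft.exists_isIso τ.isTree_rep σ.isTree_rep
      (τ.rep.isGraft_rootPart (τ.rep.isRoot_root τ.isTree_rep) τ.isTree_rep)
      (σ.rep.isGraft_rootPart (σ.rep.isRoot_root σ.isTree_rep) σ.isTree_rep) he₁ he₂
    rw [← τ.cls_rep, ← σ.cls_rep]
    exact he.cls _ _
  · rintro ⟨α, s⟩
    obtain ⟨V, _, G, rfl⟩ := exists_shape_eq s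
    set A := α.1.rep
    have hA : A.IsTree := α.1.isTree_rep
    have : Nonempty (Fin α.1.exists_cls.choose) := ⟨A.root hA⟩
    set r := A.root hA
    have hr : A.IsRoot r := A.isRoot_root hA
    set F := A.glue G (some (t₀, r)) with hFdef
    have hF : F.IsTree := isTree_glue hA
    have hav : A.RootAvoids t₀ := by
      have := α.2
      rw [← α.1.cls_rep] at this
      exact (A.isIso_transport _).symm.rootAvoids this
    obtain ⟨e₁, he₁, -⟩ := (F.isEmb_restrict (Set.range .inl)).exists_isIso
      (A.isEmb_glue_inl G (some (t₀, r))) Subtype.range_coe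
    obtain ⟨e₂, he₂, -⟩ := (F.isEmb_restrict (Set.range .inl)ᶜ).exists_isIso
      (A.isEmb_glue_inr G (some (t₀, r))) (by rw [Subtype.range_coe, Set.compl_range_inl])
    have hU := (isGraft_glue (G := G) (t₀ := t₀) hr).eq_rootPart hF (he₁.symm.rootAvoids hav)
    refine ⟨F.cls hF, ?_⟩
    obtain ⟨e, he⟩ := exists_isIso_of_cls_eq (TypedTree.cls_rep (F.cls hF))
    refine (he.graftCode _ hF).trans (Prod.ext (Subtype.ext ?_) ?_)
    · refine Eq.trans ?_ α.1.cls_rep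
      have key : ∀ U (_ : Set.range .inl = U) (h : (F.restrict U).IsTree),
          (F.restrict U).cls h = A.cls hA := by
        rintro _ rfl h
        exact he₁.cls _ _
      exact key _ hU (F.isTree_rootPart t₀ hF)
    · change (F.restrict (F.rootPart t₀)ᶜ).shape = _
      rw [← hU]
      exact he₂.shape

/-- Trees correspond to pairs made of a tree with no edge of type `t₀` outgoing from the root, and
of a forest, grafted on its root by edges of type `t₀`. -/
noncomputable def graftEquiv (t₀ : T) :
    TypedTree D T ≃ AvoidingTree D T t₀ × (TypedTree D T →₀ ℕ) :=
  Equiv.ofBijective _ (graftCode_bijective t₀)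

theorem graftEquiv_cls {V : Type*} [Finite V] {F : TypedForest D T V} (hF : F.IsTree) (t₀ : T) :
    graftEquiv t₀ (F.cls hF) = F.graftCode t₀ hF := by
  obtain ⟨e, he⟩ := exists_isIso_of_cls_eq (TypedTree.cls_rep (F.cls hF))
  exact he.graftCode (TypedTree.isTree_rep _) hF

/-- The decoration of the root. -/
noncomputable def rootDec (τ : TypedTree D T) : D :=
  Quotient.liftOn (s := typedTreeSetoid D T) τ (fun x => x.2.1.dec (x.2.1.root x.2.2))
    fun _ _ he => he.elim fun _ h => by rw [← h.1, h.root]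

theorem _root_.TypedForest.rootDec_cls {V : Type*} [Finite V] {F : TypedForest D T V}
    (hF : F.IsTree) {r : V} (hr : F.IsRoot r) : (F.cls hF).rootDec = F.dec r := by
  have h := F.isIso_transport (Finite.equivFin V)
  rw [hF.unique hr (F.isRoot_root hF), ← h.1, h.root]
  rfl

end TypedTree

namespace TypedForest

variable {D V : Type*} {F : TypedForest D Unit V}

theorem rootPart_unit (hF : F.IsTree) {r : V} (hr : F.IsRoot r) : F.rootPart () = {r} := by
  ext v
  rw [Set.mem_singleton_iff]
  constructor
  · intro hv
    by_contra hne
    obtain ⟨w, hw, hwv⟩ := (Relation.ReflTransGen.cases_head (hF.anc hr v)).resolve_left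
      (Ne.symm hne)
    obtain ⟨t, hw⟩ := hw
    exact hv r w hr hw hwv
  · rintro rfl
    exact (F.isGraft_rootPart hr hF).mem

/-- Without types, a tree with no edge outgoing from the root is a single vertex. -/
theorem _root_.TypedTree.rootDec_bijective_unit :
    Function.Bijective fun α : AvoidingTree D Unit () => α.1.rootDec := by
  have key : ∀ α : AvoidingTree D Unit (), ∀ v, v = α.1.rep.root α.1.isTree_rep := by
    intro α v
    set F := α.1.rep
    have hF : F.IsTree := α.1.isTree_rep
    have hav : F.RootAvoids () := by
      have := α.2
      rw [← α.1.cls_rep] at this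
      exact (F.isIso_transport _).symm.rootAvoids this
    by_contra hne
    obtain ⟨w, hw, -⟩ := (Relation.ReflTransGen.cases_head
      (hF.anc (F.isRoot_root hF) v)).resolve_left (Ne.symm hne)
    obtain ⟨t, hw⟩ := hw
    exact hav _ (F.isRoot_root hF) w hw
  constructor
  · intro α β h
    have hα := α.1.rep.isRoot_root α.1.isTree_rep
    have hβ := β.1.rep.isRoot_root β.1.isTree_rep
    have hdec : α.1.rootDec = β.1.rootDec := h
    rw [← α.1.cls_rep, ← β.1.cls_rep, rootDec_cls _ hα, rootDec_cls _ hβ] at hdec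
    refine Subtype.ext ?_
    rw [← α.1.cls_rep, ← β.1.cls_rep]
    let e : Fin α.1.exists_cls.choose ≃ Fin β.1.exists_cls.choose :=
      { toFun := fun _ => β.1.rep.root β.1.isTree_rep
        invFun := fun _ => α.1.rep.root α.1.isTree_rep
        left_inv := fun v => (key α v).symm
        right_inv := fun v => (key β v).symm }
    refine IsIso.cls (e := e) ⟨fun v => ?_, fun v => ?_⟩ _ _
    · rw [key α v]
      exact hdec.symm
    · rw [key α v, hα]
      exact hβ
  · intro d
    let A : TypedForest D Unit Unit := ⟨fun _ => d, fun _ => none, ⟨fun a => ⟨a, by simp⟩⟩⟩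
    have hA : A.IsTree := ⟨(), rfl, fun _ _ => rfl⟩
    refine ⟨⟨A.cls hA, A.rootAvoids_cls hA fun r _ v hv => ?_⟩, rootDec_cls hA (r := ()) rfl⟩
    cases hv

/-- Without types, trees correspond to pairs made of the decoration of the root and of the forest
grafted on the root. -/
noncomputable def _root_.TypedTree.rootEquiv :
    TypedTree D Unit ≃ D × (TypedTree D Unit →₀ ℕ) :=
  (TypedTree.graftEquiv ()).trans
    (Equiv.prodCongr (Equiv.ofBijective _ TypedTree.rootDec_bijective_unit) (Equiv.refl _))

theorem rootEquiv_cls [Finite V] (hF : F.IsTree) {r : V} (hr : F.IsRoot r) :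
    TypedTree.rootEquiv (F.cls hF) = (F.dec r, (F.restrict {r}ᶜ).shape) := by
  have hg := F.isGraft_rootPart (t₀ := ()) hr hF
  have h1 := isTree_restrict_of_trunk hF hg.isRoot hg.mem hg.trunk
  refine Prod.ext ?_ ?_
  · change (TypedTree.graftEquiv () (F.cls hF)).1.1.rootDec = _
    rw [TypedTree.graftEquiv_cls]
    exact rootDec_cls h1.1 (r := ⟨r, hg.mem⟩) ((h1.2 _).2 rfl)
  · change (TypedTree.graftEquiv () (F.cls hF)).2 = _
    rw [TypedTree.graftEquiv_cls, ← rootPart_unit hF hr]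
    rfl

end TypedForest

/-! ### Triangular linear maps -/

/-- A linear map whose matrix is triangular with respect to a rank function, with nonzero diagonal
entries, is bijective. -/
theorem Finsupp.bijective_of_triangular {K ι κ : Type*} [Field K] {f : (ι →₀ K) →ₗ[K] κ →₀ K}
    {b : ι → κ} (hb : Function.Bijective b) (rank : κ → ℕ)
    (hdiag : ∀ i, f (single i 1) (b i) ≠ 0)
    (htri : ∀ i k, f (single i 1) k ≠ 0 → k = b i ∨ rank k < rank (b i)) :
    Function.Bijective f := by
  classical
  constructor
  · rw [injective_iff_map_eq_zero]
    intro x hx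
    by_contra hne
    obtain ⟨i, hi, hmax⟩ := Finset.exists_max_image x.support (fun i => rank (b i))
      (Finsupp.support_nonempty_iff.2 hne)
    have hsum : f x = ∑ j ∈ x.support, x j • f (single j 1) := by
      conv_lhs => rw [← x.sum_single, Finsupp.sum, map_sum]
      refine Finset.sum_congr rfl fun j _ => ?_
      rw [← map_smul, smul_single, smul_eq_mul, mul_one]
    have h0 : f x (b i) = x i * f (single i 1) (b i) := by
      rw [hsum, Finsupp.finsetSum_apply, Finset.sum_eq_single_of_mem i hi]
      · rw [smul_apply, smul_eq_mul]
      · intro j hj hji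
        rw [smul_apply, smul_eq_mul]
        by_contra hn
        rcases htri j (b i) (right_ne_zero_of_mul hn) with h | h
        · exact hji (hb.1 h).symm
        · exact absurd h (hmax j hj).not_gt
    rw [hx, Finsupp.zero_apply] at h0
    exact mul_ne_zero (Finsupp.mem_support_iff.1 hi) (hdiag i) h0.symm
  · have key : ∀ k, single k 1 ∈ LinearMap.range f := by
      intro k
      induction h : rank k using Nat.strong_induction_on generalizing k with
      | _ n ih =>
        subst h
        obtain ⟨i, rfl⟩ := hb.2 k
        have hmem : b i ∈ (f (single i 1)).support := Finsupp.mem_support_iff.2 (hdiag i)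
        have hsum := (f (single i 1)).sum_single
        rw [Finsupp.sum, ← Finset.add_sum_erase _ _ hmem] at hsum
        have h1 : ∑ k ∈ (f (single i 1)).support.erase (b i), single k (f (single i 1) k) ∈
            LinearMap.range f := by
          refine Submodule.sum_mem _ fun k hk => ?_
          rw [Finset.mem_erase, Finsupp.mem_support_iff] at hk
          have h2 := (LinearMap.range f).smul_mem (f (single i 1) k)
            (ih _ ((htri i k hk.2).resolve_left hk.1) k rfl)
          rwa [smul_single, smul_eq_mul, mul_one] at h2
        have h3 : single (b i) (f (single i 1) (b i)) ∈ LinearMap.range f := by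
          rw [← add_sub_cancel_right (single (b i) _) (∑ k ∈ _, single k (f (single i 1) k)), hsum]
          exact Submodule.sub_mem _ ⟨_, rfl⟩ h1
        have h4 := (LinearMap.range f).smul_mem (f (single i 1) (b i))⁻¹ h3
        rwa [smul_single, smul_eq_mul, inv_mul_cancel₀ (hdiag i)] at h4
    intro y
    rw [← LinearMap.mem_range, ← y.sum_single, Finsupp.sum]
    refine Submodule.sum_mem _ fun k _ => ?_
    have := (LinearMap.range f).smul_mem (y k) (key k)
    rwa [smul_single, smul_eq_mul, mul_one] at this

namespace TypedForest

variable {D T V W : Type*} {F : TypedForest D T V} {t₀ : T}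

/-! ### The contraction morphism in terms of the block of the root -/

section expansion

variable {K : Type*} [Field K] (lam : T → K)

open Classical in
/-- The pair formed by the tree induced on `U`, if it has no edge of type `t₀` outgoing from its
root, and by the forest induced on the complement of `U`, as a basis vector; zero otherwise. -/
noncomputable def rootTerm (K : Type*) [Field K] [Finite V] (F : TypedForest D T V) (t₀ : T)
    (U : Set V) : AvoidingTree D T t₀ × (TypedTree D T →₀ ℕ) →₀ K :=
  if h : (F.restrict U).IsTree ∧ (F.restrict U).RootAvoids t₀ then
    Finsupp.single (F.avoidingCls h, (F.restrict Uᶜ).shape) 1 else 0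

open Classical in
/-- The linear map that sends a tree to the weighted sum of its pairs (trunk, pruned forest), where
the trunk has no edge of type `t₀` outgoing from the root. -/
noncomputable def rootExpansion (t₀ : T) :
    (TypedTree D T →₀ K) →ₗ[K] AvoidingTree D T t₀ × (TypedTree D T →₀ ℕ) →₀ K :=
  Finsupp.linearCombination K fun τ => ∑ U : Set _ with τ.rep.IsTrunk Set.univ U,
    τ.rep.cutWeight lam Set.univ U • τ.rep.rootTerm K t₀ U

open Classical in
theorem rootExpansion_single (τ : TypedTree D T) :
    rootExpansion lam t₀ (Finsupp.single τ 1) = ∑ U : Set _ with τ.rep.IsTrunk Set.univ U,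
      τ.rep.cutWeight lam Set.univ U • τ.rep.rootTerm K t₀ U := by
  rw [rootExpansion, Finsupp.linearCombination_single, one_smul]

theorem rootTerm_rootPart [Finite V] (hF : F.IsTree) :
    F.rootTerm K t₀ (F.rootPart t₀) = Finsupp.single (F.graftCode t₀ hF) 1 :=
  dif_pos ⟨F.isTree_rootPart t₀ hF, F.rootAvoids_rootPart hF⟩

/-- Among the trunks with no edge of type `t₀` outgoing from the root, the root part is strictly the
largest: this is the triangularity of `rootExpansion`. -/
theorem rootTerm_ne_zero [Finite V] (hF : F.IsTree) {U : Set V} (hU : F.IsTrunk Set.univ U)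
    {k : AvoidingTree D T t₀ × (TypedTree D T →₀ ℕ)} (hk : F.rootTerm K t₀ U k ≠ 0) :
    U = F.rootPart t₀ ∧ k = F.graftCode t₀ hF ∨
      U ≠ F.rootPart t₀ ∧ k.1.1.size < (F.graftCode t₀ hF).1.1.size := by
  classical
  by_cases hUU : U = F.rootPart t₀
  · refine Or.inl ⟨hUU, ?_⟩
    rw [hUU, rootTerm_rootPart hF, Finsupp.single_apply_ne_zero] at hk
    exact hk.1
  · refine Or.inr ⟨hUU, ?_⟩
    unfold rootTerm at hk
    split_ifs at hk with h
    · rw [Finsupp.single_apply_ne_zero] at hk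
      rw [hk.1]
      change U.ncard < (F.rootPart t₀).ncard
      exact Set.ncard_lt_ncard ((subset_rootPart hF hU h.2).ssubset_of_ne hUU)
    · exact absurd rfl hk

/-- Only edges of type `t₀` leave the root part, so that the diagonal entries of `rootExpansion` are
powers of `λ_{t₀}`. -/
theorem cutWeight_rootPart_ne_zero (hlam : lam t₀ ≠ 0) [Fintype V] (hF : F.IsTree) :
    F.cutWeight lam Set.univ (F.rootPart t₀) ≠ 0 := by
  refine Finset.prod_ne_zero_iff.2 fun v _ => ?_
  unfold cutFactor
  split
  · exact one_ne_zero
  · rename_i p hp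
    split_ifs with h
    · have hg := F.isGraft_rootPart (t₀ := t₀) (F.isRoot_root hF) hF
      rwa [(hg.attach v h.2.1 p.2 h.2.2 p.1 hp).1]
    · exact one_ne_zero

theorem rootExpansion_bijective (hlam : lam t₀ ≠ 0) :
    Function.Bijective (rootExpansion (D := D) lam t₀) := by
  classical
  refine Finsupp.bijective_of_triangular (TypedTree.graftEquiv t₀).bijective
    (fun k => k.1.1.size) (fun τ => ?_) fun τ k hk => ?_
  · have hmem : τ.rep.rootPart t₀ ∈ ({U : Set _ | τ.rep.IsTrunk Set.univ U} : Finset _) := by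
      simpa using (τ.rep.isGraft_rootPart (τ.rep.isRoot_root τ.isTree_rep) τ.isTree_rep).trunk
    rw [rootExpansion_single, Finsupp.finsetSum_apply, Finset.sum_eq_single_of_mem _ hmem]
    · rw [rootTerm_rootPart τ.isTree_rep, Finsupp.smul_apply, smul_eq_mul]
      change _ * Finsupp.single _ (1 : K) (τ.rep.graftCode t₀ τ.isTree_rep) ≠ 0
      rw [Finsupp.single_eq_same, mul_one]
      exact cutWeight_rootPart_ne_zero lam hlam τ.isTree_rep
    · intro U hU hne
      rw [Finsupp.smul_apply, smul_eq_mul]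
      by_contra hn
      rcases rootTerm_ne_zero τ.isTree_rep (by simpa using hU) (right_ne_zero_of_mul hn) with h | h
      · exact hne h.1
      · exact lt_irrefl _ h.2
  · rw [rootExpansion_single, Finsupp.finsetSum_apply] at hk
    obtain ⟨U, hU, hk⟩ := Finset.exists_ne_zero_of_sum_ne_zero hk
    rw [Finsupp.smul_apply, smul_eq_mul] at hk
    rcases rootTerm_ne_zero τ.isTree_rep (by simpa using hU) (right_ne_zero_of_mul hk) with h | h
    · exact Or.inl h.2
    · exact Or.inr h.2

/-- The linear map that sends a forest to the tree obtained by grafting it on a root decorated by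
`d`. -/
noncomputable def attachRoot (K : Type*) [Field K] (d : D) :
    ForestAlg K D Unit →ₗ[K] ForestAlg K D Unit :=
  (MvPolynomial.basisMonomials _ K).constr K fun s =>
    MvPolynomial.X (TypedTree.rootEquiv.symm (d, s))

theorem attachRoot_monomial (d : D) (s : TypedTree D Unit →₀ ℕ) :
    attachRoot K d (MvPolynomial.monomial s 1) =
      MvPolynomial.X (TypedTree.rootEquiv.symm (d, s)) := by
  have h := (MvPolynomial.basisMonomials (TypedTree D Unit) K).constr_basis K
    (fun s => (MvPolynomial.X (TypedTree.rootEquiv.symm (d, s)) : ForestAlg K D Unit)) s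
  rwa [MvPolynomial.coe_basisMonomials] at h

/-- The linear map that sends a pair (tree, forest) to the tree obtained by grafting the contracted
forest on a root decorated by the tree. -/
noncomputable def attachContraction (t₀ : T) :
    (AvoidingTree D T t₀ × (TypedTree D T →₀ ℕ) →₀ K) →ₗ[K]
      ForestAlg K (AvoidingTree D T t₀) Unit :=
  Finsupp.linearCombination K fun p =>
    attachRoot K p.1 (contractionHom lam t₀ (MvPolynomial.monomial p.2 1))

theorem outerWeight_top [Fintype V] (F : TypedForest D T V) : F.outerWeight lam ⊤ = 1 := by
  rw [outerWeight_eq]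
  refine Finset.prod_eq_one fun v _ => ?_
  unfold outerFactor
  split
  · rfl
  · exact if_neg fun h => h.2.2 trivial

theorem isTreePartition_top (hF : F.IsTree) (ha : F.RootAvoids t₀) :
    F.IsTreePartition t₀ ⊤ := by
  refine isTreePartition_iff.2 fun v => ?_
  obtain ⟨e, he, -⟩ := (IsIso.refl F).isEmb.exists_isIso
    (F.isEmb_restrict (block ⊤ (Quotient.mk _ v))) (by
      rw [Subtype.range_coe, Equiv.range_eq_univ]
      exact (Set.eq_univ_of_forall fun x => mem_block.2 trivial).symm)
  exact ⟨he.isTree hF, he.rootAvoids ha⟩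

theorem isRoot_contract [Finite V] {s : Setoid V} (h : F.IsTreePartition t₀ s) {q : Quotient s} :
    (contract h).IsRoot q ↔ F.IsRoot (blockRoot h q) := by
  simp [IsRoot, contract]

theorem blockRoot_mk_of_isRoot {s : Setoid V} (h : F.IsTreePartition t₀ s) {r : V}
    (hr : F.IsRoot r) : blockRoot h (Quotient.mk s r) = r :=
  (anc_blockRoot h r).eq_of_isRoot hr

theorem isTree_contract [Finite V] {s : Setoid V} (hF : F.IsTree) (h : F.IsTreePartition t₀ s) :
    (contract h).IsTree := by
  have hr := F.isRoot_root hF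
  refine ⟨Quotient.mk s (F.root hF), ?_, fun q hq => ?_⟩
  · exact (isRoot_contract h).2 ((blockRoot_mk_of_isRoot h hr).symm ▸ hr)
  · dsimp only at hq
    rw [isRoot_contract] at hq
    rw [← hF.unique hq hr, mk_blockRoot]

/-- A contracted tree is obtained by grafting the contraction of the complement of the block of the
root on a root decorated by that block. -/
theorem contractMono_eq_attachRoot [Finite V] {s : Setoid V} (hF : F.IsTree)
    (h : F.IsTreePartition t₀ s) {r : V} (hr : F.IsRoot r) :
    F.contractMono K t₀ s = attachRoot K (F.avoidingCls (h (Quotient.mk s r)))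
      ((F.restrict (block s (Quotient.mk s r))ᶜ).contractMono K t₀ (s.comap (↑))) := by
  let _ := Fintype.ofFinite (Quotient s)
  have hC := isTree_contract hF h
  have hCr : (contract h).IsRoot (Quotient.mk s r) := by
    rwa [isRoot_contract, blockRoot_mk_of_isRoot h hr]
  have hs := s.saturates_block r
  have himage : Quotient.mk s '' block s (Quotient.mk s r) = {Quotient.mk s r} := by
    ext q
    constructor
    · rintro ⟨v, hv, rfl⟩
      exact hv
    · rintro rfl
      exact ⟨r, rfl, rfl⟩
  rw [contractMono_restrict_compl hs h, himage, subMono_eq_monomial, attachRoot_monomial,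
    contractMono_of h, subMono_univ, mono_eq_X K hC]
  congr 1
  rw [Equiv.eq_symm_apply, rootEquiv_cls hC hCr]
  rfl

open Classical in
/-- The contractions of a tree, sorted according to the block of the root. -/
theorem contractionSum_eq_attachContraction [Fintype V] (hF : F.IsTree) :
    F.contractionSum lam t₀ = ∑ U : Set V with F.IsTrunk Set.univ U,
      F.cutWeight lam Set.univ U • attachContraction lam t₀ (F.rootTerm K t₀ U) := by
  set r := F.root hF
  have hr : F.IsRoot r := F.isRoot_root hF
  -- `g U s` is the contraction whose blocks are `U`, which contains the root, and those of `s`.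
  let g : ∀ U : Set V, Setoid (Uᶜ : Set V) → ForestAlg K (AvoidingTree D T t₀) Unit := fun U s =>
    if h : (F.restrict U).IsTree ∧ (F.restrict U).RootAvoids t₀ then
      attachRoot K (F.avoidingCls h) ((F.restrict Uᶜ).contractMono K t₀ s) else 0
  have hg : ∀ U, attachContraction lam t₀ (F.rootTerm K t₀ U) =
      ∑ s, (F.restrict Uᶜ).outerWeight lam s • g U s := by
    intro U
    by_cases h : (F.restrict U).IsTree ∧ (F.restrict U).RootAvoids t₀
    · simp only [rootTerm, g, dif_pos h, attachContraction, Finsupp.linearCombination_single,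
        one_smul]
      rw [← subMono_eq_monomial, contractionHom_subMono, contractionSum_eq, map_sum]
      exact Finset.sum_congr rfl fun s _ => map_smul _ _ _
    · simp only [rootTerm, g, dif_neg h, map_zero, smul_zero, Finset.sum_const_zero]
  -- In the sum below, the only nonzero term is that of the block `U` of the root.
  have hterm : ∀ s, F.outerWeight lam s • F.contractMono K t₀ s =
      ∑ U : Set V with F.IsTrunk Set.univ U,
        if s.Saturates U then
          if s.comap ((↑) : U → V) = ⊤ then F.cutWeight lam Set.univ U •
            ((F.restrict Uᶜ).outerWeight lam (s.comap (↑)) • g U (s.comap (↑))) else 0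
        else 0 := by
    intro s
    by_cases hs : F.IsTreePartition t₀ s
    · have htrunk : F.IsTrunk Set.univ (block s (Quotient.mk s r)) := by
        refine ⟨Set.subset_univ _, fun p _ v hv hp => ?_⟩
        by_contra hpn
        have hv' : Quotient.mk s v = Quotient.mk s r := hv
        have hvp : ¬ s v p := fun h => hpn (mem_block.2 (s.trans (s.symm h) (mem_block.1 hv)))
        have h1 := eq_blockRoot hs hp hvp
        rw [hv', blockRoot_mk_of_isRoot hs hr] at h1
        exact hp.not_isRoot (h1 ▸ hr)
      have hsat := s.saturates_block r
      have htop : s.comap ((↑) : block s (Quotient.mk s r) → V) = ⊤ := by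
        refine eq_top_iff.2 fun x y _ => ?_
        exact s.trans (mem_block.1 x.2) (s.symm (mem_block.1 y.2))
      rw [Finset.sum_eq_single_of_mem (block s (Quotient.mk s r)) (by simpa using htrunk),
        if_pos hsat, if_pos htop, outerWeight_eq_mul lam F htrunk hsat, htop, outerWeight_top,
        one_mul, smul_smul, contractMono_eq_attachRoot hF hs hr]
      · simp only [g]
        rw [dif_pos (hs _)]
      · intro U hU hne
        replace hU : F.IsTrunk Set.univ U := by simpa using hU
        split_ifs with h1 h2
        · have : g U (s.comap (↑)) = 0 := by
            refine dif_neg fun h => hne ?_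
            have hrU := hU.root_mem hF hr ⟨_, ((F.restrict U).root h.1).2⟩
            ext x
            rw [mem_block]
            refine ⟨fun hx => ?_, fun hx => (h1 x r hx).2 hrU⟩
            have : s.comap ((↑) : U → V) ⟨x, hx⟩ ⟨r, hrU⟩ := h2 ▸ trivial
            exact this
          rw [this, smul_zero, smul_zero]
        · rfl
        · rfl
    · rw [contractMono_of_not hs, smul_zero]
      refine (Finset.sum_eq_zero fun U _ => ?_).symm
      split_ifs with h1 h2
      · have : g U (s.comap (↑)) = 0 := by
          simp only [g]
          split_ifs with h
          · rw [contractMono_of_not, map_zero]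
            intro h3
            refine hs ((isTreePartition_iff_restrict h1).2 ⟨?_, h3⟩)
            rw [h2]
            exact isTreePartition_top h.1 h.2
          · rfl
        rw [this, smul_zero, smul_zero]
      · rfl
      · rfl
  simp only [contractionSum_eq, hterm, hg]
  rw [Finset.sum_comm]
  refine Finset.sum_congr rfl fun U _ => ?_
  rw [← Finset.sum_filter, Setoid.sum_saturates U fun s₁ s₂ => if s₁ = ⊤ then
    F.cutWeight lam Set.univ U • ((F.restrict Uᶜ).outerWeight lam s₂ • g U s₂) else 0,
    Finset.sum_eq_single_of_mem ⊤ (Finset.mem_univ _), Finset.smul_sum]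
  · simp
  · intro s _ hs
    simp [hs]

theorem contractionHom_X (τ : TypedTree D T) :
    contractionHom lam t₀ (MvPolynomial.X τ) =
      attachContraction lam t₀ (rootExpansion lam t₀ (Finsupp.single τ 1)) := by
  classical
  rw [← τ.mono_rep K, contractionHom_mono, contractionSum_eq_attachContraction lam τ.isTree_rep,
    rootExpansion_single, map_sum]
  exact Finset.sum_congr rfl fun U _ => (map_smul _ _ _).symm

end expansion

/-! ### Bijectivity -/

section bijective

variable {K : Type*} [Field K] (lam : T → K)

/-- The linear map that sends a forest `s` to the pair `(α, s)`, as a basis vector. -/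
noncomputable def pairWith (K : Type*) [Field K] (α : AvoidingTree D T t₀) :
    ForestAlg K D T →ₗ[K] AvoidingTree D T t₀ × (TypedTree D T →₀ ℕ) →₀ K :=
  (MvPolynomial.basisMonomials _ K).constr K fun s => Finsupp.single (α, s) 1

theorem pairWith_monomial (α : AvoidingTree D T t₀) (s : TypedTree D T →₀ ℕ) :
    pairWith K α (MvPolynomial.monomial s 1) = Finsupp.single (α, s) 1 := by
  have h := (MvPolynomial.basisMonomials (TypedTree D T) K).constr_basis K
    (fun s => (Finsupp.single (α, s) 1 : AvoidingTree D T t₀ × (TypedTree D T →₀ ℕ) →₀ K)) s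
  rwa [MvPolynomial.coe_basisMonomials] at h

theorem attachContraction_pairWith (α : AvoidingTree D T t₀) (x : ForestAlg K D T) :
    attachContraction lam t₀ (pairWith K α x) = attachRoot K α (contractionHom lam t₀ x) := by
  refine LinearMap.congr_fun (f := attachContraction lam t₀ ∘ₗ pairWith K α)
    (g := attachRoot K α ∘ₗ (contractionHom lam t₀).toLinearMap) ?_ x
  refine MvPolynomial.linearMap_ext fun s => LinearMap.ext_ring ?_
  simp only [LinearMap.comp_apply, pairWith_monomial, attachContraction,
    Finsupp.linearCombination_single, one_smul, AlgHom.toLinearMap_apply]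

/-- The forest grafted on the root of a tree has only smaller components. -/
theorem algHom_rootEquiv_congr {A : Type*} [CommRing A] [Algebra K A]
    {f g : ForestAlg K D Unit →ₐ[K] A} (σ : TypedTree D Unit)
    (h : ∀ τ : TypedTree D Unit, τ.size < σ.size →
      f (MvPolynomial.X τ) = g (MvPolynomial.X τ)) :
    f (MvPolynomial.monomial (TypedTree.rootEquiv σ).2 1) =
      g (MvPolynomial.monomial (TypedTree.rootEquiv σ).2 1) := by
  have hr := σ.rep.isRoot_root σ.isTree_rep
  have h2 : (TypedTree.rootEquiv σ).2 =
      (σ.rep.restrict {σ.rep.root σ.isTree_rep}ᶜ).shape := by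
    conv_lhs => rw [← σ.cls_rep]
    rw [rootEquiv_cls σ.isTree_rep hr]
  rw [h2, ← subMono_eq_monomial]
  refine algHom_subMono_congr _ fun τ hτ => h τ (hτ.trans_lt ?_)
  rw [σ.size_eq]
  refine Set.ncard_lt_card fun hc => ?_
  rw [Set.compl_univ_iff] at hc
  exact Set.singleton_ne_empty _ hc

theorem contractionHom_bijective (hlam : lam t₀ ≠ 0) :
    Function.Bijective (contractionHom (D := D) lam t₀) := by
  classical
  let E := LinearEquiv.ofBijective _ (rootExpansion_bijective (D := D) lam hlam)
  have hE : ∀ y, E.symm (rootExpansion lam t₀ y) = y := E.symm_apply_apply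
  let ι : (TypedTree D T →₀ K) →ₗ[K] ForestAlg K D T :=
    Finsupp.linearCombination K MvPolynomial.X
  -- The inverse `Θ`, defined recursively: a tree with root decorated by `α`, on which the forest
  -- `s` is grafted, is sent to the preimage of `(α, Θ s)` by the root expansion.
  obtain ⟨Θ, hΘ⟩ := MvPolynomial.exists_algHom_rec (K := K) (A := ForestAlg K D T)
    (TypedTree.size (D := AvoidingTree D T t₀) (T := Unit))
    (fun Θ σ => ι (E.symm (pairWith K (TypedTree.rootEquiv σ).1
      (Θ (MvPolynomial.monomial (TypedTree.rootEquiv σ).2 1)))))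
    (fun f g σ h => by simp only [algHom_rootEquiv_congr σ h])
  have hroot : ∀ α x, Θ (attachRoot K α x) = ι (E.symm (pairWith K α (Θ x))) := by
    intro α x
    refine LinearMap.congr_fun (f := Θ.toLinearMap ∘ₗ attachRoot K α)
      (g := ι ∘ₗ E.symm.toLinearMap ∘ₗ pairWith K α ∘ₗ Θ.toLinearMap) ?_ x
    refine MvPolynomial.linearMap_ext fun s => LinearMap.ext_ring ?_
    simp only [LinearMap.comp_apply, attachRoot_monomial, AlgHom.toLinearMap_apply, hΘ,
      Equiv.apply_symm_apply, LinearEquiv.coe_coe]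
  have hι : ∀ y, contractionHom lam t₀ (ι y) =
      attachContraction lam t₀ (rootExpansion lam t₀ y) := by
    intro y
    refine LinearMap.congr_fun (f := (contractionHom lam t₀).toLinearMap ∘ₗ ι)
      (g := attachContraction lam t₀ ∘ₗ rootExpansion lam t₀) ?_ y
    refine Finsupp.lhom_ext' fun τ => LinearMap.ext_ring ?_
    simp only [LinearMap.comp_apply, Finsupp.lsingle_apply, AlgHom.toLinearMap_apply, ι,
      Finsupp.linearCombination_single, one_smul, contractionHom_X]
  have hleft : ∀ n, ∀ τ : TypedTree D T, τ.size < n →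
      Θ (contractionHom lam t₀ (MvPolynomial.X τ)) = MvPolynomial.X τ := by
    intro n
    induction n with
    | zero => exact fun _ h => absurd h (Nat.not_lt_zero _)
    | succ n ih =>
      intro τ hτ
      have key : Θ (attachContraction lam t₀ (rootExpansion lam t₀ (Finsupp.single τ 1))) =
          ι (E.symm (rootExpansion lam t₀ (Finsupp.single τ 1))) := by
        rw [rootExpansion_single]
        simp only [map_sum, map_smul]
        refine Finset.sum_congr rfl fun U _ => congrArg _ ?_
        unfold rootTerm
        split_ifs with h
        · rw [attachContraction, Finsupp.linearCombination_single, one_smul, hroot,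
            ← pairWith_monomial, ← subMono_eq_monomial]
          have := algHom_subMono_congr (f := Θ.comp (contractionHom lam t₀)) (g := AlgHom.id K _)
            (S := Uᶜ) τ.rep fun σ hσ => ih σ ?_
          · rw [AlgHom.comp_apply, AlgHom.id_apply] at this
            rw [this]
          · refine hσ.trans_lt (lt_of_lt_of_le ?_ (Nat.lt_succ_iff.1 hτ))
            rw [τ.size_eq]
            refine Set.ncard_lt_card fun hc => ?_
            rw [Set.compl_univ_iff] at hc
            have := ((τ.rep.restrict U).root h.1).2
            simp [hc] at this
        · simp only [map_zero]
      rw [contractionHom_X, key, hE]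
      simp only [ι, Finsupp.linearCombination_single, one_smul]
  have hright : ∀ n, ∀ σ : TypedTree (AvoidingTree D T t₀) Unit, σ.size < n →
      contractionHom lam t₀ (Θ (MvPolynomial.X σ)) = MvPolynomial.X σ := by
    intro n
    induction n with
    | zero => exact fun _ h => absurd h (Nat.not_lt_zero _)
    | succ n ih =>
      intro σ hσ
      have h1 := algHom_rootEquiv_congr (f := (contractionHom lam t₀).comp Θ)
        (g := AlgHom.id K _) σ fun τ hτ => ih τ (by omega)
      rw [AlgHom.comp_apply, AlgHom.id_apply] at h1
      rw [hΘ, hι]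
      change attachContraction lam t₀ (E (E.symm _)) = _
      rw [E.apply_symm_apply, attachContraction_pairWith, h1, attachRoot_monomial, Prod.mk.eta,
        Equiv.symm_apply_apply]
  have h1 : Θ.comp (contractionHom lam t₀) = AlgHom.id K _ :=
    MvPolynomial.algHom_ext fun τ => hleft _ τ (Nat.lt_succ_self _)
  have h2 : (contractionHom lam t₀).comp Θ = AlgHom.id K _ :=
    MvPolynomial.algHom_ext fun σ => hright _ σ (Nat.lt_succ_self _)
  exact ⟨Function.LeftInverse.injective (g := Θ) fun x => AlgHom.congr_fun h1 x,
    Function.RightInverse.surjective (g := Θ) fun x => AlgHom.congr_fun h2 x⟩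

/-- When `λ_{t₀} = 0`, a tree with two vertices and one edge of type `t₀` is in the kernel. -/
theorem contractionHom_not_injective [Nonempty D] (hlam : lam t₀ = 0) :
    ¬ Function.Injective (contractionHom (D := D) lam t₀) := by
  let F : TypedForest D T Bool :=
    { dec := fun _ => Classical.arbitrary D
      up := fun v => if v then some (t₀, false) else none
      wf := by
        refine Subrelation.wf (r := (· < ·)) ?_ wellFounded_lt
        rintro u v ⟨t, h⟩
        cases v <;> simp_all }
  have hF : F.IsTree := ⟨false, rfl, by rintro (_ | _) h <;> simp_all [F, IsRoot]⟩
  intro hinj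
  refine MvPolynomial.X_ne_zero (R := K) (F.cls hF) (hinj ?_)
  rw [← mono_eq_X K hF, contractionHom_mono, map_zero, contractionSum_eq]
  refine Finset.sum_eq_zero fun s _ => ?_
  by_cases hs : F.IsTreePartition t₀ s
  · rw [outerWeight_eq, Finset.prod_eq_zero (i := true) (Finset.mem_univ _), zero_smul]
    -- The two vertices are in different blocks, and the edge between them has weight `λ_{t₀} = 0`.
    have hn : ¬ s true false := by
      intro h
      have hE := F.isEmb_restrict (block s (Quotient.mk s false))
      have hr : (F.restrict (block s (Quotient.mk s false))).IsRoot ⟨false, rfl⟩ := by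
        by_contra hr
        obtain ⟨p, hp⟩ := exists_parent hr
        exact (hE.parent.2 hp).not_isRoot rfl
      exact (hs (Quotient.mk s false)).2 _ hr ⟨true, mem_block.2 h⟩ ((hE.up _ _ _).2 rfl)
    simp [outerFactor, F, hn, hlam]
  · rw [contractMono_of_not hs, smul_zero]

end bijective

end TypedForest

open TypedForest in
theorem proposition26 {K : Type*} [Field K] [CharZero K] {D T : Type*} [Nonempty D]
    (lam : T → K) (t₀ : T) :
    ∃ (S : ForestAlg K D T →ₗ[K] ForestAlg K D T)
      (S' : ForestAlg K (AvoidingTree D T t₀) Unit →ₗ[K] ForestAlg K (AvoidingTree D T t₀) Unit),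
      IsHopfAlgebra (ckComul lam) (ckCounit K D T) S ∧
      IsHopfAlgebra (ckComul fun _ : Unit => (1 : K))
        (ckCounit K (AvoidingTree D T t₀) Unit) S' ∧
      (∃! Ψ : ForestAlg K D T →ₗ[K] ForestAlg K (AvoidingTree D T t₀) Unit,
        IsContractionMap lam t₀ Ψ) ∧
      ∀ Ψ : ForestAlg K D T →ₗ[K] ForestAlg K (AvoidingTree D T t₀) Unit,
        IsContractionMap lam t₀ Ψ →
          IsHopfMorphism (ckComul lam) (ckCounit K D T) S
            (ckComul fun _ : Unit => (1 : K)) (ckCounit K (AvoidingTree D T t₀) Unit) S' Ψ ∧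
          (Function.Bijective Ψ ↔ lam t₀ ≠ 0) := by
  obtain ⟨S, hS⟩ := exists_isHopfAlgebra (D := D) lam
  obtain ⟨S', hS'⟩ := exists_isHopfAlgebra (D := AvoidingTree D T t₀) fun _ : Unit => (1 : K)
  refine ⟨S, S', hS, hS', ⟨_, isContractionMap_contractionHom lam, fun Ψ hΨ =>
    hΨ.eq_contractionHom⟩, fun Ψ hΨ => ?_⟩
  rw [hΨ.eq_contractionHom]
  refine ⟨isHopfMorphism_of_bialgebra hS hS' (ckComul_contractionHom lam)
    (ckCounit_contractionHom lam), fun h hlam => ?_, fun hlam => contractionHom_bijective lam hlam⟩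
  exact contractionHom_not_injective lam hlam h.1
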